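/- **Setting.** Let $d\in\{1,2,3\}$, $T>0$, and let $\Omega\subset\mathbb R^d$ be a polytopal domain with Lipschitz boundary and outward unit normal $\mathbf n$. Let $\mathbf a\in L^\infty(0,T;W^{1,\infty}(\Omega)^d)$ with $\nabla\cdot\mathbf a=0$, let $\Gamma_-=\Gamma_-(t)=\{\mathbf x\in\partial\Omega:\ \mathbf a(t,\mathbf x)\cdot\mathbf n(\mathbf x)<0\}$, and let $u^{\rm in}\in L^2(0,T;C(\overline{\Gamma_-}))$ and $u_0\in C(\overline\Omega)$. For $h>0$ let $\mathcal K_h$ be a simplicial triangulation of $\Omega$ without hanging nodes, with cells of diameter at most $h$ and vertices $\mathbf x_1,\dots,\mathbf x_N$; let $V_h$ be the space of continuous functions on $\overline\Omega$ that are affine on each cell, with Lagrange basis $(\varphi_i)$, and write $v_i=v_h(\mathbf x_i)$ for $v_h\in V_h$. Put $$a(u,w)=\int_\Omega w\,\mathbf a\cdot\nabla u\,d\mathbf x-\int_{\Gamma_-}wu\,\mathbf a\cdot\mathbf n\,d\sigma,\qquad b(w)=-\int_{\Gamma_-}w\,u^{\rm in}\,\mathbf a\cdot\mathbf n\,d\sigma,$$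 $m_{ij}=\int_\Omega\varphi_i\varphi_j\,d\mathbf x$, $m_i=\sum_jm_{ij}$, $\mathcal N_i=\{j:m_{ij}\ne0\}$, $a_{ij}=a(\varphi_j,\varphi_i)$, $b_i=b(\varphi_i)$, and $d_{ij}=\max\{|a_{ij}|,|a_{ji}|\}$ for $i\neq j$. For symmetric correction factors $\alpha_{ij}=\alpha_{ji}\in[0,1]$ and $\beta_{ij}=\beta_{ji}\in[0,1]$ (which may depend on $t$ and on the solution) put $$d_h(w,z)=\sum_iz_i\sum_{j\in\mathcal N_i\setminus\{i\}}(1-\alpha_{ij})d_{ij}(w_i-w_j),\qquad m_h(w,z)=\sum_iz_i\sum_{j\in\mathcal N_i\setminus\{i\}}\beta_{ij}m_{ij}(w_i-w_j).$$ Given an approximate time derivative $\dot u_h(t)\in V_h$, the semi-discrete flux-corrected scheme on $[0,\tau)$ is: find $u_h:[0,\tau)\to V_h$, continuous, locally absolutely continuous on $(0,\tau)$, with $u_i(0)=u_0(\mathbf x_i)$ for all $i$ and, for almost every $t\in(0,\tau)$, $$\sum_iw_im_i\frac{du_i}{dt}+a(u_h,w_h)+d_h(u_h,w_h)=b(w_h)+m_h(\dot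 u_h,w_h)\qquad\forall w_h\in V_h.$$ The generalized coercivity condition (GCC) with $\gamma\in(0,1)$ is $$\frac{\gamma h}{\lambda}\,m_h(\dot u_h,\dot u_h)\le(1-\gamma)\,d_h(u_h,u_h)-m_h(\dot u_h,u_h)\quad\text{for a.e. }t,$$ where $\lambda$ is the maximum velocity $\|\mathbf a\|_{L^\infty((0,T)\times\Omega)}$ (the left side is read as $0$ if $\lambda=0$). In *monolithic convex limiting* (MCL), $\beta=\alpha$ and $\alpha_{ij}f_{ij}=f_{ij}^*$ for all $i$ and $j\in\mathcal N_i\setminus\{i\}$, where $f_{ij}=d_{ij}(u_i-u_j)+m_{ij}(\dot u_i-\dot u_j)$, $\bar u_{ij}=\frac{u_i+u_j}2-\frac{a_{ij}(u_j-u_i)}{2d_{ij}}$ (if $d_{ij}=0$, the products $d_{ij}\bar u_{ij}$ below are $0$), $$f_{ij}^*=\begin{cases}\min\{f_{ij},\,2d_{ij}(u_i^{\max}-\bar u_{ij}),\,2d_{ij}(\bar u_{ji}-u_j^{\min})\}&\text{if }f_{ij}\ge0,\\ \max\{f_{ij},\,2d_{ij}(u_i^{\min}-\bar u_{ij}),\,2d_{ij}(\bar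 u_{ji}-u_j^{\max})\}&\text{if }f_{ij}<0,\end{cases}$$ and $u_i^{\min}$, $u_i^{\max}$ are the infimum and supremum of the values $u_j$, $j\in\mathcal N_i$, together with the values of $u^{\rm in}$ on $\{\mathbf x\in\Gamma_-:\varphi_i(\mathbf x)\ne0\}$. **Theorem.** There is a constant $C$ that depends only on $T$, $\mathbf a$, $u^{\rm in}$, $u_0$ (and the domain $\Omega$), but not on $h$, the triangulation, $\gamma$, the correction factors or $\dot u_h$, such that the following holds. 1. (Stability.) Let $0<\tau\le T$, and let $u_h$ be a solution on $[0,\tau)$ of the flux-corrected scheme, with any approximate time derivative $\dot u_h$ and any symmetric correction factors with values in $[0,1]$ (in particular, those of MCL). If GCC holds on $(0,\tau)$ for $u_h$ and $\dot u_h$ with some $\gamma\in(0,1)$, then $\|u_h(t)\|_{L^2(\Omega)}\le C$ for all $t\in[0,\tau)$. For $\tau=T$ this gives $\|u_h\|_{L^\infty(0,T;L^2(\Omega))}\le C$. 2. (Global existence.) For every $\omega\in[0,1]$, the MCL scheme with $$\dot u_i=\frac1{m_i}\Big(b_i-\sum_{j\in\mathcal N_i}a_{ij}u_j\Big)+\frac{\omega}{m_i}\sum_{j\in\mathcal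 N_i\setminus\{i\}}d_{ij}(u_j-u_i)$$ has a solution on the whole interval $[0,T)$. -/

import Mathlib

open MeasureTheory Set
open scoped NNReal ENNReal RealInnerProductSpace

noncomputable section

namespace AFC

/-- The Euclidean space `ℝ^d`. -/
abbrev E (d : ℕ) : Type := EuclideanSpace ℝ (Fin d)

/-! ### The domain, its boundary and the inlet -/

/-- The boundary of `Ω` is locally the graph of a Lipschitz function over a hyperplane with unit
normal `e`, with `Ω` on one side of it; `g` is the graph function, extended to be constant in the
direction `e`. -/
def HasLipschitzBoundary {d : ℕ} (Ω : Set (E d)) : Prop :=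
  ∀ x ∈ frontier Ω, ∃ (r : ℝ) (e : E d) (L : ℝ≥0) (g : E d → ℝ), 0 < r ∧ ‖e‖ = 1 ∧
    LipschitzWith L g ∧ (∀ (y : E d) (s : ℝ), g (y + s • e) = g y) ∧
    ∀ y ∈ Metric.ball x r, (y ∈ Ω ↔ ⟪e, y⟫ < g y)

/-- A polytopal domain with Lipschitz boundary. -/
structure IsPolytopalDomain {d : ℕ} (Ω : Set (E d)) : Prop where
  isOpen : IsOpen Ω
  isConnected : IsConnected Ω
  polytopal : ∃ S : Finset (Finset (E d)), closure Ω = ⋃ P ∈ S, convexHull ℝ (P : Set (E d))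
  lipschitz : HasLipschitzBoundary Ω

/-- `n` is the outward unit normal to `∂Ω` at a point `x` in the relative interior of a flat piece
of the boundary: near `x` the set `Ω` is the half-space `{y | ⟪y - x, n⟫ < 0}`. -/
def IsOutwardNormal {d : ℕ} (Ω : Set (E d)) (x n : E d) : Prop :=
  x ∈ frontier Ω ∧ ‖n‖ = 1 ∧ ∃ r > 0, ∀ y ∈ Metric.ball x r, (y ∈ Ω ↔ ⟪y - x, n⟫ < 0)

open Classical in
/-- The outward unit normal field on `∂Ω`. On a polytopal domain it is defined up to the
lower-dimensional edges, where the value `0` is used. -/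
def outwardNormal {d : ℕ} (Ω : Set (E d)) (x : E d) : E d :=
  if hx : ∃ n, IsOutwardNormal Ω x n then hx.choose else 0

/-- The surface measure on `∂Ω` : the `(d-1)`-dimensional Hausdorff measure, normalized to agree
with Lebesgue measure on hyperplanes. -/
def surface {d : ℕ} (Ω : Set (E d)) : Measure (E d) :=
  (Measure.euclideanHausdorffMeasure (d - 1)).restrict (frontier Ω)

/-- The inlet `Γ₋ = {x ∈ ∂Ω | b(x) ⬝ n(x) < 0}` of a velocity `b`. -/
def inlet {d : ℕ} (Ω : Set (E d)) (b : E d → E d) : Set (E d) :=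
  {x | x ∈ frontier Ω ∧ ⟪b x, outwardNormal Ω x⟫ < 0}

/-! ### The data -/

/-- `G` is the weak derivative of the vector field `b` in `Ω`. -/
def HasWeakDeriv {d : ℕ} (Ω : Set (E d)) (b : E d → E d) (G : E d → E d →L[ℝ] E d) : Prop :=
  ∀ ψ : E d → ℝ, ContDiff ℝ ((⊤ : ℕ∞) : WithTop ℕ∞) ψ → HasCompactSupport ψ → tsupport ψ ⊆ Ω → ∀ e : E d,
    ∫ x in Ω, fderiv ℝ ψ x e • b x = - ∫ x in Ω, ψ x • G x e

/-- The field `b` is (the representative that is continuous up to the boundary of) a solenoidal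
element of `W^{1,∞}(Ω)^d`, and `b` and its weak derivative are bounded by `M`. -/
def IsSolenoidalW1Inf {d : ℕ} (Ω : Set (E d)) (M : ℝ) (b : E d → E d) : Prop :=
  ContinuousOn b (closure Ω) ∧ (∀ x ∈ closure Ω, ‖b x‖ ≤ M) ∧
  ∃ G : E d → E d →L[ℝ] E d, AEStronglyMeasurable G (volume.restrict Ω) ∧
    (∀ᵐ x ∂(volume.restrict Ω), ‖G x‖ ≤ M) ∧ HasWeakDeriv Ω b G ∧
    ∀ᵐ x ∂(volume.restrict Ω), LinearMap.trace ℝ (E d) (G x : E d →ₗ[ℝ] E d) = 0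

/-- The velocity `a ∈ L^∞(0,T;W^{1,∞}(Ω)^d)` with `∇ ⬝ a = 0`. -/
def IsVelocity {d : ℕ} (Ω : Set (E d)) (T : ℝ) (a : ℝ → E d → E d) : Prop :=
  (∀ x ∈ closure Ω, AEMeasurable (fun t => a t x) (volume.restrict (Ioo 0 T))) ∧
  ∃ M : ℝ, ∀ᵐ t ∂(volume.restrict (Ioo 0 T)), IsSolenoidalW1Inf Ω M (a t)

/-- The inflow data `u_in ∈ L²(0,T;C(closure Γ₋))`; here `Γ₋ = Γ₋(t)` may depend on time, and `B`
is a square integrable bound of the maximum norm. -/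
def IsInflowData {d : ℕ} (Ω : Set (E d)) (T : ℝ) (a : ℝ → E d → E d) (uin : ℝ → E d → ℝ) : Prop :=
  (∀ x ∈ frontier Ω, AEMeasurable (fun t => uin t x)
    (volume.restrict {t | t ∈ Ioo 0 T ∧ x ∈ inlet Ω (a t)})) ∧
  ∃ B : ℝ → ℝ, MemLp B 2 (volume.restrict (Ioo 0 T)) ∧
    ∀ᵐ t ∂(volume.restrict (Ioo 0 T)), ContinuousOn (uin t) (closure (inlet Ω (a t))) ∧
      ∀ x ∈ closure (inlet Ω (a t)), |uin t x| ≤ B t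

/-- The maximum velocity `λ`, the `L^∞` norm of `a`. -/
def maxSpeed {d : ℕ} (Ω : Set (E d)) (T : ℝ) (a : ℝ → E d → E d) : ℝ :=
  (eLpNorm (fun p : ℝ × E d => a p.1 p.2) ∞ (volume.restrict (Ioo 0 T ×ˢ Ω))).toReal

/-! ### The forms of the Galerkin method, at a fixed time -/

/-- `a(v,w) = ∫_Ω w ∇⬝(b v) - ∫_{Γ₋} w v b⬝n` for a velocity `b` with `∇ ⬝ b = 0`, for which
`∇⬝(b v) = b ⬝ ∇v`. -/
def aForm {d : ℕ} (Ω : Set (E d)) (b : E d → E d) (v w : E d → ℝ) : ℝ :=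
  (∫ x in Ω, w x * ⟪b x, gradient v x⟫)
    - ∫ x in inlet Ω b, w x * v x * ⟪b x, outwardNormal Ω x⟫ ∂(surface Ω)

/-- `b(w) = - ∫_{Γ₋} w u_in b⬝n`, for the inflow data `g`. -/
def bForm {d : ℕ} (Ω : Set (E d)) (b : E d → E d) (g : E d → ℝ) (w : E d → ℝ) : ℝ :=
  - ∫ x in inlet Ω b, w x * g x * ⟪b x, outwardNormal Ω x⟫ ∂(surface Ω)

/-! ### Triangulations and `P₁` finite elements -/

/-- A simplicial triangulation of `Ω` without hanging nodes; a cell is given by its vertices. -/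
structure Triangulation {d : ℕ} (Ω : Set (E d)) where
  cells : Finset (Finset (E d))
  card_cell : ∀ K ∈ cells, K.card = d + 1
  indep : ∀ K ∈ cells, AffineIndependent ℝ ((↑) : K → E d)
  cover : ⋃ K ∈ cells, convexHull ℝ (K : Set (E d)) = closure Ω
  conforming : ∀ K ∈ cells, ∀ L ∈ cells,
    convexHull ℝ (K : Set (E d)) ∩ convexHull ℝ (L : Set (E d)) = convexHull ℝ (K ∩ L : Set (E d))

/-- Barycentric coordinates with respect to a non-degenerate simplex. -/
def cellBasis {d : ℕ} (K : Finset (E d)) (hK : AffineIndependent ℝ ((↑) : K → E d))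
    (hc : K.card = d + 1) : AffineBasis K ℝ (E d) where
  toFun := (↑)
  ind' := hK
  tot' := hK.affineSpan_eq_top_iff_card_eq_finrank_add_one.2 (by simpa using hc)

namespace Triangulation

variable {d : ℕ} {Ω : Set (E d)} (𝒯 : Triangulation Ω)

open Classical in
/-- The set of mesh vertices. -/
def vertices : Finset (E d) := 𝒯.cells.biUnion id

/-- The mesh vertices `x_i`, used as the index set of the degrees of freedom. -/
abbrev Node : Type := {p : E d // p ∈ 𝒯.vertices}

open Classical in
/-- The Lagrange basis function `φ_i` : on every cell it is the barycentric coordinate that belongs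
to the vertex `x_i`, and it vanishes on the cells that do not contain `x_i`. -/
def hat (i : 𝒯.Node) (x : E d) : ℝ :=
  if hx : ∃ K : Finset (E d), K ∈ 𝒯.cells ∧ x ∈ convexHull ℝ (K : Set (E d)) then
    if hi : (i : E d) ∈ hx.choose then
      (cellBasis hx.choose (𝒯.indep _ hx.choose_spec.1)
        (𝒯.card_cell _ hx.choose_spec.1)).coord ⟨i, hi⟩ x
    else 0
  else 0

/-- The finite element function `v_h = ∑ v_i φ_i` with nodal values `v`; these functions are the
space `V_h`. -/
def fe (v : 𝒯.Node → ℝ) (x : E d) : ℝ := ∑ i, v i * 𝒯.hat i x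

/-! ### Galerkin and diffusion matrices, at a fixed time -/

/-- The mass matrix `m_ij`. -/
def mass (i j : 𝒯.Node) : ℝ := ∫ x in Ω, 𝒯.hat i x * 𝒯.hat j x

/-- The lumped mass `m_i`. -/
def lumped (i : 𝒯.Node) : ℝ := ∑ j, 𝒯.mass i j

open Classical in
/-- The nodal stencil `N_i`. -/
def stencil (i : 𝒯.Node) : Finset 𝒯.Node := Finset.univ.filter (fun j => 𝒯.mass i j ≠ 0)

open Classical in
/-- The punctured stencil `N_i ∖ {i}`. -/
def stencil' (i : 𝒯.Node) : Finset 𝒯.Node := (𝒯.stencil i).erase i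

/-- The advection matrix `a_ij`. -/
def aMat (b : E d → E d) (i j : 𝒯.Node) : ℝ := aForm Ω b (𝒯.hat j) (𝒯.hat i)

/-- The inflow vector `b_i`. -/
def bVec (b : E d → E d) (g : E d → ℝ) (i : 𝒯.Node) : ℝ := bForm Ω b g (𝒯.hat i)

open Classical in
/-- The artificial diffusion matrix `d_ij`. -/
def dMat (b : E d → E d) (i j : 𝒯.Node) : ℝ :=
  if i = j then - ∑ k ∈ 𝒯.stencil' i, max |𝒯.aMat b i k| |𝒯.aMat b k i|
  else max |𝒯.aMat b i j| |𝒯.aMat b j i|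

/-! ### Algebraic flux correction -/

/-- `d_h(·; w, z) = ∑_i z_i ∑_{j ∈ N_i ∖ {i}} (1 - α_ij) d_ij (w_i - w_j)`. -/
def dForm (b : E d → E d) (α : 𝒯.Node → 𝒯.Node → ℝ) (w z : 𝒯.Node → ℝ) : ℝ :=
  ∑ i, z i * ∑ j ∈ 𝒯.stencil' i, (1 - α i j) * 𝒯.dMat b i j * (w i - w j)

/-- `m_h(·; w, z) = ∑_i z_i ∑_{j ∈ N_i ∖ {i}} β_ij m_ij (w_i - w_j)`. -/
def mForm (β : 𝒯.Node → 𝒯.Node → ℝ) (w z : 𝒯.Node → ℝ) : ℝ :=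
  ∑ i, z i * ∑ j ∈ 𝒯.stencil' i, β i j * 𝒯.mass i j * (w i - w j)

/-- Correction factors: symmetric, with values in `[0,1]`. -/
def IsCorrection (α : 𝒯.Node → 𝒯.Node → ℝ) : Prop :=
  ∀ i j, α i j = α j i ∧ 0 ≤ α i j ∧ α i j ≤ 1

/-- The part `Γ_i⁻` of the inlet on which the trace of `φ_i` is supported. -/
def inletAt (b : E d → E d) (i : 𝒯.Node) : Set (E d) := {x | x ∈ inlet Ω b ∧ 𝒯.hat i x ≠ 0}

/-- The values that enter the local bounds: `u_j` for `j ∈ N_i`, and `u_in` on `Γ_i⁻`. -/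
def localValues (b : E d → E d) (g : E d → ℝ) (v : 𝒯.Node → ℝ) (i : 𝒯.Node) : Set ℝ :=
  v '' {j | j ∈ 𝒯.stencil i} ∪ g '' 𝒯.inletAt b i

/-- The local lower bound `u_i^min`. -/
def uMin (b : E d → E d) (g : E d → ℝ) (v : 𝒯.Node → ℝ) (i : 𝒯.Node) : ℝ :=
  sInf (𝒯.localValues b g v i)

/-- The local upper bound `u_i^max`. -/
def uMax (b : E d → E d) (g : E d → ℝ) (v : 𝒯.Node → ℝ) (i : 𝒯.Node) : ℝ :=
  sSup (𝒯.localValues b g v i)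

/-- The bar state. If `d_ij = 0`, its value is irrelevant: it only enters through `d_ij` times it. -/
def barState (b : E d → E d) (v : 𝒯.Node → ℝ) (i j : 𝒯.Node) : ℝ :=
  (v i + v j) / 2 - 𝒯.aMat b i j * (v j - v i) / (2 * 𝒯.dMat b i j)

/-- The target flux `f_ij = d_ij (u_i - u_j) + m_ij (u̇_i - u̇_j)`; `v'` stands for `u̇`. -/
def flux (b : E d → E d) (v v' : 𝒯.Node → ℝ) (i j : 𝒯.Node) : ℝ :=
  𝒯.dMat b i j * (v i - v j) + 𝒯.mass i j * (v' i - v' j)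

open Classical in
/-- The flux `f_ij^*` of monolithic convex limiting. -/
def mclFlux (b : E d → E d) (g : E d → ℝ) (v v' : 𝒯.Node → ℝ) (i j : 𝒯.Node) : ℝ :=
  if 0 ≤ 𝒯.flux b v v' i j then
    min (𝒯.flux b v v' i j)
      (min (2 * 𝒯.dMat b i j * (𝒯.uMax b g v i - 𝒯.barState b v i j))
        (2 * 𝒯.dMat b i j * (𝒯.barState b v j i - 𝒯.uMin b g v j)))
  else
    max (𝒯.flux b v v' i j)
      (max (2 * 𝒯.dMat b i j * (𝒯.uMin b g v i - 𝒯.barState b v i j))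
        (2 * 𝒯.dMat b i j * (𝒯.barState b v j i - 𝒯.uMax b g v j)))

/-- Correction factors of monolithic convex limiting: `f_ij^* = α_ij f_ij`. They are determined by
this wherever `f_ij ≠ 0`. -/
def IsMCL (b : E d → E d) (g : E d → ℝ) (v v' : 𝒯.Node → ℝ) (α : 𝒯.Node → 𝒯.Node → ℝ) : Prop :=
  𝒯.IsCorrection α ∧
    ∀ i, ∀ j ∈ 𝒯.stencil' i, 𝒯.mclFlux b g v v' i j = α i j * 𝒯.flux b v v' i j

/-- The approximate time derivative `u̇ = u̇^A + u̇^D`, with the amount `ω` of high order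
stabilization. -/
def rate (ω : ℝ) (b : E d → E d) (g : E d → ℝ) (v : 𝒯.Node → ℝ) (i : 𝒯.Node) : ℝ :=
  1 / 𝒯.lumped i * (𝒯.bVec b g i - ∑ j ∈ 𝒯.stencil i, 𝒯.aMat b i j * v j)
    + ω / 𝒯.lumped i * ∑ j ∈ 𝒯.stencil' i, 𝒯.dMat b i j * (v j - v i)

/-- `u` is a solution on `[0,τ)` of the semi-discrete scheme
`∑ w_i m_i du_i/dt + a(u_h,w_h) + d_h(u_h;u_h,w_h) = b(w_h) + m_h(u_h;u̇_h,w_h)` for all `w_h ∈ V_h`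
with `u_h(0) = I_h u₀`. Here `α(t)` are the correction factors in `d_h`, `β(t)` those in `m_h`, and
`u'` is the approximate time derivative `u̇`. As the data are not continuous in time, a solution is
locally absolutely continuous and the equation holds at almost every time. -/
structure IsSolution (a : ℝ → E d → E d) (uin : ℝ → E d → ℝ) (u0 : E d → ℝ) (τ : ℝ)
    (α β : ℝ → 𝒯.Node → 𝒯.Node → ℝ) (u' u : ℝ → 𝒯.Node → ℝ) : Prop where
  continuousOn : ∀ i, ContinuousOn (fun t => u t i) (Ico 0 τ)
  absolutelyContinuous : ∀ i, ∀ s t : ℝ, 0 < s → s ≤ t → t < τ →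
    AbsolutelyContinuousOnInterval (fun r => u r i) s t
  initial : ∀ i : 𝒯.Node, u 0 i = u0 i
  weak : ∀ᵐ t ∂(volume.restrict (Ioo 0 τ)), ∀ w : 𝒯.Node → ℝ,
    ∑ i, w i * 𝒯.lumped i * deriv (fun s => u s i) t + aForm Ω (a t) (𝒯.fe (u t)) (𝒯.fe w)
        + 𝒯.dForm (a t) (α t) (u t) w
      = bForm Ω (a t) (uin t) (𝒯.fe w) + 𝒯.mForm (β t) (u' t) w

/-- The generalized coercivity condition
`(γ h / λ) m_h(u_h;u̇_h,u̇_h) ≤ (1 - γ) d_h(u_h;u_h,u_h) - m_h(u_h;u̇_h,u_h)`, at a fixed time. -/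
def GCC (γ h lam : ℝ) (b : E d → E d) (α β : 𝒯.Node → 𝒯.Node → ℝ) (v' v : 𝒯.Node → ℝ) : Prop :=
  γ * h / lam * 𝒯.mForm β v' v' ≤ (1 - γ) * 𝒯.dForm b α v v - 𝒯.mForm β v' v

end Triangulation

end AFC

end

/-! *Stability.* Testing the scheme with `u_h` itself gives the time derivative of the lumped energy
`∑ i, m_i u_i ^ 2`. Since `a` is solenoidal, `2 u_h a ⬝ ∇ u_h = ∇ ⬝ (u_h ^ 2 a)`. The divergence
theorem on every cell and the cancellation on interior faces leave the flux of `u_h ^ 2` through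
`∂Ω`; its outflow part has the good sign, and the inflow part is absorbed by Young's inequality. GCC
and the nonnegativity of `m_h(v, v)` and `d_h(v, v)` give `m_h(u̇_h, u_h) ≤ d_h(u_h, u_h)`, so only
the energy of the inflow data remains, and the lumped energy dominates the squared `L²` norm. As `a`
is merely Lipschitz with zero distributional divergence, the divergence theorem on a simplex is
obtained by testing with smooth cut-offs that tend to the indicator of the simplex.

*Existence.* The limited flux is the clamp of `f_ij` between two bounds in which `d_ij ū_ij` is a
combination of nodal values with coefficients `d_ij ± a_ij`, so no division occurs. Hence MCL is a
system `u' = F t u` with `F` of Carathéodory type and with an integrable bound, globally Lipschitz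
in `u`, and Picard iteration on the whole of `[0, T]` solves it. For the measurability of `u_i^max`
in time, the supremum of the inflow data over a part of the moving inlet is rewritten as a supremum
over a fixed countable set. -/

noncomputable section

namespace AFC

open Filter Topology

/-! ### Barycentric coordinates of a simplex -/

/-- The vertex sets of non-degenerate `d`-simplices in `ℝ^d`. -/
structure IsSimplex {d : ℕ} (K : Finset (E d)) : Prop where
  card : K.card = d + 1
  indep : AffineIndependent ℝ ((↑) : K → E d)

open Classical in
/-- The barycentric coordinate of the simplex with vertex set `K` that belongs to the vertex `p`.
It is `0` if `p` is not a vertex of `K`, so that sums over `K` extend to sums over all points. -/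
def bary {d : ℕ} (K : Finset (E d)) (p : E d) : E d →ᵃ[ℝ] ℝ :=
  if h : IsSimplex K ∧ p ∈ K then (cellBasis K h.1.indep h.1.card).coord ⟨p, h.2⟩ else 0

/-- The gradient of the barycentric coordinate `bary K p`, which is constant in space. -/
def baryGrad {d : ℕ} (K : Finset (E d)) (p : E d) : E d :=
  (InnerProductSpace.toDual ℝ (E d)).symm (LinearMap.toContinuousLinearMap (bary K p).linear)

/-- The interior of the simplex with vertex set `K`. -/
def openCell {d : ℕ} (K : Finset (E d)) : Set (E d) := {x | ∀ p ∈ K, 0 < bary K p x}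

/-- The relative interior of the face of the simplex `K` opposite to the vertex `k`. -/
def openFace {d : ℕ} (K : Finset (E d)) (k : E d) : Set (E d) :=
  {x | bary K k x = 0 ∧ ∀ p ∈ K, p ≠ k → 0 < bary K p x}

/-- The outward unit normal of the simplex `K` on the face opposite to the vertex `k`. -/
def faceNormal {d : ℕ} (K : Finset (E d)) (k : E d) : E d := -(‖baryGrad K k‖⁻¹ • baryGrad K k)

lemma measure_affineMap_eq_zero {V : Type*} [NormedAddCommGroup V] [NormedSpace ℝ V]
    [FiniteDimensional ℝ V] [MeasurableSpace V] [BorelSpace V] (μ : Measure V)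
    [μ.IsAddHaarMeasure] (f : V →ᵃ[ℝ] ℝ) (hf : ∃ x, f x ≠ 0) : μ {x | f x = 0} = 0 := by
  obtain ⟨x, hx⟩ := hf
  let s : AffineSubspace ℝ V := (AffineSubspace.mk' 0 ⊥).comap f
  have hs : ∀ y, y ∈ s ↔ f y = 0 := fun y => by simp [s]
  have hset : {x | f x = 0} = (s : Set V) := ext fun y => (hs y).symm
  rw [hset]
  exact Measure.addHaar_affineSubspace _ _ fun htop =>
    hx ((hs x).1 (htop ▸ AffineSubspace.mem_top ℝ V x))

section Simplex

variable {d : ℕ} {K : Finset (E d)} {k p x : E d}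

lemma isCompact_convexHull_coe (K : Finset (E d)) : IsCompact (convexHull ℝ (K : Set (E d))) :=
  K.finite_toSet.isCompact_convexHull ℝ

lemma bary_of_notMem (hp : p ∉ K) : bary K p = 0 := by
  simp [bary, hp]

lemma bary_sub (K : Finset (E d)) (p x y : E d) :
    bary K p x - bary K p y = ⟪baryGrad K p, x - y⟫ := by
  rw [baryGrad, InnerProductSpace.toDual_symm_apply, LinearMap.coe_toContinuousLinearMap']
  exact ((bary K p).linearMap_vsub x y).symm

lemma bary_eq_inner (K : Finset (E d)) (p x : E d) :
    bary K p x = ⟪baryGrad K p, x⟫ + bary K p 0 := by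
  rw [← sub_eq_iff_eq_add, bary_sub, sub_zero]

lemma hasFDerivAt_bary (K : Finset (E d)) (p x : E d) :
    HasFDerivAt (bary K p) (innerSL ℝ (baryGrad K p)) x := by
  rw [show (bary K p : E d → ℝ) = fun x => innerSL ℝ (baryGrad K p) x + bary K p 0 from
    funext (bary_eq_inner K p)]
  exact (innerSL ℝ (baryGrad K p)).hasFDerivAt.add_const _

lemma contDiff_bary (K : Finset (E d)) (p : E d) {n : WithTop ℕ∞} : ContDiff ℝ n (bary K p) := by
  rw [show (bary K p : E d → ℝ) = fun x => ⟪baryGrad K p, x⟫ + bary K p 0 from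
    funext (bary_eq_inner K p)]
  exact (contDiff_const.inner ℝ contDiff_id).add contDiff_const

lemma continuous_bary (K : Finset (E d)) (p : E d) : Continuous (bary K p) :=
  (contDiff_bary K p (n := 0)).continuous

lemma isOpen_openCell (K : Finset (E d)) : IsOpen (openCell K) := by
  have : openCell K = ⋂ p ∈ K, {x | 0 < bary K p x} := by ext; simp [openCell]
  rw [this]
  exact isOpen_biInter_finset fun p _ => isOpen_lt continuous_const (continuous_bary K p)

lemma measurableSet_openFace (K : Finset (E d)) (k : E d) : MeasurableSet (openFace K k) := by
  have : openFace K k = {x | bary K k x = 0} ∩ ⋂ p ∈ K, {x | p ≠ k → 0 < bary K p x} := by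
    ext; simp [openFace]
  rw [this]
  refine (measurableSet_eq_fun (continuous_bary K k).measurable measurable_const).inter
    (Finset.measurableSet_biInter _ fun p _ => ?_)
  by_cases h : p = k
  · simp [h]
  · simpa [h] using measurableSet_lt measurable_const (continuous_bary K p).measurable

lemma eventually_bary_pos_of_mem_openFace (hx : x ∈ openFace K k) :
    ∀ᶠ y in 𝓝 x, ∀ p ∈ K, p ≠ k → 0 < bary K p y := by
  refine (Finset.eventually_all K).2 fun p hp => ?_
  by_cases h : p = k
  · simp [h]
  · filter_upwards [(continuous_bary K p).continuousAt.eventually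
      (lt_mem_nhds (hx.2 p hp h))] with y hy _ using hy

lemma inner_sub_faceNormal (hx : x ∈ openFace K k) (y : E d) :
    ⟪y - x, faceNormal K k⟫ = -(‖baryGrad K k‖⁻¹ * bary K k y) := by
  rw [faceNormal, inner_neg_right, inner_smul_right, real_inner_comm, ← bary_sub, hx.1, sub_zero]

namespace IsSimplex

variable (hK : IsSimplex K)
include hK

lemma bary_eq (hp : p ∈ K) : bary K p = (cellBasis K hK.indep hK.card).coord ⟨p, hp⟩ := by
  simp [bary, hp, hK]

lemma sum_bary (x : E d) : ∑ p ∈ K, bary K p x = 1 := by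
  rw [← Finset.sum_coe_sort, ← (cellBasis K hK.indep hK.card).sum_coord_apply_eq_one x]
  exact Finset.sum_congr rfl fun p _ => by rw [hK.bary_eq p.2]

lemma bary_self (hp : p ∈ K) : bary K p p = 1 := by
  rw [hK.bary_eq hp]
  exact (cellBasis K hK.indep hK.card).coord_apply_eq ⟨p, hp⟩

lemma bary_of_ne {q : E d} (hp : p ∈ K) (hq : q ∈ K) (hpq : p ≠ q) : bary K p q = 0 := by
  rw [hK.bary_eq hp]
  exact (cellBasis K hK.indep hK.card).coord_apply_ne (j := ⟨q, hq⟩)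
    fun h => hpq (congrArg Subtype.val h)

lemma mem_convexHull_iff : x ∈ convexHull ℝ (K : Set (E d)) ↔ ∀ p ∈ K, 0 ≤ bary K p x := by
  have hrange : range (cellBasis K hK.indep hK.card) = (K : Set (E d)) :=
    Subtype.range_coe_subtype.trans (ofPred_mem_eq (s := (K : Set (E d))))
  rw [← hrange, (cellBasis K hK.indep hK.card).convexHull_eq_nonneg_coord]
  exact ⟨fun h p hp => by rw [hK.bary_eq hp]; exact h ⟨p, hp⟩,
    fun h p => by rw [← hK.bary_eq p.2]; exact h p p.2⟩

lemma bary_nonneg (hx : x ∈ convexHull ℝ (K : Set (E d))) (p : E d) : 0 ≤ bary K p x := by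
  by_cases hp : p ∈ K
  · exact hK.mem_convexHull_iff.1 hx p hp
  · simp [bary_of_notMem hp]

lemma openCell_subset : openCell K ⊆ convexHull ℝ (K : Set (E d)) :=
  fun _ hx => hK.mem_convexHull_iff.2 fun p hp => (hx p hp).le

lemma openFace_subset : openFace K k ⊆ convexHull ℝ (K : Set (E d)) := by
  refine fun x hx => hK.mem_convexHull_iff.2 fun p hp => ?_
  by_cases h : p = k
  · rw [h, hx.1]
  · exact (hx.2 p hp h).le

lemma volume_diff_openCell : volume (convexHull ℝ (K : Set (E d)) \ openCell K) = 0 := by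
  refine measure_mono_null (t := ⋃ p ∈ K, {x | bary K p x = 0}) ?_
    ((measure_biUnion_null_iff K.countable_toSet).2 fun p hp =>
      measure_affineMap_eq_zero _ _ ⟨p, by simp [hK.bary_self hp]⟩)
  rintro x ⟨hx, hx'⟩
  simp only [openCell, mem_ofPred_eq, not_forall, not_lt] at hx'
  obtain ⟨p, hp, h⟩ := hx'
  exact mem_biUnion hp (le_antisymm h (hK.mem_convexHull_iff.1 hx p hp))

variable [NeZero d]

lemma exists_mem_ne (k : E d) : ∃ p ∈ K, p ≠ k :=
  Finset.exists_mem_ne (by have := NeZero.pos d; have := hK.card; omega) k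

lemma baryGrad_ne_zero (hp : p ∈ K) : baryGrad K p ≠ 0 := by
  intro h0
  obtain ⟨q, hq, hqp⟩ := hK.exists_mem_ne p
  have h := bary_sub K p p q
  rw [h0, hK.bary_self hp, hK.bary_of_ne hp hq hqp.symm, inner_zero_left] at h
  norm_num at h

lemma norm_faceNormal (hk : k ∈ K) : ‖faceNormal K k‖ = 1 := by
  rw [faceNormal, norm_neg]
  exact norm_smul_inv_norm (𝕜 := ℝ) (hK.baryGrad_ne_zero hk)

lemma eventually_mem_convexHull_iff (hk : k ∈ K) (hx : x ∈ openFace K k) :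
    ∀ᶠ y in 𝓝 x, (y ∈ convexHull ℝ (K : Set (E d)) ↔ ⟪y - x, faceNormal K k⟫ ≤ 0) := by
  have hpos : 0 < ‖baryGrad K k‖⁻¹ := inv_pos.2 (norm_pos_iff.2 (hK.baryGrad_ne_zero hk))
  filter_upwards [eventually_bary_pos_of_mem_openFace hx] with y hy
  rw [inner_sub_faceNormal hx, neg_nonpos, mul_nonneg_iff_of_pos_left hpos, hK.mem_convexHull_iff]
  refine ⟨fun h => h k hk, fun h p hp => ?_⟩
  by_cases hpk : p = k
  · rwa [hpk]
  · exact (hy p hp hpk).le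

lemma eventually_mem_openCell_iff (hk : k ∈ K) (hx : x ∈ openFace K k) :
    ∀ᶠ y in 𝓝 x, (y ∈ openCell K ↔ ⟪y - x, faceNormal K k⟫ < 0) := by
  have hpos : 0 < ‖baryGrad K k‖⁻¹ := inv_pos.2 (norm_pos_iff.2 (hK.baryGrad_ne_zero hk))
  filter_upwards [eventually_bary_pos_of_mem_openFace hx] with y hy
  rw [inner_sub_faceNormal hx, neg_lt_zero, mul_pos_iff_of_pos_left hpos]
  refine ⟨fun h => h k hk, fun h p hp => ?_⟩
  by_cases hpk : p = k
  · rwa [hpk]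
  · exact hy p hp hpk

end IsSimplex

end Simplex

/-! ### Integration along hyperplanes -/

section Slices

variable {V : Type*} [NormedAddCommGroup V] [InnerProductSpace ℝ V] {n p x : V}

lemma inner_orthogonal_eq_zero (y : (ℝ ∙ n)ᗮ) : ⟪n, (y : V)⟫ = 0 :=
  Submodule.mem_orthogonal_singleton_iff_inner_right.1 y.2

lemma mem_range_hyperplane (hx : ⟪n, x - p⟫ = 0) :
    x ∈ range fun y : (ℝ ∙ n)ᗮ => (y : V) + p :=
  ⟨⟨x - p, Submodule.mem_orthogonal_singleton_iff_inner_right.2 hx⟩, sub_add_cancel x p⟩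

lemma norm_layer_le (hn : ‖n‖ = 1) {c R A M D ε : ℝ} (hc : 0 < c) (hε : ε ∈ Ioo (0 : ℝ) 1)
    {ρ : ℝ → ℝ} (hρ : ∀ s, ρ s ≠ 0 → s ∈ Icc 0 A) (hD : ∀ s, |ρ s| ≤ D) {f : V → ℝ}
    (hM : ∀ x, |f x| ≤ M) (hR : ∀ x, f x ≠ 0 → x ∈ Metric.closedBall p R)
    (z : ℝ × (ℝ ∙ n)ᗮ) :
    ‖f ((ε / c * z.1) • n + z.2 + p) * ρ z.1‖ ≤
      (Icc 0 A ×ˢ Metric.closedBall 0 (R + A / c)).indicator (fun _ => M * D) z := by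
  have hM0 : 0 ≤ M := (abs_nonneg _).trans (hM 0)
  have hD0 : 0 ≤ D := (abs_nonneg _).trans (hD 0)
  by_cases hz : f ((ε / c * z.1) • n + z.2 + p) * ρ z.1 = 0
  · rw [hz, norm_zero]
    exact indicator_nonneg (fun _ _ => mul_nonneg hM0 hD0) _
  have hz1 := hρ _ (right_ne_zero_of_mul hz)
  have hball := hR _ (left_ne_zero_of_mul hz)
  have hshift : ‖(ε / c * z.1) • n‖ ≤ A / c := by
    rw [norm_smul, hn, mul_one, Real.norm_eq_abs,
      abs_of_nonneg (mul_nonneg (div_pos hε.1 hc).le hz1.1), div_mul_eq_mul_div]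
    gcongr
    nlinarith [hε.1, hε.2, hz1.1, hz1.2]
  have hz2 : z.2 ∈ Metric.closedBall (0 : (ℝ ∙ n)ᗮ) (R + A / c) := by
    rw [mem_closedBall_zero_iff, ← Submodule.norm_coe, show (z.2 : V) =
      ((ε / c * z.1) • n + z.2 + p - p) - (ε / c * z.1) • n by abel]
    exact (norm_sub_le _ _).trans (add_le_add (mem_closedBall_iff_norm.1 hball) hshift)
  rw [indicator_of_mem (mem_prod.2 ⟨hz1, hz2⟩), norm_mul]
  exact mul_le_mul (hM _) (hD _) (norm_nonneg _) hM0

variable [FiniteDimensional ℝ V] [MeasurableSpace V] [BorelSpace V]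

/-- Orthogonal coordinates with respect to the unit vector `n` and the base point `p`: the pair
`(s, y)` stands for the point `s • n + y + p`. -/
def sliceEquiv (p : V) (hn : ‖n‖ = 1) : ℝ × (ℝ ∙ n)ᗮ ≃ᵐ V :=
  (MeasurableEquiv.prodCongr
    (LinearIsometryEquiv.toSpanUnitSingleton (𝕜 := ℝ) n hn).toHomeomorph.toMeasurableEquiv
    (MeasurableEquiv.refl _)).trans ((ℝ ∙ n).measurableEquivProd p).symm

lemma sliceEquiv_apply (p : V) (hn : ‖n‖ = 1) (z : ℝ × (ℝ ∙ n)ᗮ) :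
    sliceEquiv p hn z = z.1 • n + z.2 + p := by
  simp only [sliceEquiv, MeasurableEquiv.trans_apply, Submodule.measurableEquivProd_symm_apply]
  rfl

lemma measurePreserving_sliceEquiv (p : V) (hn : ‖n‖ = 1) :
    MeasurePreserving (sliceEquiv p hn) := by
  have h1 := (LinearIsometryEquiv.toSpanUnitSingleton (𝕜 := ℝ) n hn).measurePreserving.prod
    (MeasurePreserving.id (volume : Measure (ℝ ∙ n)ᗮ))
  have h2 := ((ℝ ∙ n).measurePreserving_measurableEquivProd p).symm
  rw [InnerProductSpace.euclideanHausdorffMeasure_eq_volume] at h2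
  exact h2.comp h1

lemma integral_prod_comp_mul_left {β : Type*} [MeasureSpace β]
    [SFinite (volume : Measure β)] (f : ℝ × β → ℝ) {δ : ℝ} (hδ : 0 < δ) :
    ∫ z, f z = δ * ∫ z : ℝ × β, f (δ * z.1, z.2) := by
  let e : ℝ × β ≃ᵐ ℝ × β := MeasurableEquiv.prodCongr
    (Homeomorph.mulLeft₀ δ hδ.ne').toMeasurableEquiv (MeasurableEquiv.refl _)
  have he : Measure.map e volume = ENNReal.ofReal δ⁻¹ • volume := by
    rw [Measure.volume_eq_prod, show (e : ℝ × β → ℝ × β) = Prod.map (δ * ·) id from rfl,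
      ← Measure.map_prod_map _ _ (measurable_const_mul δ) measurable_id, Measure.map_id,
      Real.map_volume_mul_left hδ.ne', abs_of_pos (inv_pos.2 hδ), Measure.prod_smul_left]
  have h : ∫ z : ℝ × β, f (δ * z.1, z.2) = δ⁻¹ • ∫ z, f z := by
    rw [← ENNReal.toReal_ofReal (inv_pos.2 hδ).le, ← integral_smul_measure, ← he]
    exact (e.measurableEmbedding.integral_map f).symm
  rw [h, smul_eq_mul, mul_inv_cancel_left₀ hδ.ne']

lemma integral_slice (p : V) (hn : ‖n‖ = 1) (f : V → ℝ) {δ : ℝ} (hδ : 0 < δ) :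
    ∫ x, f x = δ * ∫ z : ℝ × (ℝ ∙ n)ᗮ, f ((δ * z.1) • n + z.2 + p) := by
  rw [← (measurePreserving_sliceEquiv p hn).integral_comp' f, integral_prod_comp_mul_left _ hδ]
  simp_rw [sliceEquiv_apply]

lemma measurableEmbedding_hyperplane (p n : V) :
    MeasurableEmbedding fun y : (ℝ ∙ n)ᗮ => (y : V) + p :=
  (Homeomorph.addRight p).measurableEmbedding.comp
    (MeasurableEmbedding.subtype_coe (Submodule.closed_of_finiteDimensional _).measurableSet)

section Hausdorff

variable {m : ℕ} (hm : Module.finrank ℝ V = m + 1) (hn : n ≠ 0) {F : Set V}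
  (hF : ∀ x ∈ F, ⟪n, x - p⟫ = 0)
include hm hn

lemma map_hyperplane (p : V) :
    Measure.map (fun y : (ℝ ∙ n)ᗮ => (y : V) + p) volume =
      μHE[m].restrict (range fun y : (ℝ ∙ n)ᗮ => (y : V) + p) := by
  have hi : Isometry fun y : (ℝ ∙ n)ᗮ => (y : V) + p :=
    (IsometryEquiv.addRight p).isometry.comp isometry_subtype_coe
  have : Fact (Module.finrank ℝ V = m + 1) := ⟨hm⟩
  rw [← hi.map_euclideanHausdorffMeasure,
    ← Submodule.finrank_orthogonal_span_singleton (𝕜 := ℝ) (n := m) hn,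
    InnerProductSpace.euclideanHausdorffMeasure_eq_volume]

include hF

lemma setIntegral_hyperplane (hFm : MeasurableSet F) (f : V → ℝ) :
    ∫ x in F, f x ∂μHE[m] = ∫ y : (ℝ ∙ n)ᗮ, F.indicator f (y + p) := by
  rw [← (measurableEmbedding_hyperplane p n).integral_map (μ := volume), map_hyperplane hm hn p,
    setIntegral_indicator hFm,
    inter_eq_self_of_subset_right fun x hx => mem_range_hyperplane (hF x hx)]

lemma euclideanHausdorffMeasure_lt_top_of_subset_hyperplane (hFb : Bornology.IsBounded F) :
    (μHE[m] : Measure V) F < ∞ := by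
  obtain ⟨R, hR⟩ := hFb.subset_closedBall p
  have hsub : F ⊆ Metric.closedBall p R ∩ range fun y : (ℝ ∙ n)ᗮ => (y : V) + p :=
    fun x hx => ⟨hR hx, mem_range_hyperplane (hF x hx)⟩
  refine (measure_mono hsub).trans_lt ?_
  rw [← Measure.restrict_apply Metric.isClosed_closedBall.measurableSet, ← map_hyperplane hm hn p,
    (measurableEmbedding_hyperplane p n).map_apply]
  refine (measure_mono fun y hy => ?_).trans_lt
    (measure_closedBall_lt_top (x := (0 : (ℝ ∙ n)ᗮ)) (r := R))
  simpa [dist_eq_norm] using hy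

end Hausdorff

lemma integral_layer_eq (hn : ‖n‖ = 1) (p : V) {c ε : ℝ} (hc : 0 < c) (hε : 0 < ε) (ρ : ℝ → ℝ)
    (f : V → ℝ) :
    ∫ x, f x * (ρ (c * ⟪n, x - p⟫ / ε) * ε⁻¹) =
      c⁻¹ * ∫ z : ℝ × (ℝ ∙ n)ᗮ, f ((ε / c * z.1) • n + z.2 + p) * ρ z.1 := by
  have hinner : ∀ z : ℝ × (ℝ ∙ n)ᗮ,
      c * ⟪n, (ε / c * z.1) • n + z.2 + p - p⟫ / ε = z.1 := fun z => by
    rw [add_sub_cancel_right, inner_add_right, inner_smul_right, inner_orthogonal_eq_zero,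
      real_inner_self_eq_norm_sq, hn]
    field_simp
    ring
  rw [integral_slice p hn _ (div_pos hε hc)]
  simp_rw [hinner, ← mul_assoc]
  rw [integral_mul_const]
  field_simp

lemma tendsto_integral_layer (hn : ‖n‖ = 1) {c R M : ℝ} (hc : 0 < c) {ρ : ℝ → ℝ}
    (hρ : Continuous ρ) (hρc : HasCompactSupport ρ) (hρ0 : ∀ s ≤ 0, ρ s = 0)
    {F : ℝ → V → ℝ} {F₀ : V → ℝ} (hFm : ∀ ε, Measurable (F ε)) (hFM : ∀ ε x, |F ε x| ≤ M)
    (hFR : ∀ ε > 0, ∀ x, F ε x ≠ 0 → x ∈ Metric.closedBall p R)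
    (hlim : ∀ᵐ y : (ℝ ∙ n)ᗮ, ∀ s > 0,
      Tendsto (fun ε => F ε ((ε / c * s) • n + y + p)) (𝓝[>] 0) (𝓝 (F₀ (y + p)))) :
    Tendsto (fun ε => ∫ x, F ε x * (ρ (c * ⟪n, x - p⟫ / ε) * ε⁻¹)) (𝓝[>] 0)
      (𝓝 (c⁻¹ * ((∫ s, ρ s) * ∫ y : (ℝ ∙ n)ᗮ, F₀ (y + p)))) := by
  obtain ⟨D, hD⟩ := hρ.bounded_above_of_compact_support hρc
  obtain ⟨A, hA⟩ := hρc.isCompact.isBounded.subset_closedBall 0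
  have hρA : ∀ s, ρ s ≠ 0 → s ∈ Icc 0 A := fun s hs =>
    ⟨le_of_not_ge fun h => hs (hρ0 s h),
      (le_abs_self s).trans (by simpa using hA (subset_tsupport ρ hs))⟩
  have hrescale : (fun ε => c⁻¹ *
      ∫ z : ℝ × (ℝ ∙ n)ᗮ, F ε ((ε / c * z.1) • n + z.2 + p) * ρ z.1) =ᶠ[𝓝[>] 0]
      fun ε => ∫ x, F ε x * (ρ (c * ⟪n, x - p⟫ / ε) * ε⁻¹) := by
    filter_upwards [self_mem_nhdsWithin] with ε hε
      using (integral_layer_eq hn p hc hε ρ (F ε)).symm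
  rw [← integral_prod_mul ρ fun y : (ℝ ∙ n)ᗮ => F₀ (y + p)]
  refine Tendsto.congr' hrescale (Tendsto.const_mul _ ?_)
  refine tendsto_integral_filter_of_dominated_convergence
    ((Icc 0 A ×ˢ Metric.closedBall 0 (R + A / c)).indicator fun _ => M * D) ?_ ?_ ?_ ?_
  · refine Eventually.of_forall fun ε => ?_
    have hX : Measurable fun z : ℝ × (ℝ ∙ n)ᗮ => (ε / c * z.1) • n + z.2 + p := by fun_prop
    exact (((hFm ε).comp hX).mul (hρ.measurable.comp measurable_fst)).aestronglyMeasurable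
  · filter_upwards [Ioo_mem_nhdsGT (zero_lt_one (α := ℝ))] with ε hε
      using Eventually.of_forall (norm_layer_le hn hc hε hρA hD (hFM ε) (hFR ε hε.1))
  · refine (integrable_indicator_iff
      (measurableSet_Icc.prod Metric.isClosed_closedBall.measurableSet)).2 (integrableOn_const ?_)
    rw [Measure.volume_eq_prod, Measure.prod_prod]
    exact (ENNReal.mul_lt_top measure_Icc_lt_top measure_closedBall_lt_top).ne
  · have hlim' : ∀ᵐ z : ℝ × (ℝ ∙ n)ᗮ, ∀ s > 0,
        Tendsto (fun ε => F ε ((ε / c * s) • n + z.2 + p)) (𝓝[>] 0) (𝓝 (F₀ (z.2 + p))) :=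
      Measure.quasiMeasurePreserving_snd.ae hlim
    filter_upwards [hlim'] with z hz
    rcases le_or_gt z.1 0 with hz1 | hz1
    · simp [hρ0 z.1 hz1]
    · simpa only [mul_comm] using (hz z.1 hz1).mul_const (ρ z.1)

end Slices

/-! ### The divergence theorem on a simplex -/

/-- A smooth function that is `0` on `(-∞,1]` and `1` on `[2,∞)`; products of `ramp`s of scaled
barycentric coordinates are the cut-off functions of a simplex. -/
def ramp (s : ℝ) : ℝ := Real.smoothTransition (s - 1)

section Ramp

variable {s : ℝ}

lemma contDiff_ramp {n : ℕ∞} : ContDiff ℝ n ramp :=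
  Real.smoothTransition.contDiff.comp (contDiff_id.sub contDiff_const)

lemma ramp_nonneg (s : ℝ) : 0 ≤ ramp s := Real.smoothTransition.nonneg _

lemma ramp_le_one (s : ℝ) : ramp s ≤ 1 := Real.smoothTransition.le_one _

lemma ramp_of_le (hs : s ≤ 1) : ramp s = 0 :=
  Real.smoothTransition.zero_of_nonpos (sub_nonpos.2 hs)

lemma ramp_of_ge (hs : 2 ≤ s) : ramp s = 1 :=
  Real.smoothTransition.one_of_one_le (by linarith)

lemma hasDerivAt_ramp (s : ℝ) : HasDerivAt ramp (deriv ramp s) s :=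
  ((contDiff_ramp (n := 1)).differentiable (by norm_num) s).hasDerivAt

lemma continuous_deriv_ramp : Continuous (deriv ramp) :=
  (contDiff_ramp (n := 1)).continuous_deriv (by norm_num)

lemma deriv_ramp_of_le (hs : s ≤ 1) : deriv ramp s = 0 :=
  IsLocalMin.deriv_eq_zero <| Eventually.of_forall fun y => by
    rw [ramp_of_le hs]; exact ramp_nonneg y

lemma deriv_ramp_of_ge (hs : 2 ≤ s) : deriv ramp s = 0 :=
  IsLocalMax.deriv_eq_zero <| Eventually.of_forall fun y => by
    rw [ramp_of_ge hs]; exact ramp_le_one y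

lemma hasCompactSupport_deriv_ramp : HasCompactSupport (deriv ramp) := by
  refine HasCompactSupport.intro (isCompact_Icc (a := (1 : ℝ)) (b := 2)) fun s hs => ?_
  rcases not_and_or.1 hs with h | h
  · exact deriv_ramp_of_le (not_le.1 h).le
  · exact deriv_ramp_of_ge (not_le.1 h).le

lemma integral_deriv_ramp : ∫ s, deriv ramp s = 1 := by
  rw [integral_of_hasDerivAt_of_tendsto (m := 0) (n := 1) hasDerivAt_ramp
    (continuous_deriv_ramp.integrable_of_hasCompactSupport hasCompactSupport_deriv_ramp), sub_zero]
  · refine tendsto_const_nhds.congr' ?_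
    filter_upwards [eventually_le_atBot 1] with s hs using (ramp_of_le hs).symm
  · refine tendsto_const_nhds.congr' ?_
    filter_upwards [eventually_ge_atTop 2] with s hs using (ramp_of_ge hs).symm

lemma prod_ramp_mem_Icc {ι : Type*} (s : Finset ι) (g : ι → ℝ) :
    ∏ l ∈ s, ramp (g l) ∈ Icc (0 : ℝ) 1 :=
  ⟨Finset.prod_nonneg fun _ _ => ramp_nonneg _,
    Finset.prod_le_one (fun _ _ => ramp_nonneg _) fun _ _ => ramp_le_one _⟩

lemma eventually_ramp_div_eq_one {g : ℝ → ℝ} {y : ℝ} (hg : Tendsto g (𝓝[>] 0) (𝓝 y))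
    (hy : 0 < y) : ∀ᶠ ε in 𝓝[>] 0, ramp (g ε / ε) = 1 := by
  have hlim : Tendsto (fun ε => g ε / ε) (𝓝[>] 0) atTop :=
    hg.pos_mul_atTop hy tendsto_inv_nhdsGT_zero
  filter_upwards [hlim.eventually_ge_atTop 2] with ε hε using ramp_of_ge hε

lemma eventually_ramp_div_eq_zero {g : ℝ → ℝ} {y : ℝ} (hg : Tendsto g (𝓝[>] 0) (𝓝 y))
    (hy : y < 0) : ∀ᶠ ε in 𝓝[>] 0, ramp (g ε / ε) = 0 := by
  filter_upwards [hg.eventually (gt_mem_nhds hy), self_mem_nhdsWithin] with ε hgε hε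
    using ramp_of_le ((div_nonpos_of_nonpos_of_nonneg hgε.le (le_of_lt hε)).trans zero_le_one)

end Ramp

/-- The field `b` is solenoidal in the open set `U`, in the sense of distributions. -/
def IsSolenoidalOn {V : Type*} [NormedAddCommGroup V] [InnerProductSpace ℝ V]
    [FiniteDimensional ℝ V] [MeasurableSpace V] [BorelSpace V] (b : V → V) (U : Set V) : Prop :=
  ∀ φ : V → ℝ, ContDiff ℝ (⊤ : ℕ∞) φ → HasCompactSupport φ → tsupport φ ⊆ U →
    ∫ x, fderiv ℝ φ x (b x) = 0

lemma IsSolenoidalOn.mono {V : Type*} [NormedAddCommGroup V] [InnerProductSpace ℝ V]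
    [FiniteDimensional ℝ V] [MeasurableSpace V] [BorelSpace V] {b : V → V} {U U' : Set V}
    (hb : IsSolenoidalOn b U) (h : U' ⊆ U) : IsSolenoidalOn b U' :=
  fun φ hφ hc hs => hb φ hφ hc (hs.trans h)

section Cutoff

variable {d : ℕ} {K : Finset (E d)} {k x : E d} {ε : ℝ}

/-- A smooth cut-off function with compact support in the interior of the simplex `K`. -/
def cellCutoff (K : Finset (E d)) (ε : ℝ) (x : E d) : ℝ := ∏ l ∈ K, ramp (bary K l x / ε)

open Classical in
/-- The cut-off function of the simplex `K` without the factor that vanishes near the face opposite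
to `k`. -/
def sideCutoff (K : Finset (E d)) (k : E d) (ε : ℝ) (x : E d) : ℝ :=
  ∏ l ∈ K.erase k, ramp (bary K l x / ε)

lemma contDiff_ramp_bary (K : Finset (E d)) (l : E d) (ε : ℝ) {n : ℕ∞} :
    ContDiff ℝ n fun x => ramp (bary K l x / ε) :=
  contDiff_ramp.comp ((contDiff_bary K l).div_const ε)

lemma contDiff_cellCutoff (K : Finset (E d)) (ε : ℝ) {n : ℕ∞} :
    ContDiff ℝ n (cellCutoff K ε) :=
  contDiff_prod fun l _ => contDiff_ramp_bary K l ε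

lemma continuous_sideCutoff (K : Finset (E d)) (k : E d) (ε : ℝ) :
    Continuous (sideCutoff K k ε) :=
  continuous_finsetProd _ fun l _ => (contDiff_ramp_bary K l ε (n := 0)).continuous

lemma continuous_deriv_ramp_bary (K : Finset (E d)) (k : E d) (ε : ℝ) :
    Continuous fun x => deriv ramp (bary K k x / ε) :=
  continuous_deriv_ramp.comp ((continuous_bary K k).div_const ε)

lemma cellCutoff_mem_Icc (K : Finset (E d)) (ε : ℝ) (x : E d) :
    cellCutoff K ε x ∈ Icc (0 : ℝ) 1 :=
  prod_ramp_mem_Icc _ _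

lemma sideCutoff_mem_Icc (K : Finset (E d)) (k : E d) (ε : ℝ) (x : E d) :
    sideCutoff K k ε x ∈ Icc (0 : ℝ) 1 :=
  prod_ramp_mem_Icc _ _

lemma sideCutoff_mul_deriv_eq_zero (hε : 0 < ε) (hx : x ∉ openCell K) :
    sideCutoff K k ε x * deriv ramp (bary K k x / ε) = 0 := by
  simp only [openCell, mem_ofPred_eq, not_forall, not_lt] at hx
  obtain ⟨p, hp, h⟩ := hx
  have hle : bary K p x / ε ≤ 1 := (div_nonpos_of_nonpos_of_nonneg h hε.le).trans zero_le_one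
  by_cases hpk : p = k
  · rw [← hpk, deriv_ramp_of_le hle, mul_zero]
  · rw [sideCutoff, Finset.prod_eq_zero (Finset.mem_erase.2 ⟨hpk, hp⟩) (ramp_of_le hle), zero_mul]

lemma fderiv_cellCutoff (K : Finset (E d)) (ε : ℝ) (x v : E d) :
    fderiv ℝ (cellCutoff K ε) x v = ∑ k ∈ K, ⟪baryGrad K k, v⟫ *
      (sideCutoff K k ε x * (deriv ramp (bary K k x / ε) * ε⁻¹)) := by
  classical
  have hramp : ∀ l ∈ K, HasFDerivAt (fun x => ramp (bary K l x / ε))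
      ((deriv ramp (bary K l x / ε) * ε⁻¹) • innerSL ℝ (baryGrad K l)) x := fun l _ => by
    have hdiv := (hasFDerivAt_bary K l x).mul_const ε⁻¹
    simp only [← div_eq_mul_inv] at hdiv
    have hcomp := (hasDerivAt_ramp (bary K l x / ε)).comp_hasFDerivAt x hdiv
    rwa [smul_smul] at hcomp
  have hprod : HasFDerivAt (cellCutoff K ε) _ x := HasFDerivAt.finsetProd hramp
  rw [hprod.fderiv, sum_apply]
  refine Finset.sum_congr rfl fun k _ => ?_
  simp only [sideCutoff, smul_apply, innerSL_apply_apply, smul_eq_mul]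
  ring

lemma tsupport_cellCutoff_subset (hε : 0 < ε) : tsupport (cellCutoff K ε) ⊆ openCell K := by
  have hclosed : IsClosed {x | ∀ p ∈ K, ε ≤ bary K p x} := by
    have : {x | ∀ p ∈ K, ε ≤ bary K p x} = ⋂ p ∈ K, {x | ε ≤ bary K p x} := by ext; simp
    rw [this]
    exact isClosed_biInter fun p _ => isClosed_le continuous_const (continuous_bary K p)
  have hsupp : Function.support (cellCutoff K ε) ⊆ {x | ∀ p ∈ K, ε ≤ bary K p x} := by
    intro x hx p hp
    by_contra! h
    exact hx (Finset.prod_eq_zero hp (ramp_of_le ((div_le_one hε).2 h.le)))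
  exact (closure_minimal hsupp hclosed).trans fun x hx p hp => hε.trans_le (hx p hp)

lemma eventually_cellCutoff_eq_one (hx : x ∈ openCell K) :
    ∀ᶠ ε in 𝓝[>] (0 : ℝ), cellCutoff K ε x = 1 := by
  have : ∀ᶠ ε in 𝓝[>] (0 : ℝ), ∀ p ∈ K, ramp (bary K p x / ε) = 1 :=
    (Finset.eventually_all K).2 fun p hp =>
      eventually_ramp_div_eq_one tendsto_const_nhds (hx p hp)
  filter_upwards [this] with ε h using Finset.prod_eq_one h

lemma tendsto_integral_cellCutoff_mul {f : E d → ℝ} (hf : IntegrableOn f (openCell K)) :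
    Tendsto (fun ε => ∫ x in openCell K, cellCutoff K ε x * f x) (𝓝[>] 0)
      (𝓝 (∫ x in openCell K, f x)) := by
  refine tendsto_integral_filter_of_dominated_convergence (fun x => ‖f x‖)
    (Eventually.of_forall fun ε => ?_)
    (Eventually.of_forall fun ε => Eventually.of_forall fun x => ?_) hf.norm ?_
  · exact (contDiff_cellCutoff K ε (n := 0)).continuous.aestronglyMeasurable.mul
      hf.aestronglyMeasurable
  · have hmem := cellCutoff_mem_Icc K ε x
    rw [norm_mul, Real.norm_of_nonneg hmem.1]
    exact mul_le_of_le_one_left (norm_nonneg _) hmem.2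
  · filter_upwards [ae_restrict_mem (isOpen_openCell K).measurableSet] with x hx
    refine tendsto_const_nhds.congr' ?_
    filter_upwards [eventually_cellCutoff_eq_one hx] with ε h
    rw [h, one_mul]

lemma eventually_mem_openCell_of_mem_openFace {v : E d} (hx : x ∈ openFace K k)
    (hv : 0 < ⟪baryGrad K k, v⟫) : ∀ᶠ ε in 𝓝[>] (0 : ℝ), x + ε • v ∈ openCell K := by
  have hlim : Tendsto (fun ε : ℝ => x + ε • v) (𝓝[>] 0) (𝓝 x) :=
    (Continuous.tendsto' (by fun_prop) 0 x (by simp)).mono_left nhdsWithin_le_nhds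
  filter_upwards [hlim.eventually (eventually_bary_pos_of_mem_openFace hx), self_mem_nhdsWithin]
    with ε hpos hε p hp
  by_cases hpk : p = k
  · have h := bary_sub K k (x + ε • v) x
    rw [hx.1, sub_zero, add_sub_cancel_left, inner_smul_right] at h
    rw [hpk, h]
    exact mul_pos hε hv
  · exact hpos p hp hpk

end Cutoff

lemma inner_neg_faceNormal {d : ℕ} (K : Finset (E d)) (k : E d) :
    ⟪baryGrad K k, -faceNormal K k⟫ = ‖baryGrad K k‖ := by
  rw [faceNormal, neg_neg, inner_smul_right, real_inner_self_eq_norm_sq, pow_two,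
    ← mul_assoc, inv_mul_mul_self]

lemma abs_indicator_mul_sideCutoff_le {d : ℕ} {K : Finset (E d)} {s : Set (E d)} {f : E d → ℝ}
    {M : ℝ} (hM0 : 0 ≤ M) (hM : ∀ x ∈ s, ‖f x‖ ≤ M) (k : E d) (ε : ℝ) (x : E d) :
    |s.indicator f x * sideCutoff K k ε x| ≤ M := by
  have hside := sideCutoff_mem_Icc K k ε x
  rw [abs_mul, abs_of_nonneg hside.1]
  have hind : |s.indicator f x| ≤ M := by
    by_cases hx : x ∈ s
    · exact (congrArg abs (indicator_of_mem hx f)).trans_le (hM x hx)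
    · rwa [indicator_of_notMem hx, abs_zero]
  exact (mul_le_of_le_one_right (abs_nonneg _) hside.2).trans hind

namespace IsSimplex

variable {d : ℕ} {K : Finset (E d)} {k p x : E d} (hK : IsSimplex K)
include hK

lemma inner_faceNormal_sub [NeZero d] (hk : k ∈ K) (hp : bary K k p = 0) (x : E d) :
    ‖baryGrad K k‖ * ⟪-faceNormal K k, x - p⟫ = bary K k x := by
  have hne : ‖baryGrad K k‖ ≠ 0 := norm_ne_zero_iff.2 (hK.baryGrad_ne_zero hk)
  rw [faceNormal, neg_neg, real_inner_smul_left, ← bary_sub, hp, sub_zero,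
    mul_inv_cancel_left₀ hne]

lemma tendsto_sideCutoff_mul {f : E d → ℝ} {v : E d}
    (hf : ContinuousOn f (convexHull ℝ (K : Set (E d))))
    (hv : 0 < ⟪baryGrad K k, v⟫) (hxk : bary K k x = 0)
    (hx : ∀ l ∈ K, l ≠ k → bary K l x ≠ 0) :
    Tendsto (fun ε => (convexHull ℝ (K : Set (E d))).indicator f (x + ε • v) *
      sideCutoff K k ε (x + ε • v)) (𝓝[>] 0) (𝓝 ((openFace K k).indicator f x)) := by
  have hlim : Tendsto (fun ε : ℝ => x + ε • v) (𝓝[>] 0) (𝓝 x) :=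
    (Continuous.tendsto' (by fun_prop) 0 x (by simp)).mono_left nhdsWithin_le_nhds
  have hbary : ∀ l, Tendsto (fun ε : ℝ => bary K l (x + ε • v)) (𝓝[>] 0) (𝓝 (bary K l x)) :=
    fun l => ((continuous_bary K l).tendsto x).comp hlim
  by_cases hF : x ∈ openFace K k
  · have hmem : ∀ᶠ ε in 𝓝[>] (0 : ℝ), x + ε • v ∈ convexHull ℝ (K : Set (E d)) :=
      (eventually_mem_openCell_of_mem_openFace hF hv).mono fun _ h => hK.openCell_subset h
    have hone : ∀ᶠ ε in 𝓝[>] (0 : ℝ), ∀ l ∈ K, l ≠ k → ramp (bary K l (x + ε • v) / ε) = 1 := by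
      refine (Finset.eventually_all K).2 fun l hl => ?_
      by_cases hlk : l = k
      · simp [hlk]
      · exact (eventually_ramp_div_eq_one (hbary l) (hF.2 l hl hlk)).mono fun _ h _ => h
    rw [indicator_of_mem hF]
    refine ((hf x (hK.openFace_subset hF)).tendsto.comp
      (tendsto_nhdsWithin_iff.2 ⟨hlim, hmem⟩)).congr' ?_
    filter_upwards [hmem, hone] with ε hε hε'
    rw [indicator_of_mem hε, sideCutoff, Finset.prod_eq_one fun l hl =>
      hε' l (Finset.mem_of_mem_erase hl) (Finset.ne_of_mem_erase hl), mul_one, Function.comp_apply]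
  · obtain ⟨l, hl, hlk, hneg⟩ : ∃ l ∈ K, l ≠ k ∧ bary K l x < 0 := by
      by_contra! h
      exact hF ⟨hxk, fun l hl hlk => (h l hl hlk).lt_of_ne (hx l hl hlk).symm⟩
    rw [indicator_of_notMem hF]
    refine tendsto_const_nhds.congr' ?_
    filter_upwards [eventually_ramp_div_eq_zero (hbary l) hneg] with ε hε
    rw [sideCutoff, Finset.prod_eq_zero (Finset.mem_erase.2 ⟨hlk, hl⟩) hε, mul_zero]

variable [NeZero d]

lemma ae_bary_ne_zero (hk : k ∈ K) (hp : bary K k p = 0) :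
    ∀ᵐ y : (ℝ ∙ -faceNormal K k)ᗮ, ∀ l ∈ K, l ≠ k → bary K l (y + p) ≠ 0 := by
  refine (Finset.eventually_all K).2 fun l hl => ?_
  by_cases hlk : l = k
  · simp [hlk]
  let f : (ℝ ∙ -faceNormal K k)ᗮ →ᵃ[ℝ] ℝ := (bary K l).comp
    ((AffineEquiv.vaddConst ℝ p).toAffineMap.comp (ℝ ∙ -faceNormal K k)ᗮ.subtype.toAffineMap)
  have hf : ∀ y, f y = bary K l (y + p) := fun y => rfl
  have horth : ⟪-faceNormal K k, l - p⟫ = 0 := by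
    have h := hK.inner_faceNormal_sub hk hp l
    rw [hK.bary_of_ne hk hl (Ne.symm hlk)] at h
    exact (mul_eq_zero.1 h).resolve_left (norm_ne_zero_iff.2 (hK.baryGrad_ne_zero hk))
  have hne : ∃ y, f y ≠ 0 :=
    ⟨⟨l - p, Submodule.mem_orthogonal_singleton_iff_inner_right.2 horth⟩, by
      simp [hf, hK.bary_self hl]⟩
  filter_upwards [compl_mem_ae_iff.2 (measure_affineMap_eq_zero volume f hne)] with y hy _ h
    using hy h

lemma ae_tendsto_sideCutoff_mul (hk : k ∈ K) (hp : bary K k p = 0) {f : E d → ℝ}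
    (hf : ContinuousOn f (convexHull ℝ (K : Set (E d)))) :
    ∀ᵐ y : (ℝ ∙ -faceNormal K k)ᗮ, ∀ s > 0, Tendsto (fun ε =>
      (convexHull ℝ (K : Set (E d))).indicator f
          ((ε / ‖baryGrad K k‖ * s) • -faceNormal K k + y + p) *
        sideCutoff K k ε ((ε / ‖baryGrad K k‖ * s) • -faceNormal K k + y + p))
      (𝓝[>] 0) (𝓝 ((openFace K k).indicator f (y + p))) := by
  filter_upwards [hK.ae_bary_ne_zero hk hp] with y hy s hs
  have hv : 0 < ⟪baryGrad K k, (s / ‖baryGrad K k‖) • -faceNormal K k⟫ := by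
    rw [inner_smul_right, inner_neg_faceNormal,
      div_mul_cancel₀ _ (norm_ne_zero_iff.2 (hK.baryGrad_ne_zero hk))]
    exact hs
  have hyk : bary K k (y + p) = 0 := by
    rw [← hK.inner_faceNormal_sub hk hp, add_sub_cancel_right, inner_orthogonal_eq_zero, mul_zero]
  refine (hK.tendsto_sideCutoff_mul hf hv hyk hy).congr fun ε => ?_
  rw [smul_smul, mul_div_left_comm, mul_comm s, add_right_comm (y : E d) p, add_comm (y : E d)]

lemma inner_faceNormal_sub_of_mem_openFace (hk : k ∈ K) (hp : bary K k p = 0)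
    (hx : x ∈ openFace K k) : ⟪-faceNormal K k, x - p⟫ = 0 :=
  (mul_eq_zero.1 ((hK.inner_faceNormal_sub hk hp x).trans hx.1)).resolve_left
    (norm_ne_zero_iff.2 (hK.baryGrad_ne_zero hk))

omit [NeZero d] in
lemma setIntegral_openCell_sideCutoff (k : E d) {ε : ℝ} (hε : 0 < ε) (f : E d → ℝ) :
    ∫ x in openCell K, f x * (sideCutoff K k ε x * (deriv ramp (bary K k x / ε) * ε⁻¹)) =
      ∫ x, (convexHull ℝ (K : Set (E d))).indicator f x * sideCutoff K k ε x *
        (deriv ramp (bary K k x / ε) * ε⁻¹) := by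
  rw [← integral_indicator (isOpen_openCell K).measurableSet]
  refine integral_congr_ae (Eventually.of_forall fun x => ?_)
  by_cases hx : x ∈ openCell K
  · simp only [indicator_of_mem hx, indicator_of_mem (hK.openCell_subset hx), mul_assoc]
  · simp only [indicator_of_notMem hx, mul_assoc]
    rw [← mul_assoc (sideCutoff K k ε x), sideCutoff_mul_deriv_eq_zero hε hx, zero_mul, mul_zero]

lemma tendsto_integral_sideCutoff (hk : k ∈ K) {f : E d → ℝ}
    (hf : ContinuousOn f (convexHull ℝ (K : Set (E d)))) :
    Tendsto (fun ε => ∫ x in openCell K,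
        f x * (sideCutoff K k ε x * (deriv ramp (bary K k x / ε) * ε⁻¹))) (𝓝[>] 0)
      (𝓝 (‖baryGrad K k‖⁻¹ * ∫ x in openFace K k, f x ∂μHE[d - 1])) := by
  classical
  set C := convexHull ℝ (K : Set (E d))
  have hc : 0 < ‖baryGrad K k‖ := norm_pos_iff.2 (hK.baryGrad_ne_zero hk)
  have hn : ‖-faceNormal K k‖ = 1 := by rw [norm_neg, hK.norm_faceNormal hk]
  obtain ⟨p, hpK, hpk⟩ := hK.exists_mem_ne k
  have hp : bary K k p = 0 := hK.bary_of_ne hk hpK hpk.symm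
  obtain ⟨M, hM⟩ := (isCompact_convexHull_coe K).exists_bound_of_continuousOn hf
  obtain ⟨R, hR⟩ := (isCompact_convexHull_coe K).isBounded.subset_closedBall p
  have hM0 : 0 ≤ M := (norm_nonneg _).trans (hM p (subset_convexHull ℝ _ hpK))
  have hfm : Measurable (C.indicator f) := by
    rw [← piecewise_eq_indicator]
    exact hf.measurable_piecewise continuousOn_const (isCompact_convexHull_coe K).measurableSet
  have hlayer := tendsto_integral_layer hn hc continuous_deriv_ramp hasCompactSupport_deriv_ramp
    (p := p) (R := R) (M := M) (fun s hs => deriv_ramp_of_le (hs.trans zero_le_one))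
    (F := fun ε x => C.indicator f x * sideCutoff K k ε x) (F₀ := (openFace K k).indicator f)
    (fun ε => hfm.mul (continuous_sideCutoff K k ε).measurable)
    (fun ε x => abs_indicator_mul_sideCutoff_le hM0 hM k ε x)
    (fun ε _ x hx =>
      hR (by_contra fun h => hx (mul_eq_zero_of_left (indicator_of_notMem h f) _)))
    (hK.ae_tendsto_sideCutoff_mul hk hp hf)
  rw [integral_deriv_ramp, one_mul, ← setIntegral_hyperplane (m := d - 1)
    (by simp [Nat.sub_add_cancel (NeZero.one_le (n := d))]) (norm_ne_zero_iff.1 (by simp [hn]))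
    (fun x => hK.inner_faceNormal_sub_of_mem_openFace hk hp) (measurableSet_openFace K k)]
    at hlayer
  refine hlayer.congr' ?_
  filter_upwards [self_mem_nhdsWithin] with ε hε
  simp only [hK.setIntegral_openCell_sideCutoff k hε, hK.inner_faceNormal_sub hk hp, C]

end IsSimplex

section Divergence

variable {d : ℕ} {K : Finset (E d)} {b : E d → E d} {ψ : E d → ℝ}

lemma fderiv_mul_cellCutoff {x : E d} (hψ : DifferentiableAt ℝ ψ x) (ε : ℝ) (v : E d) :
    fderiv ℝ (fun x => ψ x * cellCutoff K ε x) x v =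
      cellCutoff K ε x * fderiv ℝ ψ x v + ∑ k ∈ K, ψ x * ⟪baryGrad K k, v⟫ *
        (sideCutoff K k ε x * (deriv ramp (bary K k x / ε) * ε⁻¹)) := by
  have hcut : ContDiff ℝ 1 (cellCutoff K ε) := contDiff_cellCutoff K ε
  rw [fderiv_fun_mul hψ (hcut.differentiable one_ne_zero x)]
  simp only [add_apply, smul_apply, smul_eq_mul,
    fderiv_cellCutoff, Finset.mul_sum, mul_assoc]
  rw [add_comm]

namespace IsSimplex

variable (hK : IsSimplex K)
include hK

lemma integrableOn_openCell {f : E d → ℝ} (hf : ContinuousOn f (convexHull ℝ (K : Set (E d)))) :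
    IntegrableOn f (openCell K) :=
  (hf.integrableOn_compact (isCompact_convexHull_coe K)).mono_set hK.openCell_subset

lemma integral_cellCutoff_mul (hb : ContinuousOn b (convexHull ℝ (K : Set (E d))))
    (hdiv : IsSolenoidalOn b (openCell K)) (hψ : ContDiff ℝ (⊤ : ℕ∞) ψ) {ε : ℝ} (hε : 0 < ε) :
    ∫ x in openCell K, cellCutoff K ε x * fderiv ℝ ψ x (b x) =
      ∑ k ∈ K, -∫ x in openCell K, ψ x * ⟪baryGrad K k, b x⟫ *
        (sideCutoff K k ε x * (deriv ramp (bary K k x / ε) * ε⁻¹)) := by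
  have hts : tsupport (fun x => ψ x * cellCutoff K ε x) ⊆ openCell K :=
    tsupport_mul_subset_right.trans (tsupport_cellCutoff_subset hε)
  have hzero : ∫ x in openCell K, fderiv ℝ (fun x => ψ x * cellCutoff K ε x) x (b x) = 0 := by
    rw [setIntegral_eq_integral_of_forall_compl_eq_zero]
    · exact hdiv _ (hψ.mul (contDiff_cellCutoff K ε))
        (.of_support_subset_isCompact (isCompact_convexHull_coe K)
          ((subset_tsupport _).trans (hts.trans hK.openCell_subset))) hts
    · intro x hx
      rw [image_eq_zero_of_notMem_tsupport fun h => hx (hts (tsupport_fderiv_subset ℝ h)),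
        zero_apply]
  have hinner : IntegrableOn (fun x => cellCutoff K ε x * fderiv ℝ ψ x (b x)) (openCell K) :=
    hK.integrableOn_openCell <| (contDiff_cellCutoff (n := 0) K ε).continuous.continuousOn.mul <|
      (hψ.continuous_fderiv (by simp)).continuousOn.clm_apply hb
  have houter (k : E d) : IntegrableOn (fun x => ψ x * ⟪baryGrad K k, b x⟫ *
      (sideCutoff K k ε x * (deriv ramp (bary K k x / ε) * ε⁻¹))) (openCell K) :=
    hK.integrableOn_openCell <| (hψ.continuous.continuousOn.mul (continuousOn_const.inner hb)).mul
      ((continuous_sideCutoff K k ε).mul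
        ((continuous_deriv_ramp_bary K k ε).mul continuous_const)).continuousOn
  simp_rw [fderiv_mul_cellCutoff (hψ.differentiable (by simp) _)] at hzero
  rw [integral_add hinner (integrable_finsetSum _ fun k _ => houter k),
    integral_finsetSum _ fun k _ => houter k] at hzero
  rw [Finset.sum_neg_distrib, eq_neg_of_add_eq_zero_left hzero]

-- As `b` is weakly solenoidal, `∇ ⬝ (ψ b) = b ⬝ ∇ψ`.
theorem integral_divergence [NeZero d] (hb : ContinuousOn b (convexHull ℝ (K : Set (E d))))
    (hdiv : IsSolenoidalOn b (openCell K)) (hψ : ContDiff ℝ (⊤ : ℕ∞) ψ) :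
    ∫ x in openCell K, fderiv ℝ ψ x (b x) =
      ∑ k ∈ K, ∫ x in openFace K k, ψ x * ⟪b x, faceNormal K k⟫ ∂μHE[d - 1] := by
  have hinner := tendsto_integral_cellCutoff_mul <| hK.integrableOn_openCell <|
    (hψ.continuous_fderiv (by simp)).continuousOn.clm_apply hb
  have houter := tendsto_finsetSum K fun k (hk : k ∈ K) =>
    (hK.tendsto_integral_sideCutoff hk (f := fun x => ψ x * ⟪baryGrad K k, b x⟫)
      (hψ.continuous.continuousOn.mul (continuousOn_const.inner hb))).neg
  refine (tendsto_nhds_unique hinner (houter.congr' ?_)).trans ?_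
  · filter_upwards [self_mem_nhdsWithin] with ε hε
    exact (hK.integral_cellCutoff_mul hb hdiv hψ hε).symm
  · refine Finset.sum_congr rfl fun k _ => ?_
    rw [← integral_const_mul, ← integral_neg]
    refine integral_congr_ae (Eventually.of_forall fun x => ?_)
    simp only [faceNormal, inner_neg_right, inner_smul_right, real_inner_comm (b x)]
    ring

end IsSimplex

end Divergence

section Solenoidal

variable {d : ℕ} {Ω : Set (E d)} {M : ℝ} {b : E d → E d}

lemma HasWeakDeriv.integral_fderiv_mul_inner {G : E d → E d →L[ℝ] E d} (hG : HasWeakDeriv Ω b G)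
    {φ : E d → ℝ} (hφ : ContDiff ℝ (⊤ : ℕ∞) φ) (hc : HasCompactSupport φ) (hs : tsupport φ ⊆ Ω)
    {e : E d} (hb : IntegrableOn (fun x => fderiv ℝ φ x e • b x) Ω)
    (hGe : IntegrableOn (fun x => φ x • G x e) Ω) (v : E d) :
    ∫ x in Ω, fderiv ℝ φ x e * ⟪v, b x⟫ = -∫ x in Ω, φ x * ⟪v, G x e⟫ := by
  have h := congrArg (⟪v, ·⟫) (hG φ hφ hc hs e)
  simp only [inner_neg_right] at h
  rw [← integral_inner hb, ← integral_inner hGe] at h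
  simpa only [inner_smul_right] using h

lemma clm_apply_eq_sum (L : E d →L[ℝ] ℝ) (v : E d) :
    L v = ∑ i, L (EuclideanSpace.basisFun (Fin d) ℝ i) *
      ⟪EuclideanSpace.basisFun (Fin d) ℝ i, v⟫ := by
  conv_lhs => rw [← (EuclideanSpace.basisFun (Fin d) ℝ).sum_repr' v]
  simp only [map_sum, map_smul, smul_eq_mul, mul_comm]

lemma IsSolenoidalW1Inf.isSolenoidalOn (hΩ : IsOpen Ω) (hb : IsSolenoidalW1Inf Ω M b) :
    IsSolenoidalOn b Ω := by
  intro φ hφ hc hs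
  obtain ⟨hbc, hbM, G, hGm, hGM, hG, htr⟩ := hb
  let B := EuclideanSpace.basisFun (Fin d) ℝ
  have hb_int (e : E d) : IntegrableOn (fun x => fderiv ℝ φ x e • b x) Ω := by
    have hφe : Integrable (fun x => fderiv ℝ φ x e) :=
      ((hφ.continuous_fderiv (by simp)).clm_apply
        continuous_const).integrable_of_hasCompactSupport (hc.fderiv_apply ℝ e)
    exact hφe.restrict.smul_bdd M
      ((hbc.mono subset_closure).aestronglyMeasurable hΩ.measurableSet)
      (ae_restrict_of_forall_mem hΩ.measurableSet fun x hx => hbM x (subset_closure hx))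
  have hG_int (e : E d) : IntegrableOn (fun x => φ x • G x e) Ω := by
    refine (hφ.continuous.integrable_of_hasCompactSupport hc).restrict.smul_bdd (M * ‖e‖)
      ((ContinuousLinearMap.apply ℝ (E d) e).continuous.comp_aestronglyMeasurable hGm) ?_
    filter_upwards [hGM] with x hx using (G x).le_of_opNorm_le hx e
  have htrace : ∀ᵐ x ∂volume.restrict Ω, ∑ i, φ x * ⟪B i, G x (B i)⟫ = 0 := by
    filter_upwards [htr] with x hx
    rw [LinearMap.trace_eq_sum_inner _ B] at hx
    rw [← Finset.mul_sum]
    exact mul_eq_zero_of_right _ hx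
  rw [← setIntegral_eq_integral_of_forall_compl_eq_zero (s := Ω) fun x hx => by
    rw [image_eq_zero_of_notMem_tsupport fun h => hx (hs (tsupport_fderiv_subset ℝ h)),
      zero_apply]]
  calc ∫ x in Ω, fderiv ℝ φ x (b x)
      = ∑ i, ∫ x in Ω, fderiv ℝ φ x (B i) * ⟪B i, b x⟫ := by
        simp_rw [clm_apply_eq_sum (fderiv ℝ φ _) (b _)]
        exact integral_finsetSum _ fun i _ => by
          simpa only [inner_smul_right] using (hb_int (B i)).const_inner (𝕜 := ℝ) (B i)
    _ = -∫ x in Ω, ∑ i, φ x * ⟪B i, G x (B i)⟫ := by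
        rw [integral_finsetSum _ fun i _ => by
          simpa only [inner_smul_right] using (hG_int (B i)).const_inner (𝕜 := ℝ) (B i)]
        simp only [hG.integral_fderiv_mul_inner hφ hc hs (hb_int _) (hG_int _),
          Finset.sum_neg_distrib]
    _ = 0 := by rw [integral_eq_zero_of_ae htrace, neg_zero]

end Solenoidal

/-! ### The outward normal and the inlet -/

lemma exists_pos_smul_of_eventually {V : Type*} [NormedAddCommGroup V] [NormedSpace ℝ V] {x : V}
    {P : V → Prop} (h : ∀ᶠ y in 𝓝 x, P y) (v : V) : ∃ s : ℝ, 0 < s ∧ P (x + s • v) := by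
  have hc : Tendsto (fun s : ℝ => x + s • v) (𝓝[>] 0) (𝓝 x) :=
    ((by fun_prop : Continuous fun s : ℝ => x + s • v).tendsto' 0 x (by simp)).mono_left
      nhdsWithin_le_nhds
  obtain ⟨s, hs, hs'⟩ := ((hc.eventually h).and self_mem_nhdsWithin).exists
  exact ⟨s, hs', hs⟩

lemma le_of_mem_closure_of_forall_inter_le {X : Type*} [TopologicalSpace X] {s U : Set X}
    (hU : IsOpen U) {f g : X → ℝ} (hf : Continuous f) (hg : Continuous g)
    (h : ∀ z ∈ s ∩ U, f z ≤ g z) {y : X} (hy : y ∈ closure s) (hyU : y ∈ U) : f y ≤ g y :=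
  closure_minimal h (isClosed_le hf hg) (hU.closure_inter ⟨hy, hyU⟩)

section Normal

variable {d : ℕ} {Ω : Set (E d)} {x n n' : E d} {b : E d → E d}

lemma HasLipschitzBoundary.interior_closure (hΩ : IsOpen Ω) (hL : HasLipschitzBoundary Ω) :
    interior (closure Ω) = Ω := by
  refine Subset.antisymm (fun x hx => ?_) (interior_maximal subset_closure hΩ)
  by_contra hxΩ
  obtain ⟨r, e, L, g, hr, he, hgL, hge, hg⟩ :=
    hL x (hΩ.frontier_eq ▸ ⟨interior_subset hx, hxΩ⟩)
  have hgx : g x ≤ ⟪e, x⟫ := not_lt.1 fun h => hxΩ ((hg x (Metric.mem_ball_self hr)).2 h)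
  obtain ⟨s, hs, hy, hyb⟩ := exists_pos_smul_of_eventually
    ((show ∀ᶠ y in 𝓝 x, y ∈ closure Ω from mem_interior_iff_mem_nhds.1 hx).and
      (show ∀ᶠ y in 𝓝 x, y ∈ Metric.ball x r from Metric.ball_mem_nhds x hr)) e
  have hle : ⟪e, x + s • e⟫ ≤ g (x + s • e) :=
    le_of_mem_closure_of_forall_inter_le Metric.isOpen_ball (continuous_const.inner continuous_id)
      hgL.continuous (fun z hz => ((hg z hz.2).1 hz.1).le) hy hyb
  rw [hge, inner_add_right, inner_smul_right, real_inner_self_eq_norm_sq, he] at hle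
  linarith

namespace IsOutwardNormal

lemma unique (h : IsOutwardNormal Ω x n) (h' : IsOutwardNormal Ω x n') : n = n' := by
  obtain ⟨-, hn, r, hr, hb⟩ := h
  obtain ⟨-, hn', r', hr', hb'⟩ := h'
  have hev : ∀ᶠ y in 𝓝 x, ⟪y - x, n⟫ < 0 ↔ ⟪y - x, n'⟫ < 0 := by
    filter_upwards [Metric.ball_mem_nhds x hr, Metric.ball_mem_nhds x hr'] with y h1 h2
    rw [← hb y h1, hb' y h2]
  obtain ⟨s, hs, h⟩ := exists_pos_smul_of_eventually hev (n' - n)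
  by_contra hne
  have hlt : ⟪n, n'⟫ < 1 := (inner_lt_one_iff_real_of_norm_eq_one hn hn').2 hne
  simp only [add_sub_cancel_left, real_inner_smul_left, inner_sub_left,
    real_inner_self_eq_norm_sq, hn, hn', real_inner_comm n n'] at h
  have hneg := h.1 (by nlinarith)
  nlinarith

lemma outwardNormal_eq (h : IsOutwardNormal Ω x n) : outwardNormal Ω x = n := by
  have hx : ∃ n, IsOutwardNormal Ω x n := ⟨n, h⟩
  rw [outwardNormal, dif_pos hx]
  exact hx.choose_spec.unique h

lemma eventually (hΩ : IsOpen Ω) (h : IsOutwardNormal Ω x n) :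
    ∀ᶠ y in 𝓝 x, y ∈ frontier Ω → IsOutwardNormal Ω y n := by
  obtain ⟨-, hn, r, hr, hb⟩ := h
  filter_upwards [Metric.isOpen_ball.mem_nhds (Metric.mem_ball_self hr)] with y hy hyf
  have hyf' := hΩ.frontier_eq ▸ hyf
  have hzero : ⟪y - x, n⟫ = 0 := le_antisymm
    (le_of_mem_closure_of_forall_inter_le (g := fun _ => 0) Metric.isOpen_ball
      ((continuous_id.sub continuous_const).inner continuous_const) continuous_const
      (fun z hz => ((hb z hz.2).1 hz.1).le) hyf'.1 hy)
    (not_lt.1 fun h => hyf'.2 ((hb y hy).2 h))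
  refine ⟨hyf, hn, r - dist y x, sub_pos.2 hy, fun z hz => ?_⟩
  rw [hb z (Metric.ball_subset_ball' (by simp) hz), ← sub_add_sub_cancel z y x, inner_add_left,
    hzero, add_zero]

end IsOutwardNormal

lemma isOutwardNormal_of_eventually_mem_closure_iff (hreg : interior (closure Ω) = Ω)
    (hn : ‖n‖ = 1) (h : ∀ᶠ y in 𝓝 x, (y ∈ closure Ω ↔ ⟪y - x, n⟫ ≤ 0)) :
    IsOutwardNormal Ω x n := by
  have hΩ : IsOpen Ω := hreg ▸ isOpen_interior
  have hmem : ∀ᶠ y in 𝓝 x, (y ∈ Ω ↔ ⟪y - x, n⟫ < 0) := by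
    filter_upwards [h.eventually_nhds] with y hy
    refine ⟨fun hyΩ => (hy.self_of_nhds.1 (subset_closure hyΩ)).lt_of_ne fun h0 => ?_,
      fun hlt => ?_⟩
    · obtain ⟨s, hs, hs1, hs2⟩ := exists_pos_smul_of_eventually (hy.and (hΩ.mem_nhds hyΩ)) n
      have hle := hs1.1 (subset_closure hs2)
      rw [add_sub_right_comm, inner_add_left, h0, real_inner_smul_left,
        real_inner_self_eq_norm_sq, hn] at hle
      linarith
    · rw [← hreg, mem_interior_iff_mem_nhds]
      have hopen : ∀ᶠ z in 𝓝 y, ⟪z - x, n⟫ < 0 :=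
        (isOpen_lt ((continuous_id.sub continuous_const).inner continuous_const)
          continuous_const).mem_nhds hlt
      filter_upwards [hy, hopen] with z hz hz' using hz.2 hz'.le
  obtain ⟨r, hr, hball⟩ := Metric.eventually_nhds_iff_ball.1 hmem
  refine ⟨hΩ.frontier_eq ▸ ⟨h.self_of_nhds.2 (by simp), fun hx => ?_⟩, hn, r, hr, hball⟩
  simpa using hmem.self_of_nhds.1 hx

/-- The points of `∂Ω` at which the outward unit normal exists, that is, those in the relative
interior of a flat piece of the boundary. -/
def regularBoundary (Ω : Set (E d)) : Set (E d) := {x | ∃ n, IsOutwardNormal Ω x n}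

lemma regularBoundary_subset : regularBoundary Ω ⊆ frontier Ω := fun _ ⟨_, h⟩ => h.1

lemma outwardNormal_of_notMem (hx : x ∉ regularBoundary Ω) : outwardNormal Ω x = 0 :=
  dif_neg hx

lemma norm_outwardNormal_le (x : E d) : ‖outwardNormal Ω x‖ ≤ 1 := by
  by_cases hx : x ∈ regularBoundary Ω
  · obtain ⟨n, hn⟩ := hx
    rw [hn.outwardNormal_eq, hn.2.1]
  · rw [outwardNormal_of_notMem hx, norm_zero]; exact zero_le_one

lemma measurableSet_regularBoundary (hΩ : IsOpen Ω) : MeasurableSet (regularBoundary Ω) := by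
  have : regularBoundary Ω =
      frontier Ω ∩ {x | ∀ᶠ y in 𝓝 x, y ∈ frontier Ω → y ∈ regularBoundary Ω} := by
    refine Subset.antisymm (fun x hx => ⟨regularBoundary_subset hx, ?_⟩)
      fun x hx => (show ∀ᶠ _ in 𝓝 x, _ from hx.2).self_of_nhds hx.1
    obtain ⟨n, hn⟩ := hx
    filter_upwards [hn.eventually hΩ] with y hy hyf using ⟨n, hy hyf⟩
  rw [this]
  exact isClosed_frontier.measurableSet.inter isOpen_setOfPred_eventually_nhds.measurableSet

lemma continuousOn_outwardNormal (hΩ : IsOpen Ω) :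
    ContinuousOn (outwardNormal Ω) (regularBoundary Ω) := by
  rintro x ⟨n, hn⟩
  refine (continuousWithinAt_const (b := n)).congr_of_eventuallyEq ?_ hn.outwardNormal_eq
  filter_upwards [nhdsWithin_le_nhds (hn.eventually hΩ), self_mem_nhdsWithin] with y hy hyR
  exact (hy (regularBoundary_subset hyR)).outwardNormal_eq

lemma measurable_outwardNormal (hΩ : IsOpen Ω) : Measurable (outwardNormal Ω) := by
  classical
  have h : outwardNormal Ω = (regularBoundary Ω).piecewise (outwardNormal Ω) 0 := by
    ext1 x
    by_cases hx : x ∈ regularBoundary Ω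
    · rw [piecewise_eq_of_mem _ _ _ hx]
    · rw [piecewise_eq_of_notMem _ _ _ hx, outwardNormal_of_notMem hx, Pi.zero_apply]
  rw [h]
  exact (continuousOn_outwardNormal hΩ).measurable_piecewise continuousOn_const
    (measurableSet_regularBoundary hΩ)

lemma inlet_subset_frontier (b : E d → E d) : inlet Ω b ⊆ frontier Ω := fun _ hx => hx.1

lemma inlet_subset_regularBoundary (b : E d → E d) : inlet Ω b ⊆ regularBoundary Ω := by
  intro x hx
  by_contra h
  have := hx.2
  rw [outwardNormal_of_notMem h, inner_zero_right] at this
  exact lt_irrefl _ this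

lemma continuousOn_normalVelocity (hΩ : IsOpen Ω) (hb : ContinuousOn b (closure Ω)) :
    ContinuousOn (fun x => ⟪b x, outwardNormal Ω x⟫) (regularBoundary Ω) :=
  (hb.mono (regularBoundary_subset.trans frontier_subset_closure)).inner
    (continuousOn_outwardNormal hΩ)

lemma measurableSet_inlet (hΩ : IsOpen Ω) (hb : ContinuousOn b (closure Ω)) :
    MeasurableSet (inlet Ω b) := by
  have h : inlet Ω b = (fun x => ⟪b x, outwardNormal Ω x⟫) ⁻¹' Iio 0 ∩ regularBoundary Ω :=
    Subset.antisymm (fun x hx => ⟨hx.2, inlet_subset_regularBoundary b hx⟩)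
      fun x hx => ⟨regularBoundary_subset hx.2, hx.1⟩
  obtain ⟨U, hU, hUeq⟩ := continuousOn_iff'.1 (continuousOn_normalVelocity hΩ hb) _ isOpen_Iio
  rw [h, hUeq]
  exact hU.measurableSet.inter (measurableSet_regularBoundary hΩ)

lemma restrict_surface_inlet (b : E d → E d) :
    (surface Ω).restrict (inlet Ω b) = μHE[d - 1].restrict (inlet Ω b) :=
  Measure.restrict_restrict_of_subset (inlet_subset_frontier b)

end Normal

/-! ### Hat functions and finite element functions -/

namespace Triangulation

variable {d : ℕ} {Ω : Set (E d)} (𝒯 : Triangulation Ω) {K L : Finset (E d)} {x : E d}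

lemma isSimplex (hK : K ∈ 𝒯.cells) : IsSimplex K := ⟨𝒯.card_cell K hK, 𝒯.indep K hK⟩

lemma mem_closure_iff :
    x ∈ closure Ω ↔ ∃ K ∈ 𝒯.cells, x ∈ convexHull ℝ (K : Set (E d)) := by
  rw [← 𝒯.cover, mem_iUnion₂]; simp only [exists_prop]

include 𝒯 in
lemma isCompact_closure : IsCompact (closure Ω) :=
  𝒯.cover ▸ 𝒯.cells.isCompact_biUnion fun K _ => isCompact_convexHull_coe K

lemma cell_subset (hK : K ∈ 𝒯.cells) : convexHull ℝ (K : Set (E d)) ⊆ closure Ω :=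
  fun _ hx => 𝒯.mem_closure_iff.2 ⟨K, hK, hx⟩

lemma mem_vertices (hK : K ∈ 𝒯.cells) {p : E d} (hp : p ∈ K) : p ∈ 𝒯.vertices := by
  classical exact Finset.mem_biUnion.2 ⟨K, hK, hp⟩

lemma exists_mem_cell (i : 𝒯.Node) : ∃ K ∈ 𝒯.cells, (i : E d) ∈ K := by
  classical exact Finset.mem_biUnion.1 i.2

lemma node_mem_closure (i : 𝒯.Node) : (i : E d) ∈ closure Ω := by
  obtain ⟨K, hK, hi⟩ := 𝒯.exists_mem_cell i
  exact 𝒯.cell_subset hK (subset_convexHull ℝ _ hi)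

/- Both sides are affine in `x` and agree at the common vertices, whose convex hull is the
intersection of the two cells. -/
lemma bary_eq_of_mem (hK : K ∈ 𝒯.cells) (hL : L ∈ 𝒯.cells)
    (hxK : x ∈ convexHull ℝ (K : Set (E d))) (hxL : x ∈ convexHull ℝ (L : Set (E d))) (p : E d) :
    bary K p x = bary L p x := by
  have hvertex : (K ∩ L : Set (E d)) ⊆ (bary K p - bary L p) ⁻¹' {0} := by
    rintro q ⟨hqK : q ∈ K, hqL : q ∈ L⟩
    rw [mem_preimage, mem_singleton_iff, AffineMap.coe_sub, Pi.sub_apply, sub_eq_zero]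
    by_cases hpq : p = q
    · rw [hpq, (𝒯.isSimplex hK).bary_self hqK, (𝒯.isSimplex hL).bary_self hqL]
    · have hzero {J : Finset (E d)} (hJ : J ∈ 𝒯.cells) (hqJ : q ∈ J) : bary J p q = 0 := by
        by_cases hpJ : p ∈ J
        · exact (𝒯.isSimplex hJ).bary_of_ne hpJ hqJ hpq
        · rw [bary_of_notMem hpJ]; rfl
      rw [hzero hK hqK, hzero hL hqL]
  have hx := 𝒯.conforming K hK L hL ▸ mem_inter hxK hxL
  exact sub_eq_zero.1 (convexHull_min hvertex ((convex_singleton 0).affine_preimage _) hx)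

lemma eq_of_mem_openCell (hK : K ∈ 𝒯.cells) (hL : L ∈ 𝒯.cells) (hxK : x ∈ openCell K)
    (hxL : x ∈ convexHull ℝ (L : Set (E d))) : K = L := by
  refine Finset.eq_of_subset_of_card_le (fun p hp => ?_)
    (by rw [𝒯.card_cell K hK, 𝒯.card_cell L hL])
  by_contra hpL
  have h := 𝒯.bary_eq_of_mem hK hL ((𝒯.isSimplex hK).openCell_subset hxK) hxL p
  rw [bary_of_notMem hpL] at h
  exact (hxK p hp).ne' h

lemma hat_eq (hK : K ∈ 𝒯.cells) (hx : x ∈ convexHull ℝ (K : Set (E d))) (i : 𝒯.Node) :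
    𝒯.hat i x = bary K i x := by
  have hex : ∃ K : Finset (E d), K ∈ 𝒯.cells ∧ x ∈ convexHull ℝ (K : Set (E d)) := ⟨K, hK, hx⟩
  rw [𝒯.bary_eq_of_mem hK hex.choose_spec.1 hx hex.choose_spec.2, hat, dif_pos hex]
  by_cases hi : (i : E d) ∈ hex.choose
  · rw [dif_pos hi, (𝒯.isSimplex hex.choose_spec.1).bary_eq hi]
  · rw [dif_neg hi, bary_of_notMem hi]; rfl

lemma hat_of_notMem (hx : x ∉ closure Ω) (i : 𝒯.Node) : 𝒯.hat i x = 0 :=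
  dif_neg fun ⟨_, hK, hxK⟩ => hx (𝒯.cell_subset hK hxK)

lemma hat_nonneg (i : 𝒯.Node) (x : E d) : 0 ≤ 𝒯.hat i x := by
  by_cases hx : x ∈ closure Ω
  · obtain ⟨K, hK, hxK⟩ := 𝒯.mem_closure_iff.1 hx
    exact 𝒯.hat_eq hK hxK i ▸ (𝒯.isSimplex hK).bary_nonneg hxK i
  · rw [𝒯.hat_of_notMem hx]

lemma sum_bary_node (hK : K ∈ 𝒯.cells) (x : E d) : ∑ i : 𝒯.Node, bary K i x = 1 := by
  rw [← (𝒯.isSimplex hK).sum_bary x, Finset.sum_coe_sort 𝒯.vertices (fun p => bary K p x)]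
  refine (Finset.sum_subset (fun p hp => 𝒯.mem_vertices hK hp) fun p _ hp => ?_).symm
  rw [bary_of_notMem hp]; rfl

lemma sum_hat (hx : x ∈ closure Ω) : ∑ i, 𝒯.hat i x = 1 := by
  obtain ⟨K, hK, hxK⟩ := 𝒯.mem_closure_iff.1 hx
  simp_rw [𝒯.hat_eq hK hxK, 𝒯.sum_bary_node hK x]

lemma hat_le_one (i : 𝒯.Node) (x : E d) : 𝒯.hat i x ≤ 1 := by
  by_cases hx : x ∈ closure Ω
  · rw [← 𝒯.sum_hat hx]
    exact Finset.single_le_sum (fun j _ => 𝒯.hat_nonneg j x) (Finset.mem_univ i)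
  · rw [𝒯.hat_of_notMem hx]; exact zero_le_one

lemma hat_self (i : 𝒯.Node) : 𝒯.hat i i = 1 := by
  obtain ⟨K, hK, hi⟩ := 𝒯.exists_mem_cell i
  rw [𝒯.hat_eq hK (subset_convexHull ℝ _ hi), (𝒯.isSimplex hK).bary_self hi]

lemma continuousOn_hat (i : 𝒯.Node) : ContinuousOn (𝒯.hat i) (closure Ω) := by
  rw [← 𝒯.cover, ← iUnion_subtype (· ∈ 𝒯.cells) fun K => convexHull ℝ (K.1 : Set (E d))]
  exact (locallyFinite_of_finite _).continuousOn_iUnion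
    (fun K => (isCompact_convexHull_coe K.1).isClosed) fun K =>
      (continuous_bary K.1 i).continuousOn.congr fun x hx => 𝒯.hat_eq K.2 hx i

lemma measurable_hat (i : 𝒯.Node) : Measurable (𝒯.hat i) := by
  classical
  have h : 𝒯.hat i = (closure Ω).piecewise (𝒯.hat i) 0 := by
    ext1 x
    by_cases hx : x ∈ closure Ω
    · rw [piecewise_eq_of_mem _ _ _ hx]
    · rw [piecewise_eq_of_notMem _ _ _ hx, 𝒯.hat_of_notMem hx, Pi.zero_apply]
  rw [h]
  exact (𝒯.continuousOn_hat i).measurable_piecewise continuousOn_const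
    isClosed_closure.measurableSet

lemma measurable_fe (v : 𝒯.Node → ℝ) : Measurable (𝒯.fe v) :=
  Finset.measurable_sum _ fun i _ => (𝒯.measurable_hat i).const_mul _

lemma fe_single [DecidableEq 𝒯.Node] (i : 𝒯.Node) : 𝒯.fe (Pi.single i 1) = 𝒯.hat i := by
  ext x
  simp only [fe, Pi.single_apply, ite_mul, one_mul, zero_mul, Finset.sum_ite_eq',
    Finset.mem_univ, if_true]

/-- The affine function on the whole space that agrees on the cell `K` with the finite element
function with nodal values `v`. -/
def cellFun (K : Finset (E d)) (v : 𝒯.Node → ℝ) (x : E d) : ℝ := ∑ i, v i * bary K i x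

/-- The constant gradient on the cell `K` of the finite element function with nodal values `v`. -/
def cellGrad (K : Finset (E d)) (v : 𝒯.Node → ℝ) : E d := ∑ i, v i • baryGrad K i

lemma fe_eq (hK : K ∈ 𝒯.cells) (hx : x ∈ convexHull ℝ (K : Set (E d))) (v : 𝒯.Node → ℝ) :
    𝒯.fe v x = 𝒯.cellFun K v x :=
  Finset.sum_congr rfl fun i _ => by rw [𝒯.hat_eq hK hx]

lemma contDiff_cellFun (K : Finset (E d)) (v : 𝒯.Node → ℝ) {n : WithTop ℕ∞} :
    ContDiff ℝ n (𝒯.cellFun K v) :=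
  ContDiff.sum fun i _ => contDiff_const.mul (contDiff_bary K i)

lemma hasGradientAt_cellFun (K : Finset (E d)) (v : 𝒯.Node → ℝ) (x : E d) :
    HasGradientAt (𝒯.cellFun K v) (𝒯.cellGrad K v) x := by
  rw [hasGradientAt_iff_hasFDerivAt, cellGrad, map_sum]
  refine (HasFDerivAt.fun_sum fun (i : 𝒯.Node) _ =>
    (hasFDerivAt_bary K (i : E d) x).const_mul (v i)).congr_fderiv
    (Finset.sum_congr rfl fun i _ => ?_)
  rw [map_smul]; rfl

lemma hasGradientAt_fe (hK : K ∈ 𝒯.cells) (hx : x ∈ openCell K) (v : 𝒯.Node → ℝ) :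
    HasGradientAt (𝒯.fe v) (𝒯.cellGrad K v) x := by
  refine (𝒯.hasGradientAt_cellFun K v x).congr_of_eventuallyEq ?_
  filter_upwards [(isOpen_openCell K).mem_nhds hx] with y hy
  exact 𝒯.fe_eq hK ((𝒯.isSimplex hK).openCell_subset hy) v

/-! ### Integration over the cells -/

lemma openCell_subset (hreg : interior (closure Ω) = Ω) (hK : K ∈ 𝒯.cells) : openCell K ⊆ Ω :=
  hreg ▸ interior_maximal ((𝒯.isSimplex hK).openCell_subset.trans (𝒯.cell_subset hK))
    (isOpen_openCell K)

lemma volume_closure_diff_openCells : volume (closure Ω \ ⋃ K ∈ 𝒯.cells, openCell K) = 0 := by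
  refine measure_mono_null (t := ⋃ K ∈ 𝒯.cells, (convexHull ℝ (K : Set (E d)) \ openCell K)) ?_
    ((measure_biUnion_null_iff 𝒯.cells.countable_toSet).2 fun K hK =>
      (𝒯.isSimplex hK).volume_diff_openCell)
  rintro x ⟨hx, hx'⟩
  obtain ⟨K, hK, hxK⟩ := 𝒯.mem_closure_iff.1 hx
  exact mem_iUnion₂.2 ⟨K, hK, hxK, fun h => hx' (mem_iUnion₂.2 ⟨K, hK, h⟩)⟩

end Triangulation

section CellNormal

variable {d : ℕ} {K : Finset (E d)} {k l x : E d}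

lemma IsSimplex.euclideanHausdorffMeasure_face_lt_top [NeZero d] (hK : IsSimplex K)
    {k : E d} (hk : k ∈ K) : (μHE[d - 1] : Measure (E d))
      {x ∈ convexHull ℝ (K : Set (E d)) | bary K k x = 0} < ∞ := by
  obtain ⟨p, hp, hpk⟩ := hK.exists_mem_ne k
  refine euclideanHausdorffMeasure_lt_top_of_subset_hyperplane (p := p)
    (by simp [Nat.sub_add_cancel (NeZero.one_le (n := d))]) (hK.baryGrad_ne_zero hk)
    (fun x hx => ?_) ((isCompact_convexHull_coe K).isBounded.subset fun x hx => hx.1)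
  rw [← bary_sub, hx.2, hK.bary_of_ne hk hp hpk.symm, sub_zero]

lemma eq_of_mem_openFace (hk : k ∈ K) (hxk : x ∈ openFace K k)
    (hxl : x ∈ openFace K l) : k = l := by
  by_contra h
  exact (hxl.2 k hk h).ne' hxk.1

/-- The outward unit normal of the simplex `K`; it is `0` off the relative interiors of the
faces of `K`. -/
def cellNormal (K : Finset (E d)) (x : E d) : E d :=
  ∑ k ∈ K, (openFace K k).indicator (fun _ => faceNormal K k) x

lemma cellNormal_eq (hk : k ∈ K) (hx : x ∈ openFace K k) :
    cellNormal K x = faceNormal K k := by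
  rw [cellNormal, Finset.sum_eq_single_of_mem k hk, indicator_of_mem hx]
  exact fun l hl hlk => indicator_of_notMem (fun h => hlk (eq_of_mem_openFace hl h hx)) _

lemma cellNormal_eq_zero (h : ∀ k ∈ K, x ∉ openFace K k) : cellNormal K x = 0 :=
  Finset.sum_eq_zero fun k hk => indicator_of_notMem (h k hk) _

end CellNormal

namespace Triangulation

variable {d : ℕ} {Ω : Set (E d)} (𝒯 : Triangulation Ω) {K L : Finset (E d)} {x : E d}

lemma ae_mem_openCell (hΩ : IsOpen Ω) :
    ∀ᵐ x ∂volume.restrict Ω, ∃ K ∈ 𝒯.cells, x ∈ openCell K := by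
  rw [ae_restrict_iff' hΩ.measurableSet]
  filter_upwards [compl_mem_ae_iff.2 𝒯.volume_closure_diff_openCells] with x hx hxΩ
  by_contra h
  exact hx ⟨subset_closure hxΩ, fun h' => h (by simpa only [mem_iUnion₂, exists_prop] using h')⟩

lemma integral_eq_sum_cells (hreg : interior (closure Ω) = Ω) {F : E d → ℝ}
    (hF : IntegrableOn F Ω) : ∫ x in Ω, F x = ∑ K ∈ 𝒯.cells, ∫ x in openCell K, F x := by
  have hsub : ⋃ K ∈ 𝒯.cells, openCell K ⊆ Ω := iUnion₂_subset fun K hK => 𝒯.openCell_subset hreg hK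
  rw [← integral_biUnion_finset _ (fun K _ => (isOpen_openCell K).measurableSet)]
  · refine setIntegral_congr_set (ae_eq_set.2 ⟨?_, by rw [sdiff_eq_empty.2 hsub, measure_empty]⟩)
    exact measure_mono_null (sdiff_subset_sdiff_left subset_closure)
      𝒯.volume_closure_diff_openCells
  · exact fun K hK L hL hne => disjoint_left.2 fun x hx hx' =>
      hne (𝒯.eq_of_mem_openCell hK hL hx ((𝒯.isSimplex hL).openCell_subset hx'))
  · exact fun K hK => hF.mono_set (𝒯.openCell_subset hreg hK)

include 𝒯 in
lemma volume_lt_top : volume Ω < ∞ :=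
  (measure_mono subset_closure).trans_lt 𝒯.isCompact_closure.measure_lt_top

include 𝒯 in
lemma surface_univ_lt_top [NeZero d] (hreg : interior (closure Ω) = Ω) :
    surface Ω univ < ∞ := by
  have hsub : frontier Ω ⊆ ⋃ K ∈ 𝒯.cells, ⋃ k ∈ K,
      {x ∈ convexHull ℝ (K : Set (E d)) | bary K k x = 0} := by
    intro x hx
    obtain ⟨K, hK, hxK⟩ := 𝒯.mem_closure_iff.1 (frontier_subset_closure hx)
    by_contra h
    simp only [mem_iUnion, mem_ofPred_eq, not_exists, not_and] at h
    have hcell : x ∈ openCell K := fun p hp =>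
      ((𝒯.isSimplex hK).bary_nonneg hxK p).lt_of_ne' (h K hK p hp hxK)
    exact hx.2 (interior_maximal (𝒯.openCell_subset hreg hK) (isOpen_openCell K) hcell)
  rw [surface, Measure.restrict_apply_univ]
  exact (measure_mono hsub).trans_lt <| measure_biUnion_lt_top 𝒯.cells.finite_toSet fun K hK =>
    measure_biUnion_lt_top K.finite_toSet fun k hk =>
      (𝒯.isSimplex hK).euclideanHausdorffMeasure_face_lt_top hk

/-! ### Cancellation of the cell normals on interior faces -/

section CellNormal

variable {k l : E d}

lemma exists_mem_openFace (hK : K ∈ 𝒯.cells) (hL : L ∈ 𝒯.cells) (hk : k ∈ K)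
    (hx : x ∈ openFace K k) (hxL : x ∈ convexHull ℝ (L : Set (E d))) :
    ∃ l ∈ L, x ∈ openFace L l := by
  classical
  have hb := 𝒯.bary_eq_of_mem hL hK hxL ((𝒯.isSimplex hK).openFace_subset hx)
  have hsub : K.erase k ⊆ L := by
    intro p hp
    by_contra hpL
    have := hb p
    rw [bary_of_notMem hpL] at this
    exact (hx.2 p (Finset.mem_of_mem_erase hp) (Finset.ne_of_mem_erase hp)).ne this
  obtain ⟨q, hq, rfl⟩ := Finset.exists_eq_insert_iff.2
    ⟨hsub, by rw [Finset.card_erase_add_one hk, 𝒯.card_cell K hK, 𝒯.card_cell L hL]⟩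
  refine ⟨q, Finset.mem_insert_self _ _, ?_, fun p hp hpq => ?_⟩
  · rw [hb]
    by_cases hqk : q = k
    · rw [hqk, hx.1]
    · rw [bary_of_notMem fun h => hq (Finset.mem_erase.2 ⟨hqk, h⟩)]; rfl
  · have hp' := (Finset.mem_insert.1 hp).resolve_left hpq
    rw [hb]
    exact hx.2 p (Finset.mem_of_mem_erase hp') (Finset.ne_of_mem_erase hp')

variable [NeZero d]

lemma faceNormal_eq_neg (hK : K ∈ 𝒯.cells) (hL : L ∈ 𝒯.cells) (hKL : K ≠ L) (hk : k ∈ K)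
    (hl : l ∈ L) (hxk : x ∈ openFace K k) (hxl : x ∈ openFace L l) :
    faceNormal K k = -faceNormal L l := by
  obtain ⟨s, hs, hsK, hsL⟩ := exists_pos_smul_of_eventually
    (((𝒯.isSimplex hK).eventually_mem_openCell_iff hk hxk).and
      ((𝒯.isSimplex hL).eventually_mem_openCell_iff hl hxl)) (-(faceNormal K k + faceNormal L l))
  have hn := (𝒯.isSimplex hK).norm_faceNormal hk
  have hn' := (𝒯.isSimplex hL).norm_faceNormal hl
  rw [← inner_eq_neg_one_iff_of_norm_eq_one (𝕜 := ℝ) hn hn']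
  by_contra hne
  have hge := neg_le_of_abs_le (abs_real_inner_le_norm (faceNormal K k) (faceNormal L l))
  rw [hn, hn', mul_one] at hge
  have hlt : -1 < ⟪faceNormal K k, faceNormal L l⟫ := hge.lt_of_ne' hne
  simp only [add_sub_cancel_left, real_inner_smul_left, inner_neg_left, inner_add_left,
    real_inner_self_eq_norm_sq, hn, hn', real_inner_comm (faceNormal K k) (faceNormal L l)]
    at hsK hsL
  exact hKL (𝒯.eq_of_mem_openCell hK hL (hsK.2 (by nlinarith))
    ((𝒯.isSimplex hL).openCell_subset (hsL.2 (by nlinarith))))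

lemma eventually_mem_closure_iff (hK : K ∈ 𝒯.cells) (hk : k ∈ K) (hx : x ∈ openFace K k) :
    ∀ᶠ y in 𝓝 x, (y ∈ closure Ω ↔
      ∃ L ∈ 𝒯.cells, ∃ l ∈ L, x ∈ openFace L l ∧ ⟪y - x, faceNormal L l⟫ ≤ 0) := by
  have hcells : ∀ᶠ y in 𝓝 x, ∀ L ∈ 𝒯.cells, (y ∈ convexHull ℝ (L : Set (E d)) ↔
      ∃ l ∈ L, x ∈ openFace L l ∧ ⟪y - x, faceNormal L l⟫ ≤ 0) := by
    refine (Finset.eventually_all 𝒯.cells).2 fun L hL => ?_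
    by_cases hxL : x ∈ convexHull ℝ (L : Set (E d))
    · obtain ⟨l, hl, hxl⟩ := 𝒯.exists_mem_openFace hK hL hk hx hxL
      filter_upwards [(𝒯.isSimplex hL).eventually_mem_convexHull_iff hl hxl] with y hy
      rw [hy]
      refine ⟨fun h => ⟨l, hl, hxl, h⟩, ?_⟩
      rintro ⟨l', -, hxl', h⟩
      rwa [eq_of_mem_openFace hl hxl hxl']
    · filter_upwards [(isCompact_convexHull_coe L).isClosed.isOpen_compl.mem_nhds hxL] with y hy
      exact iff_of_false hy fun ⟨l, _, hxl, _⟩ => hxL ((𝒯.isSimplex hL).openFace_subset hxl)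
  filter_upwards [hcells] with y hy
  rw [𝒯.mem_closure_iff]
  exact exists_congr fun L => and_congr_right fun hL => hy L hL

lemma mem_of_mem_openFace_of_ne (hreg : interior (closure Ω) = Ω) (hK : K ∈ 𝒯.cells)
    (hL : L ∈ 𝒯.cells) (hKL : K ≠ L) (hk : k ∈ K) (hl : l ∈ L) (hxk : x ∈ openFace K k)
    (hxl : x ∈ openFace L l) : x ∈ Ω := by
  rw [← hreg, mem_interior_iff_mem_nhds]
  filter_upwards [𝒯.eventually_mem_closure_iff hK hk hxk] with y hy
  rw [hy]
  rcases le_total ⟪y - x, faceNormal K k⟫ 0 with h | h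
  · exact ⟨K, hK, k, hk, hxk, h⟩
  · refine ⟨L, hL, l, hl, hxl, ?_⟩
    rw [𝒯.faceNormal_eq_neg hK hL hKL hk hl hxk hxl, inner_neg_right] at h
    linarith

lemma isOutwardNormal_faceNormal (hreg : interior (closure Ω) = Ω) (hK : K ∈ 𝒯.cells)
    (hk : k ∈ K) (hx : x ∈ openFace K k)
    (honly : ∀ L ∈ 𝒯.cells, ∀ l ∈ L, x ∈ openFace L l → L = K) :
    IsOutwardNormal Ω x (faceNormal K k) := by
  refine isOutwardNormal_of_eventually_mem_closure_iff hreg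
    ((𝒯.isSimplex hK).norm_faceNormal hk) ?_
  filter_upwards [𝒯.eventually_mem_closure_iff hK hk hx] with y hy
  rw [hy]
  refine ⟨?_, fun h => ⟨K, hK, k, hk, hx, h⟩⟩
  rintro ⟨L, hL, l, hl, hxl, h⟩
  obtain rfl := honly L hL l hl hxl
  rwa [eq_of_mem_openFace hk hx hxl]

lemma eq_or_eq_of_mem_openFace {J : Finset (E d)} {j : E d} (hK : K ∈ 𝒯.cells) (hL : L ∈ 𝒯.cells)
    (hJ : J ∈ 𝒯.cells) (hKL : K ≠ L) (hk : k ∈ K) (hl : l ∈ L) (hj : j ∈ J)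
    (hxk : x ∈ openFace K k) (hxl : x ∈ openFace L l) (hxj : x ∈ openFace J j) :
    J = K ∨ J = L := by
  by_contra! h
  have hJK := 𝒯.faceNormal_eq_neg hJ hK h.1 hj hk hxj hxk
  have hJL := 𝒯.faceNormal_eq_neg hJ hL h.2 hj hl hxj hxl
  rw [← 𝒯.faceNormal_eq_neg hK hL hKL hk hl hxk hxl, hJK] at hJL
  have hinner := congrArg (⟪·, faceNormal K k⟫) hJL
  simp only [inner_neg_left, real_inner_self_eq_norm_sq, (𝒯.isSimplex hK).norm_faceNormal hk]
    at hinner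
  norm_num at hinner

lemma sum_cellNormal (hreg : interior (closure Ω) = Ω) (hK : K ∈ 𝒯.cells) (hk : k ∈ K)
    (hx : x ∈ openFace K k) :
    ∑ L ∈ 𝒯.cells, cellNormal L x = (frontier Ω).indicator (outwardNormal Ω) x := by
  by_cases hother : ∃ L ∈ 𝒯.cells, L ≠ K ∧ ∃ l ∈ L, x ∈ openFace L l
  · obtain ⟨L, hL, hLK, l, hl, hxl⟩ := hother
    have hxΩ : x ∈ interior Ω :=
      (hreg ▸ isOpen_interior : IsOpen Ω).interior_eq.symm ▸
        𝒯.mem_of_mem_openFace_of_ne hreg hK hL hLK.symm hk hl hx hxl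
    rw [indicator_of_notMem fun h => h.2 hxΩ, Finset.sum_eq_add_of_mem K L hK hL hLK.symm,
      cellNormal_eq hk hx, cellNormal_eq hl hxl,
      𝒯.faceNormal_eq_neg hK hL hLK.symm hk hl hx hxl, neg_add_cancel]
    refine fun J hJ hne => cellNormal_eq_zero fun j hj hxj => ?_
    exact (𝒯.eq_or_eq_of_mem_openFace hK hL hJ hLK.symm hk hl hj hx hxl hxj).elim hne.1 hne.2
  · have hnormal := 𝒯.isOutwardNormal_faceNormal hreg hK hk hx fun L hL l hl hxl =>
      not_not.1 fun hne => hother ⟨L, hL, hne, l, hl, hxl⟩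
    rw [indicator_of_mem hnormal.1, hnormal.outwardNormal_eq, Finset.sum_eq_single_of_mem K hK,
      cellNormal_eq hk hx]
    exact fun L hL hne => cellNormal_eq_zero fun l hl hxl => hother ⟨L, hL, hne, l, hl, hxl⟩

end CellNormal

end Triangulation

/-! ### The advection and inflow forms -/

section Boundary

variable {d : ℕ} {Ω : Set (E d)} {M : ℝ} {b : E d → E d} {x : E d}

lemma abs_normalVelocity_le (hM : ∀ x ∈ closure Ω, ‖b x‖ ≤ M) (hx : x ∈ frontier Ω) :
    |⟪b x, outwardNormal Ω x⟫| ≤ M :=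
  (abs_real_inner_le_norm _ _).trans <|
    (mul_le_of_le_one_right (norm_nonneg _) (norm_outwardNormal_le x)).trans
      (hM x (frontier_subset_closure hx))

lemma aestronglyMeasurable_normalVelocity (hΩ : IsOpen Ω) (hb : ContinuousOn b (closure Ω)) :
    AEStronglyMeasurable (fun x => ⟪b x, outwardNormal Ω x⟫) (surface Ω) :=
  ((hb.mono frontier_subset_closure).aestronglyMeasurable
    isClosed_frontier.measurableSet).inner (measurable_outwardNormal hΩ).aestronglyMeasurable

lemma integrableOn_inlet [IsFiniteMeasure (surface Ω)] (hΩ : IsOpen Ω)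
    (hb : ContinuousOn b (closure Ω)) (hM : ∀ x ∈ closure Ω, ‖b x‖ ≤ M) {φ : E d → ℝ} {c : ℝ}
    (hφ : AEStronglyMeasurable φ ((surface Ω).restrict (inlet Ω b)))
    (hc : ∀ x ∈ inlet Ω b, |φ x| ≤ c) :
    IntegrableOn (fun x => φ x * ⟪b x, outwardNormal Ω x⟫) (inlet Ω b) (surface Ω) := by
  refine IntegrableOn.of_bound (measure_lt_top _ _)
    (hφ.mul (aestronglyMeasurable_normalVelocity hΩ hb).restrict) (c * M) ?_
  filter_upwards [ae_restrict_mem (measurableSet_inlet hΩ hb)] with x hx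
  rw [norm_mul]
  exact mul_le_mul (hc x hx) (abs_normalVelocity_le hM hx.1) (norm_nonneg _)
    ((abs_nonneg _).trans (hc x hx))

lemma aestronglyMeasurable_inflow (hΩ : IsOpen Ω) (hb : ContinuousOn b (closure Ω)) {g : E d → ℝ}
    (hg : ContinuousOn g (closure (inlet Ω b))) :
    AEStronglyMeasurable g ((surface Ω).restrict (inlet Ω b)) :=
  (hg.mono subset_closure).aestronglyMeasurable (measurableSet_inlet hΩ hb)

end Boundary

section CellNormal

variable {d : ℕ} {K : Finset (E d)} {k : E d} {f : E d → ℝ} {b : E d → E d}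

lemma mul_inner_cellNormal (f : E d → ℝ) (b : E d → E d) (K : Finset (E d)) (x : E d) :
    f x * ⟪b x, cellNormal K x⟫ =
      ∑ k ∈ K, (openFace K k).indicator (fun x => f x * ⟪b x, faceNormal K k⟫) x := by
  rw [cellNormal, inner_sum, Finset.mul_sum]
  refine Finset.sum_congr rfl fun k _ => ?_
  by_cases hx : x ∈ openFace K k
  · rw [indicator_of_mem hx, indicator_of_mem hx]
  · rw [indicator_of_notMem hx, indicator_of_notMem hx, inner_zero_right, mul_zero]

namespace IsSimplex

variable [NeZero d]

lemma integrableOn_openFace (hK : IsSimplex K) (hk : k ∈ K)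
    (hf : ContinuousOn f (convexHull ℝ (K : Set (E d)))) :
    IntegrableOn f (openFace K k) μHE[d - 1] := by
  obtain ⟨c, hc⟩ := (isCompact_convexHull_coe K).exists_bound_of_continuousOn hf
  refine IntegrableOn.of_bound ((measure_mono fun x hx => ?_).trans_lt
    (hK.euclideanHausdorffMeasure_face_lt_top hk))
    ((hf.mono hK.openFace_subset).aestronglyMeasurable (measurableSet_openFace K k)) c ?_
  · exact ⟨hK.openFace_subset hx, hx.1⟩
  · filter_upwards [ae_restrict_mem (measurableSet_openFace K k)] with x hx
    exact hc x (hK.openFace_subset hx)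

lemma integrable_indicator_openFace (hK : IsSimplex K) (hk : k ∈ K)
    (hf : ContinuousOn f (convexHull ℝ (K : Set (E d))))
    (hb : ContinuousOn b (convexHull ℝ (K : Set (E d)))) :
    Integrable ((openFace K k).indicator fun x => f x * ⟪b x, faceNormal K k⟫) μHE[d - 1] :=
  (integrable_indicator_iff (measurableSet_openFace K k)).2
    (hK.integrableOn_openFace hk (hf.mul (hb.inner continuousOn_const)))

lemma integrable_mul_inner_cellNormal (hK : IsSimplex K)
    (hf : ContinuousOn f (convexHull ℝ (K : Set (E d))))
    (hb : ContinuousOn b (convexHull ℝ (K : Set (E d)))) :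
    Integrable (fun x => f x * ⟪b x, cellNormal K x⟫) μHE[d - 1] := by
  simp only [mul_inner_cellNormal]
  exact integrable_finsetSum _ fun k hk => hK.integrable_indicator_openFace hk hf hb

lemma integral_mul_inner_cellNormal (hK : IsSimplex K)
    (hf : ContinuousOn f (convexHull ℝ (K : Set (E d))))
    (hb : ContinuousOn b (convexHull ℝ (K : Set (E d)))) :
    ∫ x, f x * ⟪b x, cellNormal K x⟫ ∂μHE[d - 1] =
      ∑ k ∈ K, ∫ x in openFace K k, f x * ⟪b x, faceNormal K k⟫ ∂μHE[d - 1] := by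
  simp only [mul_inner_cellNormal]
  rw [integral_finsetSum _ fun k hk => hK.integrable_indicator_openFace hk hf hb]
  exact Finset.sum_congr rfl fun k _ => integral_indicator (measurableSet_openFace K k)

end IsSimplex

end CellNormal

namespace Triangulation

variable {d : ℕ} {Ω : Set (E d)} (𝒯 : Triangulation Ω) {M : ℝ} {b : E d → E d}

lemma abs_fe_le (v : 𝒯.Node → ℝ) (x : E d) : |𝒯.fe v x| ≤ ∑ i, |v i| := by
  refine (Finset.abs_sum_le_sum_abs _ _).trans (Finset.sum_le_sum fun i _ => ?_)
  rw [abs_mul, abs_of_nonneg (𝒯.hat_nonneg i x)]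
  exact mul_le_of_le_one_right (abs_nonneg _) (𝒯.hat_le_one i x)

lemma continuousOn_fe (v : 𝒯.Node → ℝ) : ContinuousOn (𝒯.fe v) (closure Ω) :=
  continuousOn_finsetSum _ fun i _ => continuousOn_const.mul (𝒯.continuousOn_hat i)

lemma measurable_gradient (f : E d → ℝ) : Measurable (gradient f) :=
  (InnerProductSpace.toDual ℝ (E d)).symm.continuous.measurable.comp (measurable_fderiv ℝ f)

lemma exists_ae_norm_gradient_fe_le (hΩ : IsOpen Ω) (v : 𝒯.Node → ℝ) :
    ∃ G : ℝ, ∀ᵐ x ∂volume.restrict Ω, ‖gradient (𝒯.fe v) x‖ ≤ G := by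
  refine ⟨∑ K ∈ 𝒯.cells, ‖𝒯.cellGrad K v‖, ?_⟩
  filter_upwards [𝒯.ae_mem_openCell hΩ] with x ⟨K, hK, hx⟩
  rw [(𝒯.hasGradientAt_fe hK hx v).gradient]
  exact Finset.single_le_sum (f := fun K => ‖𝒯.cellGrad K v‖) (fun _ _ => norm_nonneg _) hK

lemma integrableOn_advection (hΩ : IsOpen Ω) (hb : ContinuousOn b (closure Ω))
    (hM : ∀ x ∈ closure Ω, ‖b x‖ ≤ M) (v w : 𝒯.Node → ℝ) :
    IntegrableOn (fun x => 𝒯.fe w x * ⟪b x, gradient (𝒯.fe v) x⟫) Ω := by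
  obtain ⟨G, hG⟩ := 𝒯.exists_ae_norm_gradient_fe_le hΩ v
  refine IntegrableOn.of_bound 𝒯.volume_lt_top ((𝒯.measurable_fe w).aestronglyMeasurable.mul
    (((hb.mono subset_closure).aestronglyMeasurable hΩ.measurableSet).inner
      (measurable_gradient _).aestronglyMeasurable)) ((∑ i, |w i|) * (M * G)) ?_
  filter_upwards [hG, ae_restrict_mem hΩ.measurableSet] with x hx hxΩ
  have hbx := hM x (subset_closure hxΩ)
  rw [norm_mul]
  exact mul_le_mul (𝒯.abs_fe_le w x) ((norm_inner_le_norm _ _).trans (mul_le_mul hbx hx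
    (norm_nonneg _) ((norm_nonneg _).trans hbx))) (norm_nonneg _)
    (Finset.sum_nonneg fun _ _ => abs_nonneg _)

variable [NeZero d]

include 𝒯 in
lemma isFiniteMeasure_surface (hreg : interior (closure Ω) = Ω) : IsFiniteMeasure (surface Ω) :=
  ⟨𝒯.surface_univ_lt_top hreg⟩

lemma integrableOn_inlet_fe_mul_fe (hreg : interior (closure Ω) = Ω)
    (hb : ContinuousOn b (closure Ω)) (hM : ∀ x ∈ closure Ω, ‖b x‖ ≤ M) (v w : 𝒯.Node → ℝ) :
    IntegrableOn (fun x => 𝒯.fe w x * 𝒯.fe v x * ⟪b x, outwardNormal Ω x⟫)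
      (inlet Ω b) (surface Ω) := by
  have := 𝒯.isFiniteMeasure_surface hreg
  refine integrableOn_inlet (hreg ▸ isOpen_interior) hb hM (c := (∑ i, |w i|) * ∑ i, |v i|)
    ((𝒯.measurable_fe w).mul (𝒯.measurable_fe v)).aestronglyMeasurable fun x _ => ?_
  rw [abs_mul]
  exact mul_le_mul (𝒯.abs_fe_le w x) (𝒯.abs_fe_le v x) (abs_nonneg _)
    (Finset.sum_nonneg fun _ _ => abs_nonneg _)

lemma integrableOn_inlet_fe_mul {g : E d → ℝ} {B : ℝ} (hreg : interior (closure Ω) = Ω)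
    (hb : ContinuousOn b (closure Ω)) (hM : ∀ x ∈ closure Ω, ‖b x‖ ≤ M)
    (hg : ContinuousOn g (closure (inlet Ω b)))
    (hB : ∀ x ∈ closure (inlet Ω b), |g x| ≤ B) (w : 𝒯.Node → ℝ) :
    IntegrableOn (fun x => 𝒯.fe w x * g x * ⟪b x, outwardNormal Ω x⟫)
      (inlet Ω b) (surface Ω) := by
  have := 𝒯.isFiniteMeasure_surface hreg
  have hΩ : IsOpen Ω := hreg ▸ isOpen_interior
  refine integrableOn_inlet hΩ hb hM (c := (∑ i, |w i|) * B)
    ((𝒯.measurable_fe w).aestronglyMeasurable.mul (aestronglyMeasurable_inflow hΩ hb hg))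
    fun x hx => ?_
  rw [abs_mul]
  exact mul_le_mul (𝒯.abs_fe_le w x) (hB x (subset_closure hx)) (abs_nonneg _)
    (Finset.sum_nonneg fun _ _ => abs_nonneg _)

lemma two_mul_integral_openCell_advection {K : Finset (E d)} (hreg : interior (closure Ω) = Ω)
    (hb : IsSolenoidalW1Inf Ω M b) (hK : K ∈ 𝒯.cells) (v : 𝒯.Node → ℝ) :
    2 * ∫ x in openCell K, 𝒯.fe v x * ⟪b x, gradient (𝒯.fe v) x⟫ =
      ∫ x, 𝒯.fe v x * 𝒯.fe v x * ⟪b x, cellNormal K x⟫ ∂μHE[d - 1] := by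
  have hKs := 𝒯.isSimplex hK
  have hbK := hb.1.mono (𝒯.cell_subset hK)
  have hfe := (𝒯.continuousOn_fe v).mono (𝒯.cell_subset hK)
  have hdiv := hKs.integral_divergence hbK ((hb.isSolenoidalOn (hreg ▸ isOpen_interior)).mono
    (𝒯.openCell_subset hreg hK)) ((𝒯.contDiff_cellFun K v).mul (𝒯.contDiff_cellFun K v))
  rw [hKs.integral_mul_inner_cellNormal (f := fun x => 𝒯.fe v x * 𝒯.fe v x) (hfe.mul hfe) hbK,
    ← integral_const_mul]
  trans ∫ x in openCell K, fderiv ℝ (fun x => 𝒯.cellFun K v x * 𝒯.cellFun K v x) x (b x)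
  · refine setIntegral_congr_fun (isOpen_openCell K).measurableSet fun x hx => ?_
    have hgrad := (𝒯.hasGradientAt_cellFun K v x).hasFDerivAt
    have hsq := hgrad.fun_mul hgrad
    simp only [(𝒯.hasGradientAt_fe hK hx v).gradient, 𝒯.fe_eq hK (hKs.openCell_subset hx),
      hsq.fderiv, add_apply, smul_apply, InnerProductSpace.toDual_apply_apply,
      smul_eq_mul, real_inner_comm (b x)]
    ring
  · rw [hdiv]
    refine Finset.sum_congr rfl fun k _ =>
      setIntegral_congr_fun (measurableSet_openFace K k) fun x hx => ?_
    simp only [𝒯.fe_eq hK (hKs.openFace_subset hx)]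

lemma two_mul_integral_advection (hreg : interior (closure Ω) = Ω)
    (hb : IsSolenoidalW1Inf Ω M b) (v : 𝒯.Node → ℝ) :
    2 * ∫ x in Ω, 𝒯.fe v x * ⟪b x, gradient (𝒯.fe v) x⟫ =
      ∑ K ∈ 𝒯.cells, ∫ x, 𝒯.fe v x * 𝒯.fe v x * ⟪b x, cellNormal K x⟫ ∂μHE[d - 1] := by
  rw [𝒯.integral_eq_sum_cells hreg
    (𝒯.integrableOn_advection (hreg ▸ isOpen_interior) hb.1 hb.2.1 v v), Finset.mul_sum]
  exact Finset.sum_congr rfl fun K hK => 𝒯.two_mul_integral_openCell_advection hreg hb hK v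

lemma indicator_inlet_le_sum_cellNormal (hreg : interior (closure Ω) = Ω) (b : E d → E d)
    {f : E d → ℝ} {x : E d} (hf : 0 ≤ f x) :
    (inlet Ω b).indicator (fun x => f x * ⟪b x, outwardNormal Ω x⟫) x ≤
      ∑ K ∈ 𝒯.cells, f x * ⟪b x, cellNormal K x⟫ := by
  by_cases hface : ∃ K ∈ 𝒯.cells, ∃ k ∈ K, x ∈ openFace K k
  · obtain ⟨K, hK, k, hk, hx⟩ := hface
    rw [← Finset.mul_sum, ← inner_sum, 𝒯.sum_cellNormal hreg hK hk hx]
    by_cases hxi : x ∈ inlet Ω b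
    · rw [indicator_of_mem hxi, indicator_of_mem hxi.1]
    rw [indicator_of_notMem hxi]
    by_cases hxf : x ∈ frontier Ω
    · rw [indicator_of_mem hxf]
      exact mul_nonneg hf (not_lt.1 fun h => hxi ⟨hxf, h⟩)
    · rw [indicator_of_notMem hxf, inner_zero_right, mul_zero]
  · push Not at hface
    rw [Finset.sum_eq_zero fun K hK => by
      rw [cellNormal_eq_zero (hface K hK), inner_zero_right, mul_zero]]
    exact indicator_apply_nonpos fun hx => mul_nonpos_of_nonneg_of_nonpos hf hx.2.le

lemma integral_inlet_le_two_mul_integral_advection (hreg : interior (closure Ω) = Ω)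
    (hb : IsSolenoidalW1Inf Ω M b) (v : 𝒯.Node → ℝ) :
    ∫ x in inlet Ω b, 𝒯.fe v x * 𝒯.fe v x * ⟪b x, outwardNormal Ω x⟫ ∂(surface Ω) ≤
      2 * ∫ x in Ω, 𝒯.fe v x * ⟪b x, gradient (𝒯.fe v) x⟫ := by
  have hinlet := measurableSet_inlet (hreg ▸ isOpen_interior) hb.1
  have hcell : ∀ K ∈ 𝒯.cells,
      Integrable (fun x => 𝒯.fe v x * 𝒯.fe v x * ⟪b x, cellNormal K x⟫) μHE[d - 1] := fun K hK => by
    have hfe := (𝒯.continuousOn_fe v).mono (𝒯.cell_subset hK)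
    exact (𝒯.isSimplex hK).integrable_mul_inner_cellNormal (hfe.mul hfe)
      (hb.1.mono (𝒯.cell_subset hK))
  have hinflow := 𝒯.integrableOn_inlet_fe_mul_fe hreg hb.1 hb.2.1 v v
  rw [IntegrableOn, restrict_surface_inlet] at hinflow
  rw [𝒯.two_mul_integral_advection hreg hb, ← integral_finsetSum _ hcell, restrict_surface_inlet,
    ← integral_indicator hinlet]
  exact integral_mono ((integrable_indicator_iff hinlet).2 hinflow) (integrable_finsetSum _ hcell)
    fun x => 𝒯.indicator_inlet_le_sum_cellNormal hreg b (mul_self_nonneg (𝒯.fe v x))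

lemma two_mul_bForm_sub_two_mul_aForm_le (hreg : interior (closure Ω) = Ω)
    (hb : IsSolenoidalW1Inf Ω M b) {g : E d → ℝ} {B : ℝ}
    (hg : ContinuousOn g (closure (inlet Ω b)))
    (hB : ∀ x ∈ closure (inlet Ω b), |g x| ≤ B) (v : 𝒯.Node → ℝ) :
    2 * bForm Ω b g (𝒯.fe v) - 2 * aForm Ω b (𝒯.fe v) (𝒯.fe v) ≤
      |M| * (surface Ω univ).toReal * B ^ 2 := by
  have := 𝒯.isFiniteMeasure_surface hreg
  have hcoer := 𝒯.integral_inlet_le_two_mul_integral_advection hreg hb v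
  have hquad := 𝒯.integrableOn_inlet_fe_mul_fe hreg hb.1 hb.2.1 v v
  have hlin := 𝒯.integrableOn_inlet_fe_mul hreg hb.1 hb.2.1 hg hB v
  have hyoung : ∫ x in inlet Ω b, (𝒯.fe v x * 𝒯.fe v x * ⟪b x, outwardNormal Ω x⟫
      - 2 * (𝒯.fe v x * g x * ⟪b x, outwardNormal Ω x⟫)) ∂(surface Ω) ≤
      ∫ x in inlet Ω b, |M| * B ^ 2 ∂(surface Ω) := by
    refine setIntegral_mono_on (hquad.sub (hlin.const_mul 2)) integrableOn_const
      (measurableSet_inlet (hreg ▸ isOpen_interior) hb.1) fun x hx => ?_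
    have hneg : ⟪b x, outwardNormal Ω x⟫ < 0 := hx.2
    have hspeed := (abs_normalVelocity_le hb.2.1 hx.1).trans (le_abs_self M)
    rw [abs_of_neg hneg] at hspeed
    have hgB : g x ^ 2 * -⟪b x, outwardNormal Ω x⟫ ≤ B ^ 2 * |M| :=
      mul_le_mul (sq_le_sq' (neg_le_of_abs_le (hB x (subset_closure hx)))
        (le_of_abs_le (hB x (subset_closure hx)))) hspeed (neg_nonneg.2 hneg.le) (sq_nonneg _)
    nlinarith [mul_nonneg (sq_nonneg (𝒯.fe v x - g x)) (neg_nonneg.2 hneg.le)]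
  rw [integral_sub hquad (hlin.const_mul 2), integral_const_mul, setIntegral_const, smul_eq_mul]
    at hyoung
  have hmeas : (surface Ω).real (inlet Ω b) * (|M| * B ^ 2) ≤
      (surface Ω univ).toReal * (|M| * B ^ 2) :=
    mul_le_mul_of_nonneg_right (measureReal_mono (subset_univ _)) (by positivity)
  simp only [aForm, bForm]
  linarith

end Triangulation

/-! ### Mass and diffusion matrices -/

lemma sum_mul_sum_mul_sub_nonneg {ι : Type*} [Fintype ι] {s : ι → Finset ι} {c : ι → ι → ℝ}
    (hs : ∀ i j, j ∈ s i ↔ i ∈ s j) (hsymm : ∀ i, ∀ j ∈ s i, c i j = c j i)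
    (hc : ∀ i, ∀ j ∈ s i, 0 ≤ c i j) (z : ι → ℝ) :
    0 ≤ ∑ i, z i * ∑ j ∈ s i, c i j * (z i - z j) := by
  have hswap : ∑ i, ∑ j ∈ s i, c i j * (z i * (z i - z j)) =
      ∑ i, ∑ j ∈ s i, c i j * (z j * (z j - z i)) := by
    rw [Finset.sum_comm' (t' := Finset.univ) (s' := s) fun i j => by simp [hs i j]]
    exact Finset.sum_congr rfl fun i _ => Finset.sum_congr rfl fun j hj => by rw [hsymm i j hj]
  have hsq : 0 ≤ ∑ i, ∑ j ∈ s i, c i j * (z i - z j) ^ 2 :=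
    Finset.sum_nonneg fun i _ => Finset.sum_nonneg fun j hj => mul_nonneg (hc i j hj) (sq_nonneg _)
  have hexpand : ∑ i, ∑ j ∈ s i, c i j * (z i - z j) ^ 2 =
      ∑ i, ∑ j ∈ s i, c i j * (z i * (z i - z j)) +
        ∑ i, ∑ j ∈ s i, c i j * (z j * (z j - z i)) := by
    simp_rw [← Finset.sum_add_distrib]
    exact Finset.sum_congr rfl fun i _ => Finset.sum_congr rfl fun j _ => by ring
  have hform : ∑ i, z i * ∑ j ∈ s i, c i j * (z i - z j) =
      ∑ i, ∑ j ∈ s i, c i j * (z i * (z i - z j)) := by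
    simp_rw [Finset.mul_sum, mul_left_comm]
  linarith

namespace Triangulation

variable {d : ℕ} {Ω : Set (E d)} (𝒯 : Triangulation Ω)

section Mass

include 𝒯 in
lemma integrableOn_of_continuousOn_closure {f : E d → ℝ} (hf : ContinuousOn f (closure Ω)) :
    IntegrableOn f Ω :=
  (hf.integrableOn_compact 𝒯.isCompact_closure).mono_set subset_closure

lemma integrableOn_hat (i : 𝒯.Node) : IntegrableOn (𝒯.hat i) Ω :=
  𝒯.integrableOn_of_continuousOn_closure (𝒯.continuousOn_hat i)

lemma integrableOn_hat_mul_hat (i j : 𝒯.Node) :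
    IntegrableOn (fun x => 𝒯.hat i x * 𝒯.hat j x) Ω :=
  𝒯.integrableOn_of_continuousOn_closure ((𝒯.continuousOn_hat i).mul (𝒯.continuousOn_hat j))

lemma mass_comm (i j : 𝒯.Node) : 𝒯.mass i j = 𝒯.mass j i := by
  simp only [mass, mul_comm]

lemma mass_nonneg (i j : 𝒯.Node) : 0 ≤ 𝒯.mass i j :=
  integral_nonneg fun x => mul_nonneg (𝒯.hat_nonneg i x) (𝒯.hat_nonneg j x)

lemma lumped_nonneg (i : 𝒯.Node) : 0 ≤ 𝒯.lumped i :=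
  Finset.sum_nonneg fun j _ => 𝒯.mass_nonneg i j

variable (hΩ : IsOpen Ω)
include hΩ

lemma lumped_eq (i : 𝒯.Node) : 𝒯.lumped i = ∫ x in Ω, 𝒯.hat i x := by
  simp only [lumped, mass]
  rw [← integral_finsetSum _ fun j _ => 𝒯.integrableOn_hat_mul_hat i j]
  refine setIntegral_congr_fun hΩ.measurableSet fun x hx => ?_
  simp only [← Finset.mul_sum, 𝒯.sum_hat (subset_closure hx), mul_one]

lemma sum_lumped : ∑ i, 𝒯.lumped i = (volume Ω).toReal := by
  simp_rw [𝒯.lumped_eq hΩ]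
  rw [← integral_finsetSum _ fun j _ => 𝒯.integrableOn_hat j,
    setIntegral_congr_fun hΩ.measurableSet fun x hx => 𝒯.sum_hat (subset_closure hx),
    setIntegral_const, smul_eq_mul, mul_one, Measure.real]

lemma mass_self_pos (i : 𝒯.Node) : 0 < 𝒯.mass i i := by
  rw [mass, setIntegral_pos_iff_support_of_nonneg_ae
    (Eventually.of_forall fun x => mul_self_nonneg _) (𝒯.integrableOn_hat_mul_hat i i)]
  have hpos : ∀ᶠ x in 𝓝[closure Ω] (i : E d), 0 < 𝒯.hat i x :=
    (𝒯.continuousOn_hat i i (𝒯.node_mem_closure i)).eventually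
      (lt_mem_nhds (by rw [𝒯.hat_self]; exact one_pos))
  obtain ⟨V, hV, hiV, hsub⟩ := mem_nhdsWithin.1 hpos
  have hne : (V ∩ Ω).Nonempty := _root_.mem_closure_iff.1 (𝒯.node_mem_closure i) V hV hiV
  refine ((hV.inter hΩ).measure_pos volume hne).trans_le (measure_mono fun x hx => ⟨?_, hx.2⟩)
  exact (mul_self_pos.2 (hsub ⟨hx.1, subset_closure hx.2⟩).ne').ne'

lemma lumped_pos (i : 𝒯.Node) : 0 < 𝒯.lumped i :=
  (𝒯.mass_self_pos hΩ i).trans_le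
    (Finset.single_le_sum (fun j _ => 𝒯.mass_nonneg i j) (Finset.mem_univ i))

lemma integral_sq_fe_le (v : 𝒯.Node → ℝ) :
    ∫ x in Ω, 𝒯.fe v x ^ 2 ≤ ∑ i, 𝒯.lumped i * v i ^ 2 := by
  have hintegrable : ∀ i, IntegrableOn (fun x => 𝒯.hat i x * v i ^ 2) Ω := fun i =>
    (𝒯.integrableOn_hat i).mul_const _
  have hjensen : ∀ x ∈ Ω, 𝒯.fe v x ^ 2 ≤ ∑ i, 𝒯.hat i x * v i ^ 2 := fun x hx => by
    simpa only [fe, mul_comm (v _)] using Real.pow_arith_mean_le_arith_mean_pow_of_even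
      Finset.univ (fun i => 𝒯.hat i x) v (fun i _ => 𝒯.hat_nonneg i x)
      (𝒯.sum_hat (subset_closure hx)) even_two
  calc ∫ x in Ω, 𝒯.fe v x ^ 2 ≤ ∫ x in Ω, ∑ i, 𝒯.hat i x * v i ^ 2 :=
        setIntegral_mono_on (𝒯.integrableOn_of_continuousOn_closure ((𝒯.continuousOn_fe v).pow 2))
          (integrable_finsetSum _ fun i _ => hintegrable i) hΩ.measurableSet hjensen
    _ = ∑ i, 𝒯.lumped i * v i ^ 2 := by
        rw [integral_finsetSum _ fun i _ => hintegrable i]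
        exact Finset.sum_congr rfl fun i _ => by rw [integral_mul_const, 𝒯.lumped_eq hΩ]

lemma eLpNorm_fe_le (v : 𝒯.Node → ℝ) :
    eLpNorm (𝒯.fe v) 2 (volume.restrict Ω) ≤
      ENNReal.ofReal √(∑ i, 𝒯.lumped i * v i ^ 2) := by
  have hmem : MemLp (𝒯.fe v) 2 (volume.restrict Ω) :=
    (memLp_two_iff_integrable_sq (𝒯.measurable_fe v).aestronglyMeasurable).2
      (𝒯.integrableOn_of_continuousOn_closure ((𝒯.continuousOn_fe v).pow 2))
  rw [hmem.eLpNorm_eq_integral_rpow_norm (by norm_num) (by norm_num)]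
  refine ENNReal.ofReal_le_ofReal ?_
  simp only [ENNReal.toReal_ofNat, Real.rpow_ofNat, Real.norm_eq_abs, sq_abs]
  rw [← one_div, ← Real.sqrt_eq_rpow]
  exact Real.sqrt_le_sqrt (𝒯.integral_sq_fe_le hΩ v)

end Mass

section Diffusion

lemma mem_stencil'_iff {i j : 𝒯.Node} : j ∈ 𝒯.stencil' i ↔ j ≠ i ∧ 𝒯.mass i j ≠ 0 := by
  simp [stencil', stencil]

lemma mem_stencil'_comm (i j : 𝒯.Node) : j ∈ 𝒯.stencil' i ↔ i ∈ 𝒯.stencil' j := by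
  rw [mem_stencil'_iff, mem_stencil'_iff, 𝒯.mass_comm, ne_comm]

variable {i j : 𝒯.Node}

lemma ne_of_mem_stencil' (hj : j ∈ 𝒯.stencil' i) : i ≠ j :=
  (𝒯.mem_stencil'_iff.1 hj).1.symm

lemma dMat_of_ne (b : E d → E d) (h : i ≠ j) :
    𝒯.dMat b i j = max |𝒯.aMat b i j| |𝒯.aMat b j i| :=
  if_neg h

lemma dMat_comm (b : E d → E d) (h : i ≠ j) : 𝒯.dMat b i j = 𝒯.dMat b j i := by
  rw [𝒯.dMat_of_ne b h, 𝒯.dMat_of_ne b h.symm, max_comm]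

lemma abs_aMat_le_dMat (b : E d → E d) (h : i ≠ j) : |𝒯.aMat b i j| ≤ 𝒯.dMat b i j :=
  (le_max_left _ _).trans_eq (𝒯.dMat_of_ne b h).symm

lemma dMat_nonneg (b : E d → E d) (h : i ≠ j) : 0 ≤ 𝒯.dMat b i j :=
  (abs_nonneg _).trans (𝒯.abs_aMat_le_dMat b h)

lemma dForm_self_nonneg (b : E d → E d) {α : 𝒯.Node → 𝒯.Node → ℝ} (hα : 𝒯.IsCorrection α)
    (v : 𝒯.Node → ℝ) : 0 ≤ 𝒯.dForm b α v v :=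
  sum_mul_sum_mul_sub_nonneg 𝒯.mem_stencil'_comm
    (fun i j hj => by rw [(hα i j).1, 𝒯.dMat_comm b (𝒯.ne_of_mem_stencil' hj)])
    (fun i j hj => mul_nonneg (sub_nonneg.2 (hα i j).2.2)
      (𝒯.dMat_nonneg b (𝒯.ne_of_mem_stencil' hj))) v

lemma mForm_self_nonneg {β : 𝒯.Node → 𝒯.Node → ℝ} (hβ : 𝒯.IsCorrection β)
    (v : 𝒯.Node → ℝ) : 0 ≤ 𝒯.mForm β v v :=
  sum_mul_sum_mul_sub_nonneg 𝒯.mem_stencil'_comm (fun i j _ => by rw [(hβ i j).1, 𝒯.mass_comm])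
    (fun i j _ => mul_nonneg (hβ i j).2.1 (𝒯.mass_nonneg i j)) v

variable {𝒯} in
lemma GCC.mForm_le_dForm {γ h lam : ℝ} {b : E d → E d} {α β : 𝒯.Node → 𝒯.Node → ℝ}
    {v' v : 𝒯.Node → ℝ} (hgcc : 𝒯.GCC γ h lam b α β v' v) (hγ : 0 ≤ γ) (hh : 0 ≤ h)
    (hlam : 0 ≤ lam) (hα : 𝒯.IsCorrection α) (hβ : 𝒯.IsCorrection β) :
    𝒯.mForm β v' v ≤ 𝒯.dForm b α v v := by
  have hstab : 0 ≤ γ * h / lam * 𝒯.mForm β v' v' :=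
    mul_nonneg (div_nonneg (mul_nonneg hγ hh) hlam) (𝒯.mForm_self_nonneg hβ v')
  have hdiss := mul_nonneg hγ (𝒯.dForm_self_nonneg b hα v)
  rw [GCC] at hgcc
  linarith

end Diffusion

end Triangulation

/-! ### Energy stability -/

section AbsolutelyContinuous

variable {a b : ℝ}

lemma absolutelyContinuousOnInterval_sum {ι : Type*} {f : ι → ℝ → ℝ} (s : Finset ι)
    (hf : ∀ i ∈ s, AbsolutelyContinuousOnInterval (f i) a b) :
    AbsolutelyContinuousOnInterval (fun t => ∑ i ∈ s, f i t) a b := by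
  classical
  induction s using Finset.induction_on with
  | empty =>
    simpa only [Finset.sum_empty] using
      (LipschitzWith.const (0 : ℝ)).lipschitzOnWith.absolutelyContinuousOnInterval
  | insert i s hi ih =>
    simp only [Finset.sum_insert hi]
    exact (hf i (Finset.mem_insert_self i s)).fun_add
      (ih fun j hj => hf j (Finset.mem_insert_of_mem hj))

variable {f g : ℝ → ℝ}
  (hac : ∀ s t, a < s → s ≤ t → t < b → AbsolutelyContinuousOnInterval f s t)
include hac

lemma ae_differentiableAt_of_absolutelyContinuousOnInterval :
    ∀ᵐ t ∂volume.restrict (Ioo a b), DifferentiableAt ℝ f t := by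
  rw [ae_restrict_iff' measurableSet_Ioo, ae_iff]
  refine measure_null_of_locally_null _ fun x hx => ?_
  obtain ⟨⟨hax, hxb⟩, -⟩ := Classical.not_imp.1 hx
  obtain ⟨s, has, hsx⟩ := exists_between hax
  obtain ⟨t, hxt, htb⟩ := exists_between hxb
  refine ⟨_, inter_mem_nhdsWithin _ (Icc_mem_nhds hsx hxt), ?_⟩
  refine measure_mono_null (fun r hr => ?_)
    (ae_iff.1 (hac s t has (hsx.trans hxt).le htb).ae_differentiableAt)
  exact Classical.not_imp.2 ⟨Icc_subset_uIcc hr.2, (Classical.not_imp.1 hr.1).2⟩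

lemma le_add_setIntegral_of_ae_deriv_le (hf : ContinuousOn f (Ico a b))
    (hg : IntegrableOn g (Ioo a b)) (hg0 : ∀ᵐ t ∂volume.restrict (Ioo a b), 0 ≤ g t)
    (hfg : ∀ᵐ t ∂volume.restrict (Ioo a b), deriv f t ≤ g t) {t : ℝ} (ht : t ∈ Ico a b) :
    f t ≤ f a + ∫ r in Ioo a b, g r := by
  rcases ht.1.eq_or_lt with rfl | hat
  · exact le_add_of_nonneg_right (integral_nonneg_of_ae hg0)
  have hincr : ∀ s ∈ Ioo a t, f t ≤ f s + ∫ r in Ioo a b, g r := by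
    intro s hs
    have hsub : Ioc s t ⊆ Ioo a b := fun r hr => ⟨hs.1.trans hr.1, hr.2.trans_lt ht.2⟩
    have hst := hac s t hs.1 hs.2.le ht.2
    have hderiv := (intervalIntegrable_iff_integrableOn_Ioc_of_le hs.2.le).1
      hst.intervalIntegrable_deriv
    rw [← sub_le_iff_le_add', ← hst.integral_deriv_eq_sub,
      intervalIntegral.integral_of_le hs.2.le]
    exact (integral_mono_ae hderiv (hg.mono_set hsub)
      (ae_restrict_of_ae_restrict_of_subset hsub hfg)).trans
        (setIntegral_mono_set hg hg0 hsub.eventuallyLE)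
  have hlim : Tendsto (fun s => f s + ∫ r in Ioo a b, g r) (𝓝[>] a)
      (𝓝 (f a + ∫ r in Ioo a b, g r)) := by
    refine ((hf a ⟨le_rfl, hat.trans ht.2⟩).mono_left ?_).add_const _
    rw [← nhdsWithin_Ioo_eq_nhdsGT (hat.trans ht.2)]
    exact nhdsWithin_mono _ Ioo_subset_Ico_self
  exact ge_of_tendsto hlim (by filter_upwards [Ioo_mem_nhdsGT hat] with s hs using hincr s hs)

end AbsolutelyContinuous

section Stability

variable {d : ℕ} {Ω : Set (E d)}

/-- The a priori bound of the squared lumped `L²` norm on `(0,T)`: the initial energy plus the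
energy that enters through the inlet. -/
def energyBound (Ω : Set (E d)) (T M U : ℝ) (B : ℝ → ℝ) : ℝ :=
  U ^ 2 * (volume Ω).toReal + |M| * (surface Ω univ).toReal * ∫ s in Ioo 0 T, B s ^ 2

lemma energyBound_mono {τ T M U : ℝ} {B : ℝ → ℝ} (hτ : τ ≤ T)
    (hB : IntegrableOn (fun t => B t ^ 2) (Ioo 0 T)) :
    energyBound Ω τ M U B ≤ energyBound Ω T M U B := by
  unfold energyBound
  gcongr
  exact Eventually.of_forall fun t => sq_nonneg (B t)

namespace Triangulation

variable {𝒯 : Triangulation Ω}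

lemma IsSolution.ae_differentiableAt {a : ℝ → E d → E d} {uin : ℝ → E d → ℝ} {u0 : E d → ℝ}
    {τ : ℝ} {α β : ℝ → 𝒯.Node → 𝒯.Node → ℝ} {u' u : ℝ → 𝒯.Node → ℝ}
    (hsol : 𝒯.IsSolution a uin u0 τ α β u' u) :
    ∀ᵐ t ∂volume.restrict (Ioo 0 τ), ∀ i, DifferentiableAt ℝ (fun s => u s i) t :=
  ae_all_iff.2 fun i =>
    ae_differentiableAt_of_absolutelyContinuousOnInterval (hsol.absolutelyContinuous i)

variable [NeZero d] {M : ℝ}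

lemma two_mul_sum_lumped_mul_le {b : E d → E d} {g : E d → ℝ} {B γ h lam : ℝ}
    {α β : 𝒯.Node → 𝒯.Node → ℝ} {v' v w : 𝒯.Node → ℝ} (hreg : interior (closure Ω) = Ω)
    (hb : IsSolenoidalW1Inf Ω M b) (hg : ContinuousOn g (closure (inlet Ω b)))
    (hB : ∀ x ∈ closure (inlet Ω b), |g x| ≤ B)
    (hα : 𝒯.IsCorrection α) (hβ : 𝒯.IsCorrection β) (hγ : 0 ≤ γ) (hh : 0 ≤ h) (hlam : 0 ≤ lam)
    (hgcc : 𝒯.GCC γ h lam b α β v' v)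
    (hweak : ∑ i, v i * 𝒯.lumped i * w i + aForm Ω b (𝒯.fe v) (𝒯.fe v) + 𝒯.dForm b α v v =
      bForm Ω b g (𝒯.fe v) + 𝒯.mForm β v' v) :
    2 * ∑ i, v i * 𝒯.lumped i * w i ≤ |M| * (surface Ω univ).toReal * B ^ 2 := by
  have hforms := 𝒯.two_mul_bForm_sub_two_mul_aForm_le hreg hb hg hB v
  have hcorr := hgcc.mForm_le_dForm hγ hh hlam hα hβ
  linarith

variable {a : ℝ → E d → E d} {uin : ℝ → E d → ℝ} {u0 : E d → ℝ} {B : ℝ → ℝ} {U γ h lam τ : ℝ}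
  {α β : ℝ → 𝒯.Node → 𝒯.Node → ℝ} {u' u : ℝ → 𝒯.Node → ℝ}

lemma IsSolution.sum_lumped_mul_sq_le
    (hsol : 𝒯.IsSolution a uin u0 τ α β u' u) (hreg : interior (closure Ω) = Ω)
    (ha : ∀ᵐ t ∂volume.restrict (Ioo 0 τ), IsSolenoidalW1Inf Ω M (a t))
    (hB : IntegrableOn (fun t => B t ^ 2) (Ioo 0 τ))
    (huin : ∀ᵐ t ∂volume.restrict (Ioo 0 τ), ContinuousOn (uin t) (closure (inlet Ω (a t))) ∧
      ∀ x ∈ closure (inlet Ω (a t)), |uin t x| ≤ B t)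
    (hU : ∀ x ∈ closure Ω, |u0 x| ≤ U) (hγ : 0 ≤ γ) (hh : 0 ≤ h) (hlam : 0 ≤ lam)
    (hαβ : ∀ᵐ t ∂volume.restrict (Ioo 0 τ), 𝒯.IsCorrection (α t) ∧ 𝒯.IsCorrection (β t))
    (hgcc : ∀ᵐ t ∂volume.restrict (Ioo 0 τ), 𝒯.GCC γ h lam (a t) (α t) (β t) (u' t) (u t))
    {t : ℝ} (ht : t ∈ Ico 0 τ) :
    ∑ i, 𝒯.lumped i * u t i ^ 2 ≤ energyBound Ω τ M U B := by
  have hinit : ∑ i, 𝒯.lumped i * u 0 i ^ 2 ≤ U ^ 2 * (volume Ω).toReal := by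
    rw [← 𝒯.sum_lumped (hreg ▸ isOpen_interior), Finset.mul_sum]
    refine Finset.sum_le_sum fun i _ => ?_
    rw [hsol.initial i, mul_comm]
    have hi := abs_le.1 (hU _ (𝒯.node_mem_closure i))
    exact mul_le_mul_of_nonneg_right (sq_le_sq' hi.1 hi.2) (𝒯.lumped_nonneg i)
  have hcont : ContinuousOn (fun t => ∑ i, 𝒯.lumped i * u t i ^ 2) (Ico 0 τ) :=
    continuousOn_finsetSum _ fun i _ => continuousOn_const.mul ((hsol.continuousOn i).pow 2)
  have hac : ∀ s t, 0 < s → s ≤ t → t < τ →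
      AbsolutelyContinuousOnInterval (fun t => ∑ i, 𝒯.lumped i * u t i ^ 2) s t := by
    intro s t hs hst ht
    simp only [sq]
    refine absolutelyContinuousOnInterval_sum _ fun i _ => ?_
    have hi := hsol.absolutelyContinuous i s t hs hst ht
    exact (hi.fun_mul hi).const_mul _
  have henergy : ∀ᵐ t ∂volume.restrict (Ioo 0 τ), deriv (fun t => ∑ i, 𝒯.lumped i * u t i ^ 2) t ≤
      |M| * (surface Ω univ).toReal * B t ^ 2 := by
    filter_upwards [ha, huin, hαβ, hgcc, hsol.weak, hsol.ae_differentiableAt]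
      with t hat hut hαt hgt hweak hdiff
    refine le_of_eq_of_le ?_ (two_mul_sum_lumped_mul_le hreg hat hut.1 hut.2 hαt.1 hαt.2 hγ hh hlam
      hgt (hweak (u t)))
    rw [deriv_fun_sum fun i _ => ((hdiff i).fun_pow 2).const_mul _, Finset.mul_sum]
    refine Finset.sum_congr rfl fun i _ => ?_
    rw [deriv_const_mul _ ((hdiff i).fun_pow 2), deriv_fun_pow (hdiff i)]
    push_cast
    ring
  refine (le_add_setIntegral_of_ae_deriv_le hac hcont (hB.const_mul _)
    (Eventually.of_forall fun t => by positivity) henergy ht).trans ?_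
  rw [energyBound, integral_const_mul]
  exact add_le_add_left hinit _

lemma IsSolution.eLpNorm_fe_le {T : ℝ}
    (hsol : 𝒯.IsSolution a uin u0 τ α β u' u) (hreg : interior (closure Ω) = Ω) (hτ : τ ≤ T)
    (ha : ∀ᵐ t ∂volume.restrict (Ioo 0 T), IsSolenoidalW1Inf Ω M (a t))
    (hB : IntegrableOn (fun t => B t ^ 2) (Ioo 0 T))
    (huin : ∀ᵐ t ∂volume.restrict (Ioo 0 T), ContinuousOn (uin t) (closure (inlet Ω (a t))) ∧
      ∀ x ∈ closure (inlet Ω (a t)), |uin t x| ≤ B t)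
    (hU : ∀ x ∈ closure Ω, |u0 x| ≤ U) (hγ : 0 ≤ γ) (hh : 0 ≤ h) (hlam : 0 ≤ lam)
    (hαβ : ∀ᵐ t ∂volume.restrict (Ioo 0 τ), 𝒯.IsCorrection (α t) ∧ 𝒯.IsCorrection (β t))
    (hgcc : ∀ᵐ t ∂volume.restrict (Ioo 0 τ), 𝒯.GCC γ h lam (a t) (α t) (β t) (u' t) (u t))
    {t : ℝ} (ht : t ∈ Ico 0 τ) :
    eLpNorm (𝒯.fe (u t)) 2 (volume.restrict Ω) ≤ ENNReal.ofReal √(energyBound Ω T M U B) := by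
  have hsub : Ioo 0 τ ⊆ Ioo 0 T := Ioo_subset_Ioo_right hτ
  have henergy := hsol.sum_lumped_mul_sq_le hreg (ae_restrict_of_ae_restrict_of_subset hsub ha)
    (hB.mono_set hsub) (ae_restrict_of_ae_restrict_of_subset hsub huin) hU hγ hh hlam hαβ hgcc ht
  exact (𝒯.eLpNorm_fe_le (hreg ▸ isOpen_interior) (u t)).trans
    (ENNReal.ofReal_le_ofReal (Real.sqrt_le_sqrt (henergy.trans (energyBound_mono hτ hB))))

end Triangulation

end Stability

/-! ### Carathéodory functions -/

section Modification

variable {α Y V : Type*} [MeasurableSpace α] {μ : Measure α} [TopologicalSpace Y]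
  [TopologicalSpace.MetrizableSpace Y] [SecondCountableTopology Y] [MeasurableSpace Y]
  [OpensMeasurableSpace Y] [TopologicalSpace V] [TopologicalSpace.PseudoMetrizableSpace V]
  [MeasurableSpace V] [BorelSpace V] [Zero V]

lemma exists_measurable_modification {f : α → Y → V} (hm : ∀ y, AEMeasurable (fun t => f t y) μ)
    (hc : ∀ᵐ t ∂μ, Continuous (f t)) :
    ∃ F : α → Y → V, Measurable (Function.uncurry F) ∧ ∀ᵐ t ∂μ, F t = f t := by
  classical
  obtain ⟨D, hD, hDd⟩ := TopologicalSpace.exists_countable_dense Y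
  have hmk : ∀ᵐ t ∂μ, ∀ y ∈ D, f t y = (hm y).mk _ t :=
    (ae_ball_iff hD).2 fun y _ => (hm y).ae_eq_mk
  obtain ⟨S, hS, hSm, hSp⟩ := (hc.and hmk).exists_measurable_mem
  let F : α → Y → V := fun t y => if t ∈ S then f t y else 0
  have hFc : ∀ t, Continuous (F t) := fun t => by
    by_cases ht : t ∈ S
    · simpa only [F, if_pos ht] using (hSp t ht).1
    · simpa only [F, if_neg ht] using continuous_const
  have hFD : ∀ y ∈ D, Measurable fun t => F t y := fun y hy => by
    have : (fun t => F t y) = S.indicator ((hm y).mk _) := by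
      ext t
      by_cases ht : t ∈ S
      · simp only [F, if_pos ht, indicator_of_mem ht, (hSp t ht).2 y hy]
      · simp only [F, if_neg ht, indicator_of_notMem ht]
    rw [this]
    exact (hm y).measurable_mk.indicator hSm
  have hFm : ∀ y, Measurable fun t => F t y := fun y => by
    obtain ⟨x, hxD, hx⟩ := mem_closure_iff_seq_limit.1 (hDd y)
    refine measurable_of_tendsto_metrizable (fun n => hFD (x n) (hxD n)) ?_
    exact tendsto_pi_nhds.2 fun t => ((hFc t).tendsto y).comp hx
  refine ⟨F, (measurable_uncurry_of_continuous_of_measurable (u := fun y t => F t y) hFc hFm).comp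
    measurable_swap, ?_⟩
  filter_upwards [hS] with t ht
  ext y
  simp only [F, if_pos ht]

lemma aemeasurable_integral_of_continuous {f : α → Y → V}
    (hm : ∀ y, AEMeasurable (fun t => f t y) μ) (hc : ∀ᵐ t ∂μ, Continuous (f t)) {ν : Measure Y}
    [SFinite ν] {g : V → Y → ℝ} (hg : Measurable (Function.uncurry g)) :
    AEMeasurable (fun t => ∫ y, g (f t y) y ∂ν) μ := by
  obtain ⟨F, hF, hFf⟩ := exists_measurable_modification hm hc
  have h1 : Measurable fun p : α × Y => g (F p.1 p.2) p.2 := hg.comp (hF.prodMk measurable_snd)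
  refine ⟨fun t => ∫ y, g (F t y) y ∂ν, h1.stronglyMeasurable.integral_prod_right.measurable, ?_⟩
  filter_upwards [hFf] with t ht
  rw [ht]

end Modification

/-- A Carathéodory function of time `t` and state `v`: measurable in `t`, Lipschitz continuous in
`v` uniformly in `t`, with `f t 0` dominated by an integrable function. -/
structure IsCaratheodory {α X V : Type*} [MeasurableSpace α] [NormedAddCommGroup X]
    [NormedAddCommGroup V] (μ : Measure α) (f : α → X → V) : Prop where
  aestronglyMeasurable : ∀ v, AEStronglyMeasurable (fun t => f t v) μ
  lipschitz : ∃ K : ℝ≥0, ∀ᵐ t ∂μ, LipschitzWith K (f t)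
  bound : ∃ k : α → ℝ, Integrable k μ ∧ ∀ᵐ t ∂μ, ‖f t 0‖ ≤ k t

namespace IsCaratheodory

section Normed

variable {α X V : Type*} [MeasurableSpace α] {μ : Measure α} [NormedAddCommGroup X]
  [NormedAddCommGroup V] {f g : α → X → V}

lemma congr (hf : IsCaratheodory μ f) (h : ∀ᵐ t ∂μ, f t = g t) : IsCaratheodory μ g := by
  obtain ⟨K, hK⟩ := hf.lipschitz
  obtain ⟨k, hk, hk'⟩ := hf.bound
  refine ⟨fun v => (hf.aestronglyMeasurable v).congr ?_, ⟨K, ?_⟩, k, hk, ?_⟩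
  · filter_upwards [h] with t ht using congrFun ht v
  · filter_upwards [h, hK] with t ht ht' using ht ▸ ht'
  · filter_upwards [h, hk'] with t ht ht' using ht ▸ ht'

lemma of_integrable {c : α → V} (hc : Integrable c μ) : IsCaratheodory μ fun t (_ : X) => c t :=
  ⟨fun _ => hc.aestronglyMeasurable, ⟨0, .of_forall fun t => LipschitzWith.const (c t)⟩,
    fun t => ‖c t‖, hc.norm, .of_forall fun _ => le_rfl⟩

lemma add (hf : IsCaratheodory μ f) (hg : IsCaratheodory μ g) :
    IsCaratheodory μ fun t v => f t v + g t v := by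
  obtain ⟨K, hK⟩ := hf.lipschitz
  obtain ⟨k, hk, hk'⟩ := hf.bound
  obtain ⟨L, hL⟩ := hg.lipschitz
  obtain ⟨l, hl, hl'⟩ := hg.bound
  refine ⟨fun v => (hf.aestronglyMeasurable v).add (hg.aestronglyMeasurable v), ⟨K + L, ?_⟩,
    fun t => k t + l t, hk.add hl, ?_⟩
  · filter_upwards [hK, hL] with t h1 h2 using h1.add h2
  · filter_upwards [hk', hl'] with t h1 h2 using norm_add_le_of_le h1 h2

lemma neg (hf : IsCaratheodory μ f) : IsCaratheodory μ fun t v => -f t v := by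
  obtain ⟨K, hK⟩ := hf.lipschitz
  obtain ⟨k, hk, hk'⟩ := hf.bound
  refine ⟨fun v => (hf.aestronglyMeasurable v).neg, ⟨K, hK.mono fun t ht => ht.neg⟩, k, hk, ?_⟩
  simpa only [norm_neg] using hk'

lemma sub (hf : IsCaratheodory μ f) (hg : IsCaratheodory μ g) :
    IsCaratheodory μ fun t v => f t v - g t v := by
  simpa only [sub_eq_add_neg] using hf.add hg.neg

lemma sum {κ : Type*} (s : Finset κ) {f : κ → α → X → V}
    (hf : ∀ j ∈ s, IsCaratheodory μ (f j)) : IsCaratheodory μ fun t v => ∑ j ∈ s, f j t v := by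
  classical
  induction s using Finset.induction_on with
  | empty => simpa only [Finset.sum_empty] using of_integrable (integrable_zero _ _ _)
  | insert j s hj ih =>
    simp only [Finset.sum_insert hj]
    exact (hf j (Finset.mem_insert_self j s)).add
      (ih fun k hk => hf k (Finset.mem_insert_of_mem hk))

lemma comp_neg (hf : IsCaratheodory μ f) : IsCaratheodory μ fun t v => f t (-v) := by
  obtain ⟨K, hK⟩ := hf.lipschitz
  obtain ⟨k, hk, hk'⟩ := hf.bound
  refine ⟨fun v => hf.aestronglyMeasurable (-v), ⟨K, ?_⟩, k, hk, by simpa only [neg_zero] using hk'⟩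
  filter_upwards [hK] with t ht
  exact LipschitzWith.of_dist_le_mul fun v w => by
    simpa only [dist_neg_neg] using ht.dist_le_mul (-v) (-w)

lemma smul [NormedSpace ℝ V] (hf : IsCaratheodory μ f) {c : α → ℝ} (hc : AEStronglyMeasurable c μ)
    {A : ℝ} (hA : ∀ᵐ t ∂μ, |c t| ≤ A) : IsCaratheodory μ fun t v => c t • f t v := by
  obtain ⟨K, hK⟩ := hf.lipschitz
  obtain ⟨k, hk, hk'⟩ := hf.bound
  refine ⟨fun v => hc.smul (hf.aestronglyMeasurable v), ⟨A.toNNReal * K, ?_⟩, fun t => |A| * k t,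
    hk.const_mul _, ?_⟩
  · filter_upwards [hK, hA] with t hKt hAt
    refine LipschitzWith.of_dist_le_mul fun v w => ?_
    rw [dist_smul₀, Real.norm_eq_abs, NNReal.coe_mul, mul_assoc]
    exact mul_le_mul (hAt.trans (Real.le_coe_toNNReal A)) (hKt.dist_le_mul v w) dist_nonneg
      NNReal.zero_le_coe
  · filter_upwards [hk', hA] with t hkt hAt
    rw [norm_smul]
    exact mul_le_mul (hAt.trans (le_abs_self A)) hkt (norm_nonneg _) (abs_nonneg _)

lemma const_smul [NormedSpace ℝ V] (hf : IsCaratheodory μ f) (c : ℝ) :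
    IsCaratheodory μ fun t v => c • f t v :=
  hf.smul aestronglyMeasurable_const (.of_forall fun _ => le_rfl)

/-- Superposition: although `f` need not be jointly measurable, a modification of it is. -/
lemma integrable_comp [SecondCountableTopology X] [SecondCountableTopology V]
    (hf : IsCaratheodory μ f) {w : α → X} (hw : Integrable w μ) :
    Integrable (fun t => f t (w t)) μ := by
  borelize X V
  obtain ⟨K, hK⟩ := hf.lipschitz
  obtain ⟨k, hk, hk'⟩ := hf.bound
  obtain ⟨F, hF, hFf⟩ := exists_measurable_modification
    (fun v => (hf.aestronglyMeasurable v).aemeasurable) (hK.mono fun t ht => ht.continuous)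
  have hmeas : AEStronglyMeasurable (fun t => f t (w t)) μ :=
    (hF.comp_aemeasurable (aemeasurable_id.prodMk hw.aemeasurable)).aestronglyMeasurable.congr
      (hFf.mono fun t ht => congrFun ht (w t))
  refine (hk.add (hw.norm.const_mul K)).mono' hmeas ?_
  filter_upwards [hK, hk'] with t hKt hkt
  have hdist := hKt.dist_le_mul (w t) 0
  rw [dist_eq_norm, dist_zero_right] at hdist
  exact (norm_le_norm_add_norm_sub' _ _).trans (add_le_add hkt hdist)

end Normed

section Real

variable {α X ι : Type*} [MeasurableSpace α] {μ : Measure α} [NormedAddCommGroup X] [Fintype ι]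
  {f g : α → X → ℝ}

lemma coord (i : ι) : IsCaratheodory μ fun (_ : α) (v : ι → ℝ) => v i :=
  ⟨fun _ => aestronglyMeasurable_const, ⟨1, .of_forall fun _ => LipschitzWith.eval i⟩,
    0, integrable_zero _ _ _, .of_forall fun _ => norm_zero.le⟩

lemma pi {f : α → X → ι → ℝ} (hf : ∀ i, IsCaratheodory μ fun t v => f t v i) :
    IsCaratheodory μ f := by
  choose K hK using fun i => (hf i).lipschitz
  choose k hk hk' using fun i => (hf i).bound
  refine ⟨fun v => (aemeasurable_pi_iff.2 fun i =>
    ((hf i).aestronglyMeasurable v).aemeasurable).aestronglyMeasurable,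
    ⟨∑ i, K i, ?_⟩, fun t => ∑ i, ‖k i t‖, integrable_finsetSum _ fun i _ => (hk i).norm, ?_⟩
  · filter_upwards [ae_all_iff.2 hK] with t ht
    refine LipschitzWith.of_dist_le_mul fun v w => ?_
    refine (dist_pi_le_iff (by positivity)).2 fun i => ((ht i).dist_le_mul v w).trans ?_
    gcongr
    exact Finset.single_le_sum (f := K) (fun _ _ => zero_le) (Finset.mem_univ i)
  · filter_upwards [ae_all_iff.2 hk'] with t ht
    refine (pi_norm_le_iff_of_nonneg (by positivity)).2 fun i => ?_
    exact ((ht i).trans (le_abs_self _)).trans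
      (Finset.single_le_sum (f := fun i => ‖k i t‖) (fun _ _ => norm_nonneg _) (Finset.mem_univ i))

lemma max (hf : IsCaratheodory μ f) (hg : IsCaratheodory μ g) :
    IsCaratheodory μ fun t v => Max.max (f t v) (g t v) := by
  obtain ⟨K, hK⟩ := hf.lipschitz
  obtain ⟨k, hk, hk'⟩ := hf.bound
  obtain ⟨L, hL⟩ := hg.lipschitz
  obtain ⟨l, hl, hl'⟩ := hg.bound
  refine ⟨fun v => (hf.aestronglyMeasurable v).sup (hg.aestronglyMeasurable v),
    ⟨Max.max K L, ?_⟩, fun t => Max.max (k t) (l t), hk.sup hl, ?_⟩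
  · filter_upwards [hK, hL] with t h1 h2 using h1.max h2
  · filter_upwards [hk', hl'] with t h1 h2 using abs_max_le_max_abs_abs.trans (max_le_max h1 h2)

lemma min (hf : IsCaratheodory μ f) (hg : IsCaratheodory μ g) :
    IsCaratheodory μ fun t v => Min.min (f t v) (g t v) := by
  refine (hf.neg.max hg.neg).neg.congr (.of_forall fun t => ?_)
  ext v
  rw [max_neg_neg, neg_neg]

end Real

end IsCaratheodory

/-! ### Carathéodory differential equations -/

section Picard

variable {X : Type*} [NormedAddCommGroup X] [SecondCountableTopology X] {T : ℝ} {F : ℝ → X → X}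

lemma IsCaratheodory.intervalIntegrable_IccExtend
    (hF : IsCaratheodory (volume.restrict (Ioo 0 T)) F) (hT : 0 ≤ T) (w : C(Icc 0 T, X)) {t : ℝ}
    (ht : t ∈ Icc 0 T) : IntervalIntegrable (fun s => F s (IccExtend hT w s)) volume 0 t := by
  have hw : IntegrableOn (IccExtend hT w) (Ioo 0 T) :=
    (w.continuous.Icc_extend'.integrableOn_Icc (a := 0) (b := T)).mono_set Ioo_subset_Icc_self
  rw [intervalIntegrable_iff_integrableOn_Ioo_of_le ht.1]
  exact (hF.integrable_comp hw).mono_measure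
    (Measure.restrict_mono (Ioo_subset_Ioo_right ht.2) le_rfl)

variable [NormedSpace ℝ X]

/-- The Picard operator of `u' = F t u`, `u 0 = x₀`. Its argument is extended by constants outside
`[0, T]`, so that the integrand is a function on `ℝ`. -/
def picard (hF : IsCaratheodory (volume.restrict (Ioo 0 T)) F) (hT : 0 ≤ T) (x₀ : X)
    (w : C(Icc 0 T, X)) : C(Icc 0 T, X) where
  toFun t := x₀ + ∫ s in (0 : ℝ)..t, F s (IccExtend hT w s)
  continuous_toFun := by
    have h := intervalIntegral.continuousOn_primitive_interval'
      (hF.intervalIntegrable_IccExtend hT w (right_mem_Icc.2 hT)) left_mem_uIcc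
    rw [uIcc_of_le hT] at h
    exact continuous_const.add (continuousOn_iff_continuous_domRestrict.1 h)

variable (hF : IsCaratheodory (volume.restrict (Ioo 0 T)) F) (hT : 0 ≤ T) (x₀ : X)

lemma norm_picard_sub_picard_le {K : ℝ≥0}
    (hK : ∀ᵐ t ∂(volume.restrict (Ioo 0 T)), LipschitzWith K (F t)) {w z : C(Icc 0 T, X)}
    {g : ℝ → ℝ} (hg : Continuous g) (hwz : ∀ t : Icc 0 T, ‖w t - z t‖ ≤ g t) (t : Icc 0 T) :
    ‖picard hF hT x₀ w t - picard hF hT x₀ z t‖ ≤ ∫ s in (0 : ℝ)..t, K * g s := by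
  have hpoint : ∀ᵐ s, s ∈ Ioc 0 (t : ℝ) →
      ‖F s (IccExtend hT w s) - F s (IccExtend hT z s)‖ ≤ K * g s := by
    filter_upwards [(ae_restrict_iff' measurableSet_Ioo).1 hK, volume.ae_ne T] with s hs hsT hst
    have hsT : s ∈ Ioo 0 T := ⟨hst.1, (hst.2.trans t.2.2).lt_of_ne hsT⟩
    have hdist := (hs hsT).dist_le_mul (IccExtend hT w s) (IccExtend hT z s)
    rw [dist_eq_norm, dist_eq_norm] at hdist
    refine hdist.trans (mul_le_mul_of_nonneg_left ?_ K.2)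
    simpa only [IccExtend_of_mem _ _ (Ioo_subset_Icc_self hsT)] using hwz ⟨s, _⟩
  have hsub : picard hF hT x₀ w t - picard hF hT x₀ z t =
      ∫ s in (0 : ℝ)..t, (F s (IccExtend hT w s) - F s (IccExtend hT z s)) := by
    rw [intervalIntegral.integral_sub (hF.intervalIntegrable_IccExtend hT w t.2)
      (hF.intervalIntegrable_IccExtend hT z t.2)]
    exact add_sub_add_left_eq_sub _ _ _
  rw [hsub]
  exact intervalIntegral.norm_integral_le_of_norm_le t.2.1 hpoint
    ((continuous_const.mul hg).intervalIntegrable _ _)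

lemma norm_picard_iterate_sub_le {K : ℝ≥0}
    (hK : ∀ᵐ t ∂(volume.restrict (Ioo 0 T)), LipschitzWith K (F t)) (w z : C(Icc 0 T, X)) (n : ℕ)
    (t : Icc 0 T) :
    ‖(picard hF hT x₀)^[n] w t - (picard hF hT x₀)^[n] z t‖ ≤
      (K * (t : ℝ)) ^ n / n.factorial * dist w z := by
  induction n generalizing t with
  | zero =>
    simpa [← dist_eq_norm] using ContinuousMap.dist_apply_le_dist (f := w) (g := z) t
  | succ n ih =>
    rw [Function.iterate_succ_apply', Function.iterate_succ_apply']
    calc _ ≤ ∫ s in (0 : ℝ)..t, K * ((K * s) ^ n / n.factorial * dist w z) :=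
          norm_picard_sub_picard_le hF hT x₀ hK
            (g := fun s => (K * s) ^ n / n.factorial * dist w z) (by fun_prop) ih t
      _ = ∫ s in (0 : ℝ)..t, K ^ (n + 1) / n.factorial * dist w z * s ^ n := by
          congr with s
          rw [mul_pow]
          ring
      _ = (K * (t : ℝ)) ^ (n + 1) / (n + 1).factorial * dist w z := by
          rw [intervalIntegral.integral_const_mul, integral_pow, Nat.factorial_succ,
            zero_pow n.succ_ne_zero]
          push_cast
          field_simp
          ring

lemma exists_contractingWith_picard_iterate :
    ∃ (q : ℝ≥0) (n : ℕ), ContractingWith q (picard hF hT x₀)^[n] := by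
  obtain ⟨K, hK⟩ := hF.lipschitz
  obtain ⟨n, hn⟩ := ((FloorSemiring.tendsto_pow_div_factorial_atTop ((K : ℝ) * T)).eventually
    (gt_mem_nhds zero_lt_one)).exists
  have hq : 0 ≤ (K * T : ℝ) ^ n / n.factorial := by positivity
  refine ⟨⟨_, hq⟩, n, by exact_mod_cast hn, LipschitzWith.of_dist_le_mul fun w z =>
    (ContinuousMap.dist_le (mul_nonneg hq dist_nonneg)).2 fun t => ?_⟩
  rw [dist_eq_norm]
  refine (norm_picard_iterate_sub_le hF hT x₀ hK w z n t).trans ?_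
  have ht : 0 ≤ (t : ℝ) := t.2.1
  change (K * (t : ℝ)) ^ n / n.factorial * dist w z ≤ (K * T) ^ n / n.factorial * dist w z
  gcongr
  exact t.2.2

lemma exists_picard_eq_self [CompleteSpace X] : ∃ w, picard hF hT x₀ w = w := by
  obtain ⟨q, n, hn⟩ := exists_contractingWith_picard_iterate hF hT x₀
  have : Nonempty C(Icc 0 T, X) := ⟨0⟩
  exact ⟨_, hn.isFixedPt_fixedPoint_iterate⟩

end Picard

lemma IsCaratheodory.exists_density {X : Type*} [NormedAddCommGroup X] [NormedSpace ℝ X]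
    [SecondCountableTopology X] [CompleteSpace X] {T : ℝ} {F : ℝ → X → X}
    (hF : IsCaratheodory (volume.restrict (Ioo 0 T)) F) (hT : 0 ≤ T) (x₀ : X) :
    ∃ φ : ℝ → X, IntervalIntegrable φ volume 0 T ∧
      ∀ t ∈ Icc 0 T, φ t = F t (x₀ + ∫ s in (0 : ℝ)..t, φ s) := by
  obtain ⟨w, hw⟩ := exists_picard_eq_self hF hT x₀
  refine ⟨fun s => F s (IccExtend hT w s),
    hF.intervalIntegrable_IccExtend hT w (right_mem_Icc.2 hT), fun t ht => ?_⟩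
  have hwt : w ⟨t, ht⟩ = x₀ + ∫ s in (0 : ℝ)..t, F s (IccExtend hT w s) :=
    (DFunLike.congr_fun hw ⟨t, ht⟩).symm
  simp only [← hwt, IccExtend_of_mem _ _ ht]

lemma IsCaratheodory.exists_absolutelyContinuous_solution {ι : Type*} [Fintype ι] {T : ℝ}
    {F : ℝ → (ι → ℝ) → ι → ℝ} (hF : IsCaratheodory (volume.restrict (Ioo 0 T)) F) (hT : 0 ≤ T)
    (x₀ : ι → ℝ) :
    ∃ u : ℝ → ι → ℝ, (∀ i, AbsolutelyContinuousOnInterval (fun t => u t i) 0 T) ∧ u 0 = x₀ ∧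
      ∀ᵐ t ∂(volume.restrict (Ioo 0 T)), ∀ i, HasDerivAt (fun s => u s i) (F t (u t) i) t := by
  obtain ⟨φ, hφ, hφF⟩ := hF.exists_density hT x₀
  have hφi (i : ι) : IntervalIntegrable (fun t => φ t i) volume 0 T := ⟨hφ.1.eval i, hφ.2.eval i⟩
  have hu {t : ℝ} (ht : t ∈ Icc 0 T) :
      (fun i => x₀ i + ∫ s in (0 : ℝ)..t, φ s i) = x₀ + ∫ s in (0 : ℝ)..t, φ s := by
    ext i
    rw [Pi.add_apply, intervalIntegral.integral_of_le ht.1, intervalIntegral.integral_of_le ht.1,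
      eval_integral fun i => (hφi i).1.mono_set (Ioc_subset_Ioc_right ht.2)]
  refine ⟨fun t i => x₀ i + ∫ s in (0 : ℝ)..t, φ s i, fun i => ?_, by simp, ?_⟩
  · have hconst : AbsolutelyContinuousOnInterval (fun _ : ℝ => x₀ i) 0 T :=
      ((LipschitzWith.const (x₀ i)).lipschitzOnWith (s := uIcc 0 T)).absolutelyContinuousOnInterval
    exact hconst.add ((hφi i).absolutelyContinuousOnInterval_intervalIntegral left_mem_uIcc)
  · have hderiv := ae_all_iff.2 fun i => (hφi i).ae_hasDerivAt_integral
    filter_upwards [ae_restrict_of_ae hderiv, ae_restrict_mem measurableSet_Ioo] with t hder ht i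
    have ht' : t ∈ Icc 0 T := Ioo_subset_Icc_self ht
    rw [hu ht', ← hφF t ht']
    exact (hder i (uIcc_of_le hT ▸ ht') 0 left_mem_uIcc).const_add _

/-! ### Matrix representation of the forms -/

lemma integral_sum_mul_sum_mul {X ι κ : Type*} [Fintype ι] [Fintype κ] [MeasurableSpace X]
    {μ : Measure X} {f : ι → κ → X → ℝ} (hf : ∀ i j, Integrable (f i j) μ) (w : ι → ℝ)
    (v : κ → ℝ) :
    ∫ x, ∑ i, w i * ∑ j, f i j x * v j ∂μ = ∑ i, w i * ∑ j, (∫ x, f i j x ∂μ) * v j := by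
  have hrow : ∀ i, ∀ j ∈ Finset.univ, Integrable (fun x => f i j x * v j) μ :=
    fun i j _ => (hf i j).mul_const _
  rw [integral_finsetSum _ fun i _ => (integrable_finsetSum _ (hrow i)).const_mul _]
  refine Finset.sum_congr rfl fun i _ => ?_
  simp only [integral_const_mul, integral_finsetSum _ (hrow i), integral_mul_const]

namespace Triangulation

section Matrices

variable {d : ℕ} {Ω : Set (E d)} (𝒯 : Triangulation Ω) {M β : ℝ} {b : E d → E d} {g : E d → ℝ}

lemma ae_gradient_fe_eq_sum (hΩ : IsOpen Ω) (v : 𝒯.Node → ℝ) :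
    ∀ᵐ x ∂volume.restrict Ω, gradient (𝒯.fe v) x = ∑ j, v j • gradient (𝒯.hat j) x := by
  classical
  filter_upwards [𝒯.ae_mem_openCell hΩ] with x ⟨K, hK, hx⟩
  have hhat : ∀ j, HasGradientAt (𝒯.hat j) (𝒯.cellGrad K (Pi.single j 1)) x := fun j => by
    simpa only [𝒯.fe_single] using 𝒯.hasGradientAt_fe hK hx (Pi.single j 1)
  have hsum : HasFDerivAt (𝒯.fe v) (∑ j, v j • fderiv ℝ (𝒯.hat j) x) x :=
    HasFDerivAt.fun_sum fun j _ => (hhat j).hasFDerivAt.differentiableAt.hasFDerivAt.const_mul (v j)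
  simp only [gradient, hsum.fderiv, map_sum, map_smul]

lemma integrableOn_advection_hat (hΩ : IsOpen Ω) (hb : ContinuousOn b (closure Ω))
    (hM : ∀ x ∈ closure Ω, ‖b x‖ ≤ M) (i j : 𝒯.Node) :
    IntegrableOn (fun x => 𝒯.hat i x * ⟪b x, gradient (𝒯.hat j) x⟫) Ω := by
  classical
  simpa only [𝒯.fe_single] using
    𝒯.integrableOn_advection hΩ hb hM (Pi.single j 1) (Pi.single i 1)

lemma integral_advection_fe (hΩ : IsOpen Ω) (hb : ContinuousOn b (closure Ω))
    (hM : ∀ x ∈ closure Ω, ‖b x‖ ≤ M) (v w : 𝒯.Node → ℝ) :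
    ∫ x in Ω, 𝒯.fe w x * ⟪b x, gradient (𝒯.fe v) x⟫ =
      ∑ i, w i * ∑ j, (∫ x in Ω, 𝒯.hat i x * ⟪b x, gradient (𝒯.hat j) x⟫) * v j := by
  rw [← integral_sum_mul_sum_mul (𝒯.integrableOn_advection_hat hΩ hb hM)]
  refine integral_congr_ae ?_
  filter_upwards [𝒯.ae_gradient_fe_eq_sum hΩ v] with x hx
  simp only [hx, inner_sum, inner_smul_right, fe, Finset.sum_mul, Finset.mul_sum]
  rw [Finset.sum_comm]
  exact Finset.sum_congr rfl fun i _ => Finset.sum_congr rfl fun j _ => by ring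

variable [NeZero d]

lemma integrableOn_inlet_hat_mul_hat (hreg : interior (closure Ω) = Ω)
    (hb : ContinuousOn b (closure Ω)) (hM : ∀ x ∈ closure Ω, ‖b x‖ ≤ M) (i j : 𝒯.Node) :
    IntegrableOn (fun x => 𝒯.hat i x * 𝒯.hat j x * ⟪b x, outwardNormal Ω x⟫) (inlet Ω b)
      (surface Ω) := by
  classical
  simpa only [𝒯.fe_single] using
    𝒯.integrableOn_inlet_fe_mul_fe hreg hb hM (Pi.single j 1) (Pi.single i 1)

lemma integral_inlet_fe_mul_fe (hreg : interior (closure Ω) = Ω)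
    (hb : ContinuousOn b (closure Ω)) (hM : ∀ x ∈ closure Ω, ‖b x‖ ≤ M) (v w : 𝒯.Node → ℝ) :
    ∫ x in inlet Ω b, 𝒯.fe w x * 𝒯.fe v x * ⟪b x, outwardNormal Ω x⟫ ∂(surface Ω) =
      ∑ i, w i * ∑ j, (∫ x in inlet Ω b,
        𝒯.hat i x * 𝒯.hat j x * ⟪b x, outwardNormal Ω x⟫ ∂(surface Ω)) * v j := by
  rw [← integral_sum_mul_sum_mul (𝒯.integrableOn_inlet_hat_mul_hat hreg hb hM)]
  congr 1 with x
  simp only [fe, Finset.sum_mul, Finset.mul_sum]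
  rw [Finset.sum_comm]
  exact Finset.sum_congr rfl fun i _ => Finset.sum_congr rfl fun j _ => by ring

lemma aForm_fe (hreg : interior (closure Ω) = Ω) (hb : ContinuousOn b (closure Ω))
    (hM : ∀ x ∈ closure Ω, ‖b x‖ ≤ M) (v w : 𝒯.Node → ℝ) :
    aForm Ω b (𝒯.fe v) (𝒯.fe w) = ∑ i, w i * ∑ j, 𝒯.aMat b i j * v j := by
  rw [aForm, 𝒯.integral_advection_fe (hreg ▸ isOpen_interior) hb hM,
    𝒯.integral_inlet_fe_mul_fe hreg hb hM]
  simp only [aMat, aForm, sub_mul, Finset.sum_sub_distrib, mul_sub]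

lemma bForm_fe (hreg : interior (closure Ω) = Ω) (hb : ContinuousOn b (closure Ω))
    (hM : ∀ x ∈ closure Ω, ‖b x‖ ≤ M) (hg : ContinuousOn g (closure (inlet Ω b)))
    (hβ : ∀ x ∈ closure (inlet Ω b), |g x| ≤ β) (w : 𝒯.Node → ℝ) :
    bForm Ω b g (𝒯.fe w) = ∑ i, w i * 𝒯.bVec b g i := by
  classical
  have hintegrable : ∀ i, IntegrableOn (fun x => 𝒯.hat i x * g x * ⟪b x, outwardNormal Ω x⟫)
      (inlet Ω b) (surface Ω) := fun i => by
    simpa only [𝒯.fe_single] using 𝒯.integrableOn_inlet_fe_mul hreg hb hM hg hβ (Pi.single i 1)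
  simp only [bVec, bForm, fe, Finset.sum_mul, mul_assoc (w _), mul_neg, Finset.sum_neg_distrib]
  rw [integral_finsetSum _ fun i _ => (hintegrable i).const_mul _]
  simp only [integral_const_mul]

/-! ### Bounds for the matrices -/

omit [NeZero d] in
lemma exists_ae_norm_gradient_hat_le (hΩ : IsOpen Ω) :
    ∃ G : ℝ, ∀ i, ∀ᵐ x ∂volume.restrict Ω, ‖gradient (𝒯.hat i) x‖ ≤ G := by
  classical
  choose G hG using fun i => 𝒯.exists_ae_norm_gradient_fe_le hΩ (Pi.single i 1)
  refine ⟨∑ i, |G i|, fun i => ?_⟩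
  filter_upwards [hG i] with x hx
  rw [𝒯.fe_single] at hx
  exact hx.trans ((le_abs_self _).trans
    (Finset.single_le_sum (f := fun i => |G i|) (fun _ _ => abs_nonneg _) (Finset.mem_univ i)))

omit [NeZero d] in
lemma abs_hat_le_one (i : 𝒯.Node) (x : E d) : |𝒯.hat i x| ≤ 1 :=
  (abs_of_nonneg (𝒯.hat_nonneg i x)).trans_le (𝒯.hat_le_one i x)

include 𝒯 in
lemma abs_integral_inlet_le (hreg : interior (closure Ω) = Ω) (hb : ContinuousOn b (closure Ω))
    (hM : ∀ x ∈ closure Ω, ‖b x‖ ≤ M) {φ : E d → ℝ} {c : ℝ} (hc : 0 ≤ c)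
    (hφ : ∀ x ∈ inlet Ω b, |φ x| ≤ c) :
    |∫ x in inlet Ω b, φ x * ⟪b x, outwardNormal Ω x⟫ ∂(surface Ω)| ≤
      c * |M| * (surface Ω).real univ := by
  have := 𝒯.isFiniteMeasure_surface hreg
  have hinlet := measurableSet_inlet (hreg ▸ isOpen_interior) hb
  rw [← Real.norm_eq_abs (integral _ _)]
  refine (norm_setIntegral_le_of_norm_le_const_ae (C := c * |M|) (measure_lt_top _ _) ?_).trans
    (mul_le_mul_of_nonneg_left (measureReal_mono (μ := surface Ω) (subset_univ (inlet Ω b)))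
      (by positivity))
  filter_upwards [ae_restrict_mem hinlet] with x hx
  rw [norm_mul]
  exact mul_le_mul (hφ x hx) ((abs_normalVelocity_le hM hx.1).trans (le_abs_self M))
    (norm_nonneg _) hc

lemma exists_abs_aMat_le (hreg : interior (closure Ω) = Ω) (M : ℝ) :
    ∃ A : ℝ, ∀ b, ContinuousOn b (closure Ω) → (∀ x ∈ closure Ω, ‖b x‖ ≤ M) →
      ∀ i j, |𝒯.aMat b i j| ≤ A := by
  have hΩ : IsOpen Ω := hreg ▸ isOpen_interior
  obtain ⟨G, hG⟩ := 𝒯.exists_ae_norm_gradient_hat_le hΩ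
  refine ⟨M * G * volume.real Ω + 1 * |M| * (surface Ω).real univ, fun b hb hM i j => ?_⟩
  rw [aMat, aForm, ← Real.norm_eq_abs]
  refine (norm_sub_le _ _).trans (add_le_add ?_ ?_)
  · refine norm_setIntegral_le_of_norm_le_const_ae 𝒯.volume_lt_top ?_
    filter_upwards [hG j, ae_restrict_mem hΩ.measurableSet] with x hx hxΩ
    have hbx := hM x (subset_closure hxΩ)
    rw [norm_mul]
    exact (mul_le_of_le_one_left (norm_nonneg _) (𝒯.abs_hat_le_one i x)).trans
      ((norm_inner_le_norm _ _).trans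
        (mul_le_mul hbx hx (norm_nonneg _) ((norm_nonneg _).trans hbx)))
  · refine 𝒯.abs_integral_inlet_le hreg hb hM zero_le_one fun x _ => ?_
    rw [abs_mul]
    exact mul_le_one₀ (𝒯.abs_hat_le_one i x) (abs_nonneg _) (𝒯.abs_hat_le_one j x)

lemma abs_bVec_le (hreg : interior (closure Ω) = Ω) (hb : ContinuousOn b (closure Ω))
    (hM : ∀ x ∈ closure Ω, ‖b x‖ ≤ M) (hβ : ∀ x ∈ inlet Ω b, |g x| ≤ β) (i : 𝒯.Node) :
    |𝒯.bVec b g i| ≤ |β| * |M| * (surface Ω).real univ := by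
  rw [bVec, bForm, abs_neg]
  refine 𝒯.abs_integral_inlet_le hreg hb hM (abs_nonneg β) fun x hx => ?_
  rw [abs_mul]
  exact (mul_le_of_le_one_left (abs_nonneg _) (𝒯.abs_hat_le_one i x)).trans
    ((hβ x hx).trans (le_abs_self β))

end Matrices

section LocalBounds

variable {d : ℕ} {Ω : Set (E d)} (𝒯 : Triangulation Ω) {β : ℝ} {b : E d → E d} {g : E d → ℝ}

/-! ### Local bounds -/

lemma self_mem_stencil (hΩ : IsOpen Ω) (i : 𝒯.Node) : i ∈ 𝒯.stencil i := by
  simp [stencil, (𝒯.mass_self_pos hΩ i).ne']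

lemma mem_stencil_of_mem_stencil' {i j : 𝒯.Node} (h : j ∈ 𝒯.stencil' i) : j ∈ 𝒯.stencil i := by
  classical
  exact Finset.mem_of_mem_erase h

lemma abs_le_of_mem_localValues (hβ : ∀ x ∈ inlet Ω b, |g x| ≤ β) {v : 𝒯.Node → ℝ}
    {i : 𝒯.Node} {y : ℝ} (hy : y ∈ 𝒯.localValues b g v i) : |y| ≤ ‖v‖ + |β| := by
  rcases hy with ⟨j, -, rfl⟩ | ⟨x, hx, rfl⟩
  · exact (norm_le_pi_norm v j).trans (le_add_of_nonneg_right (abs_nonneg β))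
  · exact ((hβ x hx.1).trans (le_abs_self β)).trans (le_add_of_nonneg_left (norm_nonneg v))

lemma bddAbove_localValues (hβ : ∀ x ∈ inlet Ω b, |g x| ≤ β) (v : 𝒯.Node → ℝ) (i : 𝒯.Node) :
    BddAbove (𝒯.localValues b g v i) :=
  ⟨‖v‖ + |β|, fun _ hy => (le_abs_self _).trans (𝒯.abs_le_of_mem_localValues hβ hy)⟩

lemma nonempty_localValues (hΩ : IsOpen Ω) (b : E d → E d) (g : E d → ℝ) (v : 𝒯.Node → ℝ)
    (i : 𝒯.Node) : (𝒯.localValues b g v i).Nonempty :=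
  ⟨v i, Or.inl ⟨i, 𝒯.self_mem_stencil hΩ i, rfl⟩⟩

lemma le_uMax (hβ : ∀ x ∈ inlet Ω b, |g x| ≤ β) (v : 𝒯.Node → ℝ) {i j : 𝒯.Node}
    (hj : j ∈ 𝒯.stencil i) : v j ≤ 𝒯.uMax b g v i :=
  le_csSup (𝒯.bddAbove_localValues hβ v i) (Or.inl ⟨j, hj, rfl⟩)

lemma uMin_eq_neg_uMax (b : E d → E d) (g : E d → ℝ) (v : 𝒯.Node → ℝ) (i : 𝒯.Node) :
    𝒯.uMin b g v i = -𝒯.uMax b (-g) (-v) i := by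
  rw [uMin, uMax, Real.sInf_def, ← image_neg_eq_neg]
  simp only [localValues, image_union, image_image]
  rfl

lemma uMin_le (hβ : ∀ x ∈ inlet Ω b, |g x| ≤ β) (v : 𝒯.Node → ℝ) {i j : 𝒯.Node}
    (hj : j ∈ 𝒯.stencil i) : 𝒯.uMin b g v i ≤ v j := by
  rw [uMin_eq_neg_uMax, neg_le]
  exact 𝒯.le_uMax (g := -g) (fun x hx => (abs_neg (g x)).trans_le (hβ x hx)) (-v) hj

lemma abs_uMax_zero_le (hΩ : IsOpen Ω) (hβ : ∀ x ∈ inlet Ω b, |g x| ≤ β) (i : 𝒯.Node) :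
    |𝒯.uMax b g 0 i| ≤ |β| := by
  refine abs_le.2 ⟨(neg_nonpos.2 (abs_nonneg β)).trans
    (𝒯.le_uMax hβ 0 (𝒯.self_mem_stencil hΩ i)), csSup_le (𝒯.nonempty_localValues hΩ b g 0 i) ?_⟩
  intro y hy
  simpa only [norm_zero, zero_add] using
    (le_abs_self y).trans (𝒯.abs_le_of_mem_localValues hβ hy)

lemma lipschitzWith_uMax (hΩ : IsOpen Ω) (hβ : ∀ x ∈ inlet Ω b, |g x| ≤ β) (i : 𝒯.Node) :
    LipschitzWith 1 fun v => 𝒯.uMax b g v i := by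
  refine LipschitzWith.of_le_add fun v w => csSup_le (𝒯.nonempty_localValues hΩ b g v i) ?_
  rintro y (⟨j, hj, rfl⟩ | ⟨x, hx, rfl⟩)
  · have hdist : v j - w j ≤ dist v w := (le_abs_self _).trans (dist_le_pi_dist v w j)
    linarith [𝒯.le_uMax hβ w hj]
  · exact (le_csSup (𝒯.bddAbove_localValues hβ w i) (Or.inr ⟨x, hx, rfl⟩)).trans
      (le_add_of_nonneg_right dist_nonneg)

/-! ### Limited fluxes -/

lemma two_mul_dMat_mul_sub_barState (b : E d → E d) (v : 𝒯.Node → ℝ) {i j : 𝒯.Node} (hij : i ≠ j)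
    (m : ℝ) :
    2 * 𝒯.dMat b i j * (m - 𝒯.barState b v i j) =
      (𝒯.dMat b i j + 𝒯.aMat b i j) * (m - v i) + (𝒯.dMat b i j - 𝒯.aMat b i j) * (m - v j) := by
  rw [barState]
  by_cases h : 𝒯.dMat b i j = 0
  · have ha : 𝒯.aMat b i j = 0 := abs_nonpos_iff.1 ((𝒯.abs_aMat_le_dMat b hij).trans h.le)
    rw [h, ha]
    ring
  · field_simp
    ring

lemma two_mul_dMat_mul_sub_barState_nonneg (b : E d → E d) {v : 𝒯.Node → ℝ} {i j : 𝒯.Node}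
    (hij : i ≠ j) {m : ℝ} (hi : v i ≤ m) (hj : v j ≤ m) :
    0 ≤ 2 * 𝒯.dMat b i j * (m - 𝒯.barState b v i j) := by
  have ha := abs_le.1 (𝒯.abs_aMat_le_dMat b hij)
  rw [𝒯.two_mul_dMat_mul_sub_barState b v hij]
  exact add_nonneg (mul_nonneg (neg_le_iff_add_nonneg'.1 ha.1) (sub_nonneg.2 hi))
    (mul_nonneg (sub_nonneg.2 ha.2) (sub_nonneg.2 hj))

lemma two_mul_dMat_mul_sub_barState_nonpos (b : E d → E d) {v : 𝒯.Node → ℝ} {i j : 𝒯.Node}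
    (hij : i ≠ j) {m : ℝ} (hi : m ≤ v i) (hj : m ≤ v j) :
    2 * 𝒯.dMat b i j * (m - 𝒯.barState b v i j) ≤ 0 := by
  have ha := abs_le.1 (𝒯.abs_aMat_le_dMat b hij)
  rw [𝒯.two_mul_dMat_mul_sub_barState b v hij]
  exact add_nonpos (mul_nonpos_of_nonneg_of_nonpos (neg_le_iff_add_nonneg'.1 ha.1)
    (sub_nonpos.2 hi)) (mul_nonpos_of_nonneg_of_nonpos (sub_nonneg.2 ha.2) (sub_nonpos.2 hj))

/-- The upper bound `min {2 d_ij (u_i^max - ū_ij), 2 d_ij (ū_ji - u_j^min)}` that is imposed on the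
limited flux `f_ij^*`. -/
def fluxUpper (b : E d → E d) (g : E d → ℝ) (v : 𝒯.Node → ℝ) (i j : 𝒯.Node) : ℝ :=
  min (2 * 𝒯.dMat b i j * (𝒯.uMax b g v i - 𝒯.barState b v i j))
    (2 * 𝒯.dMat b i j * (𝒯.barState b v j i - 𝒯.uMin b g v j))

/-- The lower bound `max {2 d_ij (u_i^min - ū_ij), 2 d_ij (ū_ji - u_j^max)}` that is imposed on the
limited flux `f_ij^*`. -/
def fluxLower (b : E d → E d) (g : E d → ℝ) (v : 𝒯.Node → ℝ) (i j : 𝒯.Node) : ℝ :=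
  max (2 * 𝒯.dMat b i j * (𝒯.uMin b g v i - 𝒯.barState b v i j))
    (2 * 𝒯.dMat b i j * (𝒯.barState b v j i - 𝒯.uMax b g v j))

lemma fluxLower_eq_neg_fluxUpper (b : E d → E d) (g : E d → ℝ) (v : 𝒯.Node → ℝ) {i j : 𝒯.Node}
    (hij : i ≠ j) : 𝒯.fluxLower b g v i j = -𝒯.fluxUpper b g v j i := by
  rw [fluxUpper, fluxLower, 𝒯.dMat_comm b hij, min_comm, ← max_neg_neg]
  congr 1 <;> ring

lemma flux_swap (b : E d → E d) (v v' : 𝒯.Node → ℝ) {i j : 𝒯.Node} (hij : i ≠ j) :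
    𝒯.flux b v v' j i = -𝒯.flux b v v' i j := by
  rw [flux, flux, 𝒯.dMat_comm b hij, 𝒯.mass_comm i j]
  ring

lemma clamp_div_self_mem_Icc {l u : ℝ} (hl : l ≤ 0) (hu : 0 ≤ u) (f : ℝ) :
    max l (min f u) / f ∈ Icc 0 1 := by
  rcases le_or_gt 0 f with hf | hf
  · rw [max_eq_right (hl.trans (le_min hf hu))]
    exact ⟨div_nonneg (le_min hf hu) hf, div_le_one_of_le₀ (min_le_left _ _) hf⟩
  · rw [min_eq_left (hf.le.trans hu)]
    exact ⟨div_nonneg_of_nonpos (max_le hl hf.le) hf.le,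
      (div_le_one_of_neg hf).2 (le_max_right _ _)⟩

variable {i j : 𝒯.Node}

lemma fluxUpper_nonneg (hΩ : IsOpen Ω) (hβ : ∀ x ∈ inlet Ω b, |g x| ≤ β) (v : 𝒯.Node → ℝ)
    (hj : j ∈ 𝒯.stencil' i) : 0 ≤ 𝒯.fluxUpper b g v i j := by
  have hij := 𝒯.ne_of_mem_stencil' hj
  have hi := 𝒯.mem_stencil_of_mem_stencil' ((𝒯.mem_stencil'_comm i j).1 hj)
  refine le_min (𝒯.two_mul_dMat_mul_sub_barState_nonneg b hij
    (𝒯.le_uMax hβ v (𝒯.self_mem_stencil hΩ i))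
    (𝒯.le_uMax hβ v (𝒯.mem_stencil_of_mem_stencil' hj))) ?_
  have hmin := 𝒯.two_mul_dMat_mul_sub_barState_nonpos b hij.symm
    (𝒯.uMin_le hβ v (𝒯.self_mem_stencil hΩ j)) (𝒯.uMin_le hβ v hi)
  rw [𝒯.dMat_comm b hij]
  linarith

lemma fluxLower_nonpos (hΩ : IsOpen Ω) (hβ : ∀ x ∈ inlet Ω b, |g x| ≤ β) (v : 𝒯.Node → ℝ)
    (hj : j ∈ 𝒯.stencil' i) : 𝒯.fluxLower b g v i j ≤ 0 := by
  rw [𝒯.fluxLower_eq_neg_fluxUpper b g v (𝒯.ne_of_mem_stencil' hj), neg_nonpos]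
  exact 𝒯.fluxUpper_nonneg hΩ hβ v ((𝒯.mem_stencil'_comm i j).1 hj)

lemma mclFlux_eq_clamp (hΩ : IsOpen Ω) (hβ : ∀ x ∈ inlet Ω b, |g x| ≤ β) (v v' : 𝒯.Node → ℝ)
    (hj : j ∈ 𝒯.stencil' i) :
    𝒯.mclFlux b g v v' i j =
      max (𝒯.fluxLower b g v i j) (min (𝒯.flux b v v' i j) (𝒯.fluxUpper b g v i j)) := by
  have hu := 𝒯.fluxUpper_nonneg hΩ hβ v hj
  have hl := 𝒯.fluxLower_nonpos hΩ hβ v hj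
  rw [mclFlux]
  split_ifs with hf
  · exact (max_eq_right (hl.trans (le_min hf hu))).symm
  · rw [min_eq_left ((not_le.1 hf).le.trans hu), max_comm]
    rfl

lemma mclFlux_swap (hΩ : IsOpen Ω) (hβ : ∀ x ∈ inlet Ω b, |g x| ≤ β) (v v' : 𝒯.Node → ℝ)
    (hj : j ∈ 𝒯.stencil' i) : 𝒯.mclFlux b g v v' j i = -𝒯.mclFlux b g v v' i j := by
  have hij := 𝒯.ne_of_mem_stencil' hj
  have hle : 𝒯.fluxLower b g v i j ≤ 𝒯.fluxUpper b g v i j :=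
    (𝒯.fluxLower_nonpos hΩ hβ v hj).trans (𝒯.fluxUpper_nonneg hΩ hβ v hj)
  rw [𝒯.mclFlux_eq_clamp hΩ hβ v v' hj,
    𝒯.mclFlux_eq_clamp hΩ hβ v v' ((𝒯.mem_stencil'_comm i j).1 hj), 𝒯.flux_swap b v v' hij,
    𝒯.fluxLower_eq_neg_fluxUpper b g v hij.symm,
    ← neg_eq_iff_eq_neg.2 (𝒯.fluxLower_eq_neg_fluxUpper b g v hij), min_neg_neg, max_neg_neg,
    max_min_distrib_left, max_eq_right hle, min_comm, max_comm]

open Classical in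
/-- The correction factors `α_ij = f_ij^* / f_ij` of monolithic convex limiting; they are set to `0`
off the punctured stencil and, by the convention for division by zero, where `f_ij = 0`. -/
def mclFactor (b : E d → E d) (g : E d → ℝ) (v v' : 𝒯.Node → ℝ) (i j : 𝒯.Node) : ℝ :=
  if j ∈ 𝒯.stencil' i then 𝒯.mclFlux b g v v' i j / 𝒯.flux b v v' i j else 0

lemma mclFactor_mul_flux (hΩ : IsOpen Ω) (hβ : ∀ x ∈ inlet Ω b, |g x| ≤ β) (v v' : 𝒯.Node → ℝ)
    (hj : j ∈ 𝒯.stencil' i) :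
    𝒯.mclFactor b g v v' i j * 𝒯.flux b v v' i j = 𝒯.mclFlux b g v v' i j := by
  rw [mclFactor, if_pos hj]
  refine div_mul_cancel_of_imp fun hf => ?_
  rw [𝒯.mclFlux_eq_clamp hΩ hβ v v' hj, hf, min_eq_left (𝒯.fluxUpper_nonneg hΩ hβ v hj),
    max_eq_right (𝒯.fluxLower_nonpos hΩ hβ v hj)]

lemma isCorrection_mclFactor (hΩ : IsOpen Ω) (hβ : ∀ x ∈ inlet Ω b, |g x| ≤ β)
    (v v' : 𝒯.Node → ℝ) : 𝒯.IsCorrection (𝒯.mclFactor b g v v') := by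
  intro i j
  by_cases hj : j ∈ 𝒯.stencil' i
  · have hmem := clamp_div_self_mem_Icc (𝒯.fluxLower_nonpos hΩ hβ v hj)
      (𝒯.fluxUpper_nonneg hΩ hβ v hj) (𝒯.flux b v v' i j)
    rw [mclFactor, mclFactor, if_pos hj, if_pos ((𝒯.mem_stencil'_comm i j).1 hj),
      𝒯.flux_swap b v v' (𝒯.ne_of_mem_stencil' hj), 𝒯.mclFlux_swap hΩ hβ v v' hj, neg_div_neg_eq,
      𝒯.mclFlux_eq_clamp hΩ hβ v v' hj]
    exact ⟨rfl, hmem⟩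
  · rw [mclFactor, mclFactor, if_neg hj, if_neg fun hi => hj ((𝒯.mem_stencil'_comm i j).2 hi)]
    exact ⟨rfl, le_rfl, zero_le_one⟩

lemma isMCL_mclFactor (hΩ : IsOpen Ω) (hβ : ∀ x ∈ inlet Ω b, |g x| ≤ β) (v v' : 𝒯.Node → ℝ) :
    𝒯.IsMCL b g v v' (𝒯.mclFactor b g v v') :=
  ⟨𝒯.isCorrection_mclFactor hΩ hβ v v', fun _ _ hj => (𝒯.mclFactor_mul_flux hΩ hβ v v' hj).symm⟩

end LocalBounds

end Triangulation

/-! ### Measurability in time -/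

lemma aemeasurable_setIntegral_of_continuousOn {α X V : Type*} [MeasurableSpace α] {μ : Measure α}
    [TopologicalSpace X] [TopologicalSpace.MetrizableSpace X] [SecondCountableTopology X]
    [MeasurableSpace X] [BorelSpace X] [TopologicalSpace V]
    [TopologicalSpace.PseudoMetrizableSpace V] [MeasurableSpace V] [BorelSpace V] [Zero V]
    {S : Set X} (hS : MeasurableSet S) {f : α → X → V}
    (hm : ∀ x ∈ S, AEMeasurable (fun t => f t x) μ) (hc : ∀ᵐ t ∂μ, ContinuousOn (f t) S)
    {ν : Measure X} [IsFiniteMeasure ν] {g : V → X → ℝ} (hg : Measurable (Function.uncurry g)) :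
    AEMeasurable (fun t => ∫ x in S, g (f t x) x ∂ν) μ := by
  simp only [← integral_subtype_comap hS]
  refine aemeasurable_integral_of_continuous (f := fun t (y : S) => f t y)
    (g := fun V (y : S) => g V y) (fun y => hm y y.2) ?_
    (hg.comp (measurable_fst.prodMk (measurable_subtype_coe.comp measurable_snd)))
  filter_upwards [hc] with t ht
  exact continuousOn_iff_continuous_domRestrict.1 ht

lemma iSup_dense_eq_iSup {X : Type*} [TopologicalSpace X] {f : X → ℝ} (hf : LowerSemicontinuous f)
    (hbdd : BddAbove (range f)) {D : Set X} (hD : Dense D) : ⨆ x : D, f x = ⨆ x, f x := by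
  rcases isEmpty_or_nonempty X with hX | hX
  · rw [Real.iSup_of_isEmpty, Real.iSup_of_isEmpty]
  have := hD.nonempty.to_subtype
  have hbddD : BddAbove (range fun x : D => f x) :=
    hbdd.mono (range_subset_iff.2 fun x => mem_range_self (x : X))
  refine le_antisymm (ciSup_le fun x => le_ciSup hbdd (x : X))
    (ciSup_le fun x => le_of_forall_lt fun c hc => ?_)
  obtain ⟨y, hyD, hcy⟩ := hD.inter_nhds_nonempty (hf x c hc)
  exact lt_of_lt_of_le hcy (le_ciSup hbddD ⟨y, hyD⟩)

section Inlet

variable {d : ℕ} {Ω : Set (E d)} {b : E d → E d}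

lemma setIntegral_inlet (hΩ : IsOpen Ω) (hb : ContinuousOn b (closure Ω)) (φ : E d → ℝ) :
    ∫ x in inlet Ω b, φ x * ⟪b x, outwardNormal Ω x⟫ ∂(surface Ω) =
      ∫ x in regularBoundary Ω, φ x * min ⟪b x, outwardNormal Ω x⟫ 0 ∂(surface Ω) := by
  classical
  rw [← inter_eq_self_of_subset_right (inlet_subset_regularBoundary b),
    ← setIntegral_indicator (measurableSet_inlet hΩ hb)]
  refine setIntegral_congr_fun (measurableSet_regularBoundary hΩ) fun x hx => ?_
  by_cases h : ⟪b x, outwardNormal Ω x⟫ < 0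
  · simp only [indicator_of_mem (show x ∈ inlet Ω b from ⟨regularBoundary_subset hx, h⟩),
      min_eq_left h.le]
  · simp only [indicator_of_notMem (show x ∉ inlet Ω b from fun h' => h h'.2),
      min_eq_right (not_lt.1 h), mul_zero]

lemma inlet_mem_nhdsWithin (hΩ : IsOpen Ω) (hb : ContinuousOn b (closure Ω)) {x : E d}
    (hx : x ∈ inlet Ω b) : inlet Ω b ∈ 𝓝[regularBoundary Ω] x := by
  have hnear := (continuousOn_normalVelocity hΩ hb x
    (inlet_subset_regularBoundary b hx)).eventually (gt_mem_nhds hx.2)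
  filter_upwards [hnear, self_mem_nhdsWithin] with y hy hyR
  exact ⟨regularBoundary_subset hyR, hy⟩

lemma continuousWithinAt_regularBoundary_of_mem_inlet (hΩ : IsOpen Ω)
    (hb : ContinuousOn b (closure Ω)) {g : E d → ℝ} (hg : ContinuousOn g (closure (inlet Ω b)))
    {x : E d} (hx : x ∈ inlet Ω b) : ContinuousWithinAt g (regularBoundary Ω) x :=
  (hg.mono subset_closure x hx).mono_of_mem_nhdsWithin (inlet_mem_nhdsWithin hΩ hb hx)

end Inlet

/-- Transport data at a fixed time: a velocity `b` and inflow data `g`, continuous up to the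
boundary with the bounds `M` and `β`. -/
structure IsAdmissible {d : ℕ} (Ω : Set (E d)) (M β : ℝ) (b : E d → E d) (g : E d → ℝ) :
    Prop where
  continuousOn_velocity : ContinuousOn b (closure Ω)
  norm_velocity_le : ∀ x ∈ closure Ω, ‖b x‖ ≤ M
  continuousOn_inflow : ContinuousOn g (closure (inlet Ω b))
  abs_inflow_le_closure : ∀ x ∈ closure (inlet Ω b), |g x| ≤ β

namespace IsAdmissible

variable {d : ℕ} {Ω : Set (E d)} {M β : ℝ} {b : E d → E d} {g : E d → ℝ}

lemma abs_inflow_le (h : IsAdmissible Ω M β b g) : ∀ x ∈ inlet Ω b, |g x| ≤ β :=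
  fun x hx => h.abs_inflow_le_closure x (subset_closure hx)

lemma neg (h : IsAdmissible Ω M β b g) : IsAdmissible Ω M β b (-g) where
  continuousOn_velocity := h.continuousOn_velocity
  norm_velocity_le := h.norm_velocity_le
  continuousOn_inflow := h.continuousOn_inflow.neg
  abs_inflow_le_closure x hx := (abs_neg (g x)).trans_le (h.abs_inflow_le_closure x hx)

lemma abs_inflow_mul_min_le (h : IsAdmissible Ω M β b g) {x : E d} (hx : x ∈ frontier Ω) :
    |g x * min ⟪b x, outwardNormal Ω x⟫ 0| ≤ |β| * |min ⟪b x, outwardNormal Ω x⟫ 0| := by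
  rw [abs_mul]
  by_cases hxi : x ∈ inlet Ω b
  · exact mul_le_mul_of_nonneg_right ((h.abs_inflow_le x hxi).trans (le_abs_self β)) (abs_nonneg _)
  · rw [min_eq_right (not_lt.1 fun hneg => hxi ⟨hx, hneg⟩), abs_zero, mul_zero, mul_zero]

-- `g` is uncontrolled off the inlet, but the factor `min ⟪b, n⟫ 0` vanishes there.
lemma continuousOn_inflow_mul_min (hΩ : IsOpen Ω) (h : IsAdmissible Ω M β b g) :
    ContinuousOn (fun x => g x * min ⟪b x, outwardNormal Ω x⟫ 0) (regularBoundary Ω) := by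
  have hmin : ContinuousOn (fun x => min ⟪b x, outwardNormal Ω x⟫ 0) (regularBoundary Ω) :=
    (continuousOn_normalVelocity hΩ h.continuousOn_velocity).inf continuousOn_const
  intro x hx
  by_cases hxi : x ∈ inlet Ω b
  · exact (continuousWithinAt_regularBoundary_of_mem_inlet hΩ h.continuousOn_velocity
      h.continuousOn_inflow hxi).mul (hmin x hx)
  have hx0 : min ⟪b x, outwardNormal Ω x⟫ 0 = 0 :=
    min_eq_right (not_lt.1 fun hneg => hxi ⟨regularBoundary_subset hx, hneg⟩)
  have hlim := (hmin x hx).abs.const_mul |β|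
  rw [ContinuousWithinAt, hx0, abs_zero, mul_zero] at hlim
  rw [ContinuousWithinAt, hx0, mul_zero]
  refine squeeze_zero_norm' ?_ hlim
  filter_upwards [self_mem_nhdsWithin] with y hy
  exact h.abs_inflow_mul_min_le (regularBoundary_subset hy)

end IsAdmissible

/-- Measurable transport data on the time interval `(0,T)`, with an integrable bound `B` of the
inflow data. -/
structure IsTransportData {d : ℕ} (Ω : Set (E d)) (T M : ℝ) (B : ℝ → ℝ) (a : ℝ → E d → E d)
    (uin : ℝ → E d → ℝ) : Prop where
  velocity : ∀ x ∈ closure Ω, AEMeasurable (fun t => a t x) (volume.restrict (Ioo 0 T))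
  inflow : ∀ x ∈ frontier Ω, AEMeasurable (fun t => uin t x)
    (volume.restrict {t | t ∈ Ioo 0 T ∧ x ∈ inlet Ω (a t)})
  integrable_bound : Integrable B (volume.restrict (Ioo 0 T))
  admissible : ∀ᵐ t ∂(volume.restrict (Ioo 0 T)), IsAdmissible Ω M (B t) (a t) (uin t)

namespace IsTransportData

variable {d : ℕ} {Ω : Set (E d)} {T M : ℝ} {B : ℝ → ℝ} {a : ℝ → E d → E d} {uin : ℝ → E d → ℝ}

lemma neg (h : IsTransportData Ω T M B a uin) : IsTransportData Ω T M B a (-uin) where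
  velocity := h.velocity
  inflow x hx := (h.inflow x hx).neg
  integrable_bound := h.integrable_bound
  admissible := h.admissible.mono fun _ ht => ht.neg

lemma aemeasurable_normalVelocity (h : IsTransportData Ω T M B a uin) {x : E d}
    (hx : x ∈ frontier Ω) :
    AEMeasurable (fun t => ⟪a t x, outwardNormal Ω x⟫) (volume.restrict (Ioo 0 T)) :=
  (h.velocity x (frontier_subset_closure hx)).inner aemeasurable_const

lemma nullMeasurableSet_inlet (h : IsTransportData Ω T M B a uin) {x : E d}
    (hx : x ∈ frontier Ω) :
    NullMeasurableSet {t | x ∈ inlet Ω (a t)} (volume.restrict (Ioo 0 T)) := by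
  have heq : {t | x ∈ inlet Ω (a t)} = {t | ⟪a t x, outwardNormal Ω x⟫ < 0} :=
    Set.ext fun t => and_iff_right hx
  rw [heq]
  exact nullMeasurableSet_lt (h.aemeasurable_normalVelocity hx) aemeasurable_const

lemma aemeasurable_indicator_inflow (h : IsTransportData Ω T M B a uin) {x : E d}
    (hx : x ∈ frontier Ω) :
    AEMeasurable ({t | x ∈ inlet Ω (a t)}.indicator fun t => uin t x)
      (volume.restrict (Ioo 0 T)) := by
  have hinlet := h.nullMeasurableSet_inlet hx
  rw [aemeasurable_indicator_iff₀ hinlet, Measure.restrict_restrict₀ hinlet, inter_comm]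
  exact h.inflow x hx

lemma aemeasurable_inflow_mul_min (h : IsTransportData Ω T M B a uin) {x : E d}
    (hx : x ∈ frontier Ω) :
    AEMeasurable (fun t => uin t x * min ⟪a t x, outwardNormal Ω x⟫ 0)
      (volume.restrict (Ioo 0 T)) := by
  have hprod := (h.aemeasurable_indicator_inflow hx).mul
    ((h.aemeasurable_normalVelocity hx).min (aemeasurable_const (b := (0 : ℝ))))
  refine hprod.congr (Eventually.of_forall fun t => ?_)
  by_cases ht : x ∈ inlet Ω (a t)
  · simp [indicator_of_mem (show t ∈ {t | x ∈ inlet Ω (a t)} from ht)]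
  · simp [min_eq_right (not_lt.1 fun hneg => ht ⟨hx, hneg⟩)]

end IsTransportData

namespace Triangulation

section UpperBound

variable {d : ℕ} {Ω : Set (E d)} (𝒯 : Triangulation Ω) {M β : ℝ} {b : E d → E d} {g : E d → ℝ}

/-- The maximum of the nodal values `v` over the stencil of the node `i`. -/
def stencilMax (v : 𝒯.Node → ℝ) (i : 𝒯.Node) : ℝ := sSup (v '' {j | j ∈ 𝒯.stencil i})

/-- The excess of the inflow data `g` over the level `c` on `Γ_i⁻`, extended by zero. Unlike `g`, it
is lower semicontinuous on the regular part of the boundary. -/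
def inflowExcess (b : E d → E d) (g : E d → ℝ) (i : 𝒯.Node) (c : ℝ) : E d → ℝ :=
  (𝒯.inletAt b i).indicator fun x => max (g x - c) 0

lemma inflowExcess_nonneg (b : E d → E d) (g : E d → ℝ) (i : 𝒯.Node) (c : ℝ) (x : E d) :
    0 ≤ 𝒯.inflowExcess b g i c x :=
  indicator_nonneg (fun _ _ => le_max_right _ _) x

lemma inletAt_mem_nhdsWithin (hΩ : IsOpen Ω) (hb : ContinuousOn b (closure Ω)) {i : 𝒯.Node}
    {x : E d} (hx : x ∈ 𝒯.inletAt b i) : 𝒯.inletAt b i ∈ 𝓝[regularBoundary Ω] x := by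
  have hhat := ((𝒯.continuousOn_hat i).mono (regularBoundary_subset.trans frontier_subset_closure))
    x (inlet_subset_regularBoundary b hx.1)
  filter_upwards [inlet_mem_nhdsWithin hΩ hb hx.1, hhat.eventually (isOpen_ne.mem_nhds hx.2)]
    with y hy hy' using ⟨hy, hy'⟩

lemma lowerSemicontinuousOn_inflowExcess (hΩ : IsOpen Ω) (hb : ContinuousOn b (closure Ω))
    (hg : ContinuousOn g (closure (inlet Ω b))) (i : 𝒯.Node) (c : ℝ) :
    LowerSemicontinuousOn (𝒯.inflowExcess b g i c) (regularBoundary Ω) := by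
  intro x _
  by_cases hxi : x ∈ 𝒯.inletAt b i
  · have hcont : ContinuousWithinAt (fun y => max (g y - c) 0) (regularBoundary Ω) x :=
      ((continuousWithinAt_regularBoundary_of_mem_inlet hΩ hb hg hxi.1).sub_const c).max
        continuousWithinAt_const
    refine (hcont.congr_of_eventuallyEq ?_ (indicator_of_mem hxi _)).lowerSemicontinuousWithinAt
    filter_upwards [𝒯.inletAt_mem_nhdsWithin hΩ hb hxi] with y hy using indicator_of_mem hy _
  · intro y hy
    rw [inflowExcess, indicator_of_notMem hxi] at hy
    exact Eventually.of_forall fun z => hy.trans_le (𝒯.inflowExcess_nonneg b g i c z)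

lemma stencilMax_le_uMax (hΩ : IsOpen Ω) (hβ : ∀ x ∈ inlet Ω b, |g x| ≤ β) (v : 𝒯.Node → ℝ)
    (i : 𝒯.Node) : 𝒯.stencilMax v i ≤ 𝒯.uMax b g v i :=
  csSup_le_csSup (𝒯.bddAbove_localValues hβ v i) ⟨v i, i, 𝒯.self_mem_stencil hΩ i, rfl⟩
    subset_union_left

lemma inflowExcess_stencilMax_le (hΩ : IsOpen Ω) (hβ : ∀ x ∈ inlet Ω b, |g x| ≤ β)
    (v : 𝒯.Node → ℝ) (i : 𝒯.Node) (x : E d) :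
    𝒯.inflowExcess b g i (𝒯.stencilMax v i) x ≤ 𝒯.uMax b g v i - 𝒯.stencilMax v i := by
  have hV := sub_nonneg.2 (𝒯.stencilMax_le_uMax hΩ hβ v i)
  refine indicator_le' (fun x hx => max_le ?_ hV) (fun _ _ => hV) x
  gcongr
  exact le_csSup (𝒯.bddAbove_localValues hβ v i) (Or.inr ⟨x, hx, rfl⟩)

lemma uMax_eq_stencilMax_add_iSup (hΩ : IsOpen Ω) (hβ : ∀ x ∈ inlet Ω b, |g x| ≤ β)
    (v : 𝒯.Node → ℝ) (i : 𝒯.Node) :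
    𝒯.uMax b g v i = 𝒯.stencilMax v i +
      ⨆ x : regularBoundary Ω, 𝒯.inflowExcess b g i (𝒯.stencilMax v i) x := by
  set V := 𝒯.stencilMax v i
  have hle := 𝒯.inflowExcess_stencilMax_le hΩ hβ v i
  refine le_antisymm (csSup_le (𝒯.nonempty_localValues hΩ b g v i) ?_) (le_sub_iff_add_le'.1
    (Real.iSup_le (fun x => hle x) (sub_nonneg.2 (𝒯.stencilMax_le_uMax hΩ hβ v i))))
  rintro y (⟨j, hj, rfl⟩ | ⟨x, hx, rfl⟩)
  · exact le_add_of_le_of_nonneg (le_csSup ((toFinite _).image v).bddAbove ⟨j, hj, rfl⟩)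
      (Real.iSup_nonneg fun x => 𝒯.inflowExcess_nonneg b g i V x)
  · have hbdd : BddAbove (range fun x : regularBoundary Ω => 𝒯.inflowExcess b g i V x) :=
      ⟨_, forall_mem_range.2 fun x => hle x⟩
    have hexcess := le_ciSup hbdd ⟨x, inlet_subset_regularBoundary b hx.1⟩
    rw [inflowExcess, indicator_of_mem hx] at hexcess
    exact sub_le_iff_le_add'.1 ((le_max_left _ 0).trans hexcess)

-- A supremum over a fixed countable set, hence measurable with respect to parameters.
lemma uMax_eq_stencilMax_add_iSup_dense (hΩ : IsOpen Ω) (h : IsAdmissible Ω M β b g)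
    (v : 𝒯.Node → ℝ) (i : 𝒯.Node) {D : Set (regularBoundary Ω)} (hD : Dense D) :
    𝒯.uMax b g v i = 𝒯.stencilMax v i +
      ⨆ x : D, 𝒯.inflowExcess b g i (𝒯.stencilMax v i) (x : regularBoundary Ω) := by
  have hlsc := lowerSemicontinuous_restrict_iff.2
    (𝒯.lowerSemicontinuousOn_inflowExcess hΩ h.continuousOn_velocity h.continuousOn_inflow i
      (𝒯.stencilMax v i))
  rw [𝒯.uMax_eq_stencilMax_add_iSup hΩ h.abs_inflow_le]
  exact congrArg _ (iSup_dense_eq_iSup hlsc ⟨_, forall_mem_range.2 fun x =>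
    𝒯.inflowExcess_stencilMax_le hΩ h.abs_inflow_le v i x⟩ hD).symm

end UpperBound

section Time

variable {d : ℕ} {Ω : Set (E d)} (𝒯 : Triangulation Ω) {T M : ℝ} {B : ℝ → ℝ} {a : ℝ → E d → E d}
  {uin : ℝ → E d → ℝ}

lemma aemeasurable_integral_advection (hΩ : IsOpen Ω) (h : IsTransportData Ω T M B a uin)
    (i j : 𝒯.Node) :
    AEMeasurable (fun t => ∫ x in Ω, 𝒯.hat i x * ⟪a t x, gradient (𝒯.hat j) x⟫)
      (volume.restrict (Ioo 0 T)) := by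
  have : IsFiniteMeasure (volume.restrict Ω) := isFiniteMeasure_restrict.2 𝒯.volume_lt_top.ne
  simpa only [Measure.restrict_restrict hΩ.measurableSet, inter_self] using
    aemeasurable_setIntegral_of_continuousOn (ν := volume.restrict Ω) hΩ.measurableSet
      (g := fun V x => 𝒯.hat i x * ⟪V, gradient (𝒯.hat j) x⟫)
      (fun x hx => h.velocity x (subset_closure hx))
      (h.admissible.mono fun t ht => ht.continuousOn_velocity.mono subset_closure)
      (((𝒯.measurable_hat i).comp measurable_snd).mul
        (measurable_fst.inner ((measurable_gradient _).comp measurable_snd)))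

lemma aemeasurable_uMax (hΩ : IsOpen Ω) (h : IsTransportData Ω T M B a uin) (v : 𝒯.Node → ℝ)
    (i : 𝒯.Node) :
    AEMeasurable (fun t => 𝒯.uMax (a t) (uin t) v i) (volume.restrict (Ioo 0 T)) := by
  obtain ⟨D, hDc, hD⟩ := TopologicalSpace.exists_countable_dense (regularBoundary Ω)
  have := hDc.to_subtype
  have hexcess : ∀ x : D, AEMeasurable (fun t => 𝒯.inflowExcess (a t) (uin t) i
      (𝒯.stencilMax v i) (x : regularBoundary Ω)) (volume.restrict (Ioo 0 T)) := by
    classical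
    rintro ⟨⟨x, hxR⟩, -⟩
    have hx := regularBoundary_subset hxR
    by_cases hxi : 𝒯.hat i x = 0
    · simp [inflowExcess, inletAt, hxi]
    have hpos := (((h.aemeasurable_indicator_inflow hx).sub_const (𝒯.stencilMax v i)).max
      (aemeasurable_const (b := (0 : ℝ)))).indicator₀ (h.nullMeasurableSet_inlet hx)
    refine hpos.congr (Eventually.of_forall fun t => ?_)
    by_cases ht : x ∈ inlet Ω (a t) <;> simp [inflowExcess, inletAt, indicator, hxi, ht]
  refine ((AEMeasurable.iSup hexcess).const_add (𝒯.stencilMax v i)).congr ?_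
  filter_upwards [h.admissible] with t ht
  exact (𝒯.uMax_eq_stencilMax_add_iSup_dense hΩ ht v i hD).symm

variable [NeZero d]

lemma aemeasurable_aMat (hreg : interior (closure Ω) = Ω) (h : IsTransportData Ω T M B a uin)
    (i j : 𝒯.Node) :
    AEMeasurable (fun t => 𝒯.aMat (a t) i j) (volume.restrict (Ioo 0 T)) := by
  have hΩ : IsOpen Ω := hreg ▸ isOpen_interior
  have := 𝒯.isFiniteMeasure_surface hreg
  refine (𝒯.aemeasurable_integral_advection hΩ h i j).sub
    ((aemeasurable_setIntegral_of_continuousOn (ν := surface Ω) (measurableSet_regularBoundary hΩ)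
      (g := fun V x => 𝒯.hat i x * 𝒯.hat j x * min V 0)
      (fun x hx => h.aemeasurable_normalVelocity (regularBoundary_subset hx))
      (h.admissible.mono fun t ht => continuousOn_normalVelocity hΩ ht.continuousOn_velocity)
      ((((𝒯.measurable_hat i).comp measurable_snd).mul
        ((𝒯.measurable_hat j).comp measurable_snd)).mul
        (measurable_fst.min measurable_const))).congr ?_)
  filter_upwards [h.admissible] with t ht
  exact (setIntegral_inlet hΩ ht.continuousOn_velocity fun x => 𝒯.hat i x * 𝒯.hat j x).symm

lemma aemeasurable_bVec (hreg : interior (closure Ω) = Ω) (h : IsTransportData Ω T M B a uin)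
    (i : 𝒯.Node) :
    AEMeasurable (fun t => 𝒯.bVec (a t) (uin t) i) (volume.restrict (Ioo 0 T)) := by
  have hΩ : IsOpen Ω := hreg ▸ isOpen_interior
  have := 𝒯.isFiniteMeasure_surface hreg
  refine ((aemeasurable_setIntegral_of_continuousOn (ν := surface Ω)
    (measurableSet_regularBoundary hΩ) (g := fun V x => 𝒯.hat i x * V)
    (fun x hx => h.aemeasurable_inflow_mul_min (regularBoundary_subset hx))
    (h.admissible.mono fun t ht => ht.continuousOn_inflow_mul_min hΩ)
    (((𝒯.measurable_hat i).comp measurable_snd).mul measurable_fst)).congr ?_).neg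
  filter_upwards [h.admissible] with t ht
  rw [setIntegral_inlet hΩ ht.continuousOn_velocity fun x => 𝒯.hat i x * uin t x]
  simp only [mul_assoc]

end Time

end Triangulation

namespace Triangulation

variable {d : ℕ} {Ω : Set (E d)} (𝒯 : Triangulation Ω) {T M : ℝ} {B : ℝ → ℝ} {a : ℝ → E d → E d}
  {uin : ℝ → E d → ℝ}

/-! ### Global existence for monolithic convex limiting -/

lemma isCaratheodory_uMax (hΩ : IsOpen Ω) (h : IsTransportData Ω T M B a uin) (i : 𝒯.Node) :
    IsCaratheodory (volume.restrict (Ioo 0 T)) fun t v => 𝒯.uMax (a t) (uin t) v i where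
  aestronglyMeasurable v := (𝒯.aemeasurable_uMax hΩ h v i).aestronglyMeasurable
  lipschitz := ⟨1, h.admissible.mono fun _ ht => 𝒯.lipschitzWith_uMax hΩ ht.abs_inflow_le i⟩
  bound := ⟨fun t => |B t|, h.integrable_bound.abs,
    h.admissible.mono fun _ ht => 𝒯.abs_uMax_zero_le hΩ ht.abs_inflow_le i⟩

lemma isCaratheodory_uMin (hΩ : IsOpen Ω) (h : IsTransportData Ω T M B a uin) (i : 𝒯.Node) :
    IsCaratheodory (volume.restrict (Ioo 0 T)) fun t v => 𝒯.uMin (a t) (uin t) v i := by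
  simp only [uMin_eq_neg_uMax]
  exact (𝒯.isCaratheodory_uMax hΩ h.neg i).comp_neg.neg

variable [NeZero d]

lemma isCaratheodory_bVec (hreg : interior (closure Ω) = Ω) (h : IsTransportData Ω T M B a uin)
    (i : 𝒯.Node) :
    IsCaratheodory (volume.restrict (Ioo 0 T)) fun t (_ : 𝒯.Node → ℝ) =>
      𝒯.bVec (a t) (uin t) i := by
  have hbound := (h.integrable_bound.abs.mul_const |M|).mul_const ((surface Ω).real univ)
  refine .of_integrable (hbound.mono' (𝒯.aemeasurable_bVec hreg h i).aestronglyMeasurable ?_)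
  filter_upwards [h.admissible] with t ht
  exact 𝒯.abs_bVec_le hreg ht.continuousOn_velocity ht.norm_velocity_le ht.abs_inflow_le i

lemma ae_abs_aMat_le (hreg : interior (closure Ω) = Ω) (h : IsTransportData Ω T M B a uin) :
    ∃ A : ℝ, ∀ᵐ t ∂volume.restrict (Ioo 0 T), ∀ i j, |𝒯.aMat (a t) i j| ≤ A := by
  obtain ⟨A, hA⟩ := 𝒯.exists_abs_aMat_le hreg M
  exact ⟨A, h.admissible.mono fun t ht => hA _ ht.continuousOn_velocity ht.norm_velocity_le⟩

lemma isCaratheodory_aMat_mul (hreg : interior (closure Ω) = Ω)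
    (h : IsTransportData Ω T M B a uin) (i j : 𝒯.Node) {f : ℝ → (𝒯.Node → ℝ) → ℝ}
    (hf : IsCaratheodory (volume.restrict (Ioo 0 T)) f) :
    IsCaratheodory (volume.restrict (Ioo 0 T)) fun t v => 𝒯.aMat (a t) i j * f t v := by
  obtain ⟨A, hA⟩ := 𝒯.ae_abs_aMat_le hreg h
  exact hf.smul (𝒯.aemeasurable_aMat hreg h i j).aestronglyMeasurable
    (hA.mono fun t ht => ht i j)

lemma isCaratheodory_dMat_mul (hreg : interior (closure Ω) = Ω)
    (h : IsTransportData Ω T M B a uin) {i j : 𝒯.Node} (hij : i ≠ j) {f : ℝ → (𝒯.Node → ℝ) → ℝ}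
    (hf : IsCaratheodory (volume.restrict (Ioo 0 T)) f) :
    IsCaratheodory (volume.restrict (Ioo 0 T)) fun t v => 𝒯.dMat (a t) i j * f t v := by
  obtain ⟨A, hA⟩ := 𝒯.ae_abs_aMat_le hreg h
  simp only [𝒯.dMat_of_ne _ hij]
  refine hf.smul (A := A) ((𝒯.aemeasurable_aMat hreg h i j).abs.max
    (𝒯.aemeasurable_aMat hreg h j i).abs).aestronglyMeasurable (hA.mono fun t ht => ?_)
  rw [abs_of_nonneg (le_max_of_le_left (abs_nonneg _))]
  exact max_le (ht i j) (ht j i)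

lemma isCaratheodory_rate (hreg : interior (closure Ω) = Ω) (h : IsTransportData Ω T M B a uin)
    (ω : ℝ) (i : 𝒯.Node) :
    IsCaratheodory (volume.restrict (Ioo 0 T)) fun t v => 𝒯.rate ω (a t) (uin t) v i :=
  (((𝒯.isCaratheodory_bVec hreg h i).sub (.sum _ fun j _ =>
    𝒯.isCaratheodory_aMat_mul hreg h i j (.coord j))).const_smul _).add
    ((IsCaratheodory.sum _ fun j hj => 𝒯.isCaratheodory_dMat_mul hreg h (𝒯.ne_of_mem_stencil' hj)
      ((IsCaratheodory.coord j).sub (.coord i))).const_smul _)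

-- `d_ij ū_ij` is a combination of nodal values with coefficients `d_ij ± a_ij`, without division.
lemma isCaratheodory_two_mul_dMat_mul_sub_barState (hreg : interior (closure Ω) = Ω)
    (h : IsTransportData Ω T M B a uin) {i j : 𝒯.Node} (hij : i ≠ j) {f : ℝ → (𝒯.Node → ℝ) → ℝ}
    (hf : IsCaratheodory (volume.restrict (Ioo 0 T)) f) :
    IsCaratheodory (volume.restrict (Ioo 0 T)) fun t v =>
      2 * 𝒯.dMat (a t) i j * (f t v - 𝒯.barState (a t) v i j) := by
  have hi := hf.sub (.coord i)
  have hj := hf.sub (.coord j)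
  simp only [𝒯.two_mul_dMat_mul_sub_barState _ _ hij, add_mul, sub_mul]
  exact ((𝒯.isCaratheodory_dMat_mul hreg h hij hi).add
    (𝒯.isCaratheodory_aMat_mul hreg h i j hi)).add
    ((𝒯.isCaratheodory_dMat_mul hreg h hij hj).sub (𝒯.isCaratheodory_aMat_mul hreg h i j hj))

lemma isCaratheodory_fluxUpper (hreg : interior (closure Ω) = Ω)
    (h : IsTransportData Ω T M B a uin) {i j : 𝒯.Node} (hij : i ≠ j) :
    IsCaratheodory (volume.restrict (Ioo 0 T)) fun t v => 𝒯.fluxUpper (a t) (uin t) v i j := by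
  have hΩ : IsOpen Ω := hreg ▸ isOpen_interior
  have hi := 𝒯.isCaratheodory_two_mul_dMat_mul_sub_barState hreg h hij
    (𝒯.isCaratheodory_uMax hΩ h i)
  have hj := 𝒯.isCaratheodory_two_mul_dMat_mul_sub_barState hreg h hij.symm
    (𝒯.isCaratheodory_uMin hΩ h j)
  refine hi.min (hj.neg.congr (Eventually.of_forall fun t => funext fun v => ?_))
  rw [𝒯.dMat_comm (a t) hij, ← mul_neg, neg_sub]

lemma isCaratheodory_fluxLower (hreg : interior (closure Ω) = Ω)
    (h : IsTransportData Ω T M B a uin) {i j : 𝒯.Node} (hij : i ≠ j) :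
    IsCaratheodory (volume.restrict (Ioo 0 T)) fun t v => 𝒯.fluxLower (a t) (uin t) v i j := by
  simp only [𝒯.fluxLower_eq_neg_fluxUpper _ _ _ hij]
  exact (𝒯.isCaratheodory_fluxUpper hreg h hij.symm).neg

lemma isCaratheodory_flux_rate (hreg : interior (closure Ω) = Ω)
    (h : IsTransportData Ω T M B a uin) (ω : ℝ) {i j : 𝒯.Node} (hij : i ≠ j) :
    IsCaratheodory (volume.restrict (Ioo 0 T)) fun t v =>
      𝒯.flux (a t) v (𝒯.rate ω (a t) (uin t) v) i j :=
  (𝒯.isCaratheodory_dMat_mul hreg h hij ((IsCaratheodory.coord i).sub (.coord j))).add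
    (((𝒯.isCaratheodory_rate hreg h ω i).sub
      (𝒯.isCaratheodory_rate hreg h ω j)).const_smul (𝒯.mass i j))

lemma isCaratheodory_mclFlux_rate (hreg : interior (closure Ω) = Ω)
    (h : IsTransportData Ω T M B a uin) (ω : ℝ) {i j : 𝒯.Node} (hj : j ∈ 𝒯.stencil' i) :
    IsCaratheodory (volume.restrict (Ioo 0 T)) fun t v =>
      𝒯.mclFlux (a t) (uin t) v (𝒯.rate ω (a t) (uin t) v) i j := by
  have hij := 𝒯.ne_of_mem_stencil' hj
  refine ((𝒯.isCaratheodory_fluxLower hreg h hij).max ((𝒯.isCaratheodory_flux_rate hreg h ω hij).min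
    (𝒯.isCaratheodory_fluxUpper hreg h hij))).congr ?_
  filter_upwards [h.admissible] with t ht
  exact funext fun v => (𝒯.mclFlux_eq_clamp (hreg ▸ isOpen_interior) ht.abs_inflow_le v _ hj).symm

/-- The time derivative of the nodal values in the scheme with monolithic convex limiting. -/
def mclRhs (ω : ℝ) (b : E d → E d) (g : E d → ℝ) (v : 𝒯.Node → ℝ) (i : 𝒯.Node) : ℝ :=
  (𝒯.lumped i)⁻¹ * (𝒯.bVec b g i - ∑ j, 𝒯.aMat b i j * v j
    - ∑ j ∈ 𝒯.stencil' i, 𝒯.dMat b i j * (v i - v j)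
    + ∑ j ∈ 𝒯.stencil' i, 𝒯.mclFlux b g v (𝒯.rate ω b g v) i j)

lemma isCaratheodory_mclRhs (hreg : interior (closure Ω) = Ω)
    (h : IsTransportData Ω T M B a uin) (ω : ℝ) :
    IsCaratheodory (volume.restrict (Ioo 0 T)) fun t v => 𝒯.mclRhs ω (a t) (uin t) v :=
  .pi fun i => ((((𝒯.isCaratheodory_bVec hreg h i).sub (.sum _ fun j _ =>
    𝒯.isCaratheodory_aMat_mul hreg h i j (.coord j))).sub (.sum _ fun j hj =>
      𝒯.isCaratheodory_dMat_mul hreg h (𝒯.ne_of_mem_stencil' hj)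
        ((IsCaratheodory.coord i).sub (.coord j)))).add
    (.sum _ fun _ hj => 𝒯.isCaratheodory_mclFlux_rate hreg h ω hj)).const_smul _

omit [NeZero d] in
lemma sum_mclFlux_eq {b : E d → E d} {g : E d → ℝ} {v v' : 𝒯.Node → ℝ}
    {α : 𝒯.Node → 𝒯.Node → ℝ} (hα : 𝒯.IsMCL b g v v' α) (i : 𝒯.Node) :
    ∑ j ∈ 𝒯.stencil' i, 𝒯.mclFlux b g v v' i j =
      ∑ j ∈ 𝒯.stencil' i, 𝒯.dMat b i j * (v i - v j)
        - ∑ j ∈ 𝒯.stencil' i, (1 - α i j) * 𝒯.dMat b i j * (v i - v j)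
        + ∑ j ∈ 𝒯.stencil' i, α i j * 𝒯.mass i j * (v' i - v' j) := by
  rw [← Finset.sum_sub_distrib, ← Finset.sum_add_distrib]
  refine Finset.sum_congr rfl fun j hj => ?_
  rw [hα.2 i j hj, flux]
  ring

lemma mclRhs_weak (hreg : interior (closure Ω) = Ω) {β : ℝ} {b : E d → E d} {g : E d → ℝ}
    (h : IsAdmissible Ω M β b g) (ω : ℝ) {v : 𝒯.Node → ℝ} {α : 𝒯.Node → 𝒯.Node → ℝ}
    (hα : 𝒯.IsMCL b g v (𝒯.rate ω b g v) α) (w : 𝒯.Node → ℝ) :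
    ∑ i, w i * 𝒯.lumped i * 𝒯.mclRhs ω b g v i + aForm Ω b (𝒯.fe v) (𝒯.fe w) + 𝒯.dForm b α v w =
      bForm Ω b g (𝒯.fe w) + 𝒯.mForm α (𝒯.rate ω b g v) w := by
  have hb := h.continuousOn_velocity
  have hM := h.norm_velocity_le
  rw [𝒯.aForm_fe hreg hb hM, 𝒯.bForm_fe hreg hb hM h.continuousOn_inflow h.abs_inflow_le_closure,
    dForm, mForm, ← Finset.sum_add_distrib, ← Finset.sum_add_distrib, ← Finset.sum_add_distrib]
  refine Finset.sum_congr rfl fun i _ => ?_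
  rw [mclRhs, 𝒯.sum_mclFlux_eq hα, mul_assoc,
    mul_inv_cancel_left₀ (𝒯.lumped_pos (hreg ▸ isOpen_interior) i).ne']
  ring

lemma exists_mcl_solution (hreg : interior (closure Ω) = Ω) (hT : 0 ≤ T)
    (h : IsTransportData Ω T M B a uin) (u0 : E d → ℝ) (ω : ℝ) :
    ∃ (α : ℝ → 𝒯.Node → 𝒯.Node → ℝ) (u' u : ℝ → 𝒯.Node → ℝ),
      (∀ᵐ t ∂(volume.restrict (Ioo 0 T)), u' t = 𝒯.rate ω (a t) (uin t) (u t) ∧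
        𝒯.IsMCL (a t) (uin t) (u t) (u' t) (α t)) ∧
      𝒯.IsSolution a uin u0 T α α u' u := by
  obtain ⟨u, hac, hu0, hder⟩ :=
    (𝒯.isCaratheodory_mclRhs hreg h ω).exists_absolutelyContinuous_solution hT fun i => u0 i
  have hmcl : ∀ᵐ t ∂(volume.restrict (Ioo 0 T)), 𝒯.IsMCL (a t) (uin t) (u t)
      (𝒯.rate ω (a t) (uin t) (u t))
      (𝒯.mclFactor (a t) (uin t) (u t) (𝒯.rate ω (a t) (uin t) (u t))) := by
    filter_upwards [h.admissible] with t ht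
    exact 𝒯.isMCL_mclFactor (hreg ▸ isOpen_interior) ht.abs_inflow_le _ _
  refine ⟨_, _, u, hmcl.mono fun t ht => ⟨rfl, ht⟩, ?_⟩
  refine ⟨fun i => ?_, fun i s t hs hst ht => ?_, fun i => congrFun hu0 i, ?_⟩
  · exact (uIcc_of_le hT ▸ (hac i).continuousOn).mono Ico_subset_Icc_self
  · refine (hac i).mono ?_
    rw [uIcc_of_le hst, uIcc_of_le hT]
    exact Icc_subset_Icc hs.le ht.le
  · filter_upwards [h.admissible, hmcl, hder] with t ht hmclt hdert w
    simp only [fun i => (hdert i).deriv]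
    exact 𝒯.mclRhs_weak hreg ht ω hmclt w

end Triangulation

lemma IsPolytopalDomain.isCompact_closure {d : ℕ} {Ω : Set (E d)} (hΩ : IsPolytopalDomain Ω) :
    IsCompact (closure Ω) := by
  obtain ⟨S, hS⟩ := hΩ.polytopal
  rw [hS]
  exact S.finite_toSet.isCompact_biUnion fun P _ => P.finite_toSet.isCompact_convexHull ℝ

end AFC

end

theorem theorem1_general {d : ℕ} [NeZero d] {T : ℝ} (hT : 0 ≤ T) {Ω : Set (AFC.E d)}
    (hΩ : interior (closure Ω) = Ω) {a : ℝ → AFC.E d → AFC.E d} (ha : AFC.IsVelocity Ω T a)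
    {uin : ℝ → AFC.E d → ℝ} (huin : AFC.IsInflowData Ω T a uin) {u0 : AFC.E d → ℝ} {U : ℝ}
    (hu0 : ∀ x ∈ closure Ω, |u0 x| ≤ U) :
    ∃ C : ℝ≥0, ∀ 𝒯 : AFC.Triangulation Ω,
      (∀ γ h : ℝ, 0 ≤ γ → 0 ≤ h → ∀ τ ≤ T,
        ∀ (α β : ℝ → 𝒯.Node → 𝒯.Node → ℝ) (u' u : ℝ → 𝒯.Node → ℝ),
          (∀ᵐ t ∂(volume.restrict (Ioo 0 τ)), 𝒯.IsCorrection (α t) ∧ 𝒯.IsCorrection (β t)) →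
          𝒯.IsSolution a uin u0 τ α β u' u →
          (∀ᵐ t ∂(volume.restrict (Ioo 0 τ)),
            𝒯.GCC γ h (AFC.maxSpeed Ω T a) (a t) (α t) (β t) (u' t) (u t)) →
          ∀ t ∈ Ico 0 τ, eLpNorm (𝒯.fe (u t)) 2 (volume.restrict Ω) ≤ C) ∧
      ∀ ω : ℝ, ∃ (α : ℝ → 𝒯.Node → 𝒯.Node → ℝ) (u' u : ℝ → 𝒯.Node → ℝ),
        (∀ᵐ t ∂(volume.restrict (Ioo 0 T)),
          u' t = 𝒯.rate ω (a t) (uin t) (u t) ∧ 𝒯.IsMCL (a t) (uin t) (u t) (u' t) (α t)) ∧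
        𝒯.IsSolution a uin u0 T α α u' u := by
  obtain ⟨hameas, M, hM⟩ := ha
  obtain ⟨huinmeas, B, hB, hBuin⟩ := huin
  have hdata : AFC.IsTransportData Ω T M B a uin := by
    refine ⟨hameas, huinmeas, hB.integrable one_le_two, ?_⟩
    filter_upwards [hM, hBuin] with t hMt hBt using ⟨hMt.1, hMt.2.1, hBt.1, hBt.2⟩
  refine ⟨(√(AFC.energyBound Ω T M U B)).toNNReal, fun 𝒯 =>
    ⟨fun γ h hγ hh τ hτ α β u' u hαβ hsol hgcc t ht => ?_,
      𝒯.exists_mcl_solution hΩ hT hdata u0⟩⟩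
  exact hsol.eLpNorm_fe_le hΩ hτ hM hB.integrable_sq hBuin hu0 hγ hh ENNReal.toReal_nonneg hαβ
    hgcc ht

theorem theorem1 {d : ℕ} (hd : d = 1 ∨ d = 2 ∨ d = 3) {T : ℝ} (hT : 0 < T)
    {Ω : Set (AFC.E d)} (hΩ : AFC.IsPolytopalDomain Ω)
    {a : ℝ → AFC.E d → AFC.E d} (ha : AFC.IsVelocity Ω T a)
    {uin : ℝ → AFC.E d → ℝ} (huin : AFC.IsInflowData Ω T a uin)
    {u0 : AFC.E d → ℝ} (hu0 : ContinuousOn u0 (closure Ω)) :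
    ∃ C : ℝ≥0, ∀ (h : ℝ) (𝒯 : AFC.Triangulation Ω), 0 < h →
      (∀ K ∈ 𝒯.cells, Metric.diam (convexHull ℝ (K : Set (AFC.E d))) ≤ h) →
      -- stability, on every time interval `[0,τ)` of existence
      (∀ γ ∈ Ioo (0 : ℝ) 1, ∀ τ ∈ Ioc 0 T,
        ∀ (α β : ℝ → 𝒯.Node → 𝒯.Node → ℝ) (u' u : ℝ → 𝒯.Node → ℝ),
          (∀ᵐ t ∂(volume.restrict (Ioo 0 τ)), 𝒯.IsCorrection (α t) ∧ 𝒯.IsCorrection (β t)) →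
          𝒯.IsSolution a uin u0 τ α β u' u →
          (∀ᵐ t ∂(volume.restrict (Ioo 0 τ)),
            𝒯.GCC γ h (AFC.maxSpeed Ω T a) (a t) (α t) (β t) (u' t) (u t)) →
          ∀ t ∈ Ico 0 τ, eLpNorm (𝒯.fe (u t)) 2 (volume.restrict Ω) ≤ C) ∧
      -- global existence for monolithic convex limiting
      (∀ ω ∈ Icc (0 : ℝ) 1,
        ∃ (α : ℝ → 𝒯.Node → 𝒯.Node → ℝ) (u' u : ℝ → 𝒯.Node → ℝ),
          (∀ᵐ t ∂(volume.restrict (Ioo 0 T)),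
            u' t = 𝒯.rate ω (a t) (uin t) (u t) ∧
            𝒯.IsMCL (a t) (uin t) (u t) (u' t) (α t)) ∧
          𝒯.IsSolution a uin u0 T α α u' u) := by
  have : NeZero d := ⟨by lia⟩
  obtain ⟨U, hU⟩ := hΩ.isCompact_closure.exists_bound_of_continuousOn hu0
  obtain ⟨C, hC⟩ := theorem1_general hT.le (hΩ.lipschitz.interior_closure hΩ.isOpen) ha huin hU
  exact ⟨C, fun h 𝒯 hh _ => ⟨fun γ hγ τ hτ => (hC 𝒯).1 γ h hγ.1.le hh.le τ hτ.2,
    fun ω _ => (hC 𝒯).2 ω⟩⟩
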